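/- **Conventions.** Let $t\ge 0$, $T=\{1,\dots,t\}$, $\hat T=\{1,\dots,t+1\}$. A linear order $\mathbf c$ on $T$ is given by pairwise distinct natural numbers $c_1,\dots,c_t$ ($i$ precedes $j$ iff $c_i<c_j$). **Diagrams.** A diagram (of order $t+1$) is a sequence of columns $C_1,\dots,C_{t+1}$ of blocks with heights $ht\,C_i\in\mathbb N$; its height is $\max_i ht\,C_i$. For $p<q$, $C_p$ and $C_q$ are (left and right) neighbours at level $j$ if both have height $\ge j$ and every column strictly between them has height $<j$. Boundary conditions, always assumed: a column that is strictly higher than all columns to its left (resp. right) has even (resp. odd) height, or has the height of the diagram. The strongly extremal column is the leftmost (resp. rightmost) column of maximal height $r$ if $r$ is odd (resp. even). Diagrams are equivalent if they are related by the equivalence relation generated by * adding two blocks to a column $C$ of height $i$, where in the new diagram $C$ is, if $i$ is even, the left neighbour and, if $i$ is odd, the right neighbour of one and the same column at both levels $i+1,i+2$ (domino adjunction); * adding one block to the strongly extremal column; * cancelling two adjacent rows with the same number of blocks. A diagram is complete if no domino can be adjoined to it, and reduced if it has no two equal adjacent non-empty rows. $H$ is the set of equivalence classes, and $H_j\subset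 H$ is the set of classes whose strongly extremal column is $C_j$ (this does not depend on the representative). **Entries and relations.** Let $B(i,j)$ be the block of $C_i$ at level $j$. The rightmost block of an odd row and the leftmost block of an even row are called extremal and have no entry. Every other block has an entry $b(i,j)\in T$: $b(i,1)=i$; and $b(i,j+1)=b(k,j)$, where $C_k$ is the left ($j$ odd) or right ($j$ even) neighbour of $C_i$ at level $j$. Put $b(i,0)=i-1$ for $i\ge 2$. A diagram $\mathscr D$ gives a set $P(\mathscr D)$ of relations on $T$: for columns $C_p,C_q$ ($p<q$) that are neighbours at a level $j\ge1$, * if $j$ is even and $C_n$ is the left neighbour of $C_q$ at level $j-1$, then $b(q,j)<b(k,j-1)$ for all $k$ with $p\le k<n$ and $ht\,C_k\ge j-1$; * if $j$ is odd and $C_n$ is the right neighbour of $C_p$ at level $j-1$, then $b(p,j)<b(k,j-1)$ for all $k$ with $n<k\le q$ and $ht\,C_k\ge j-1$. $H(\mathbf c)\subset H$ is the set of classes of complete diagrams $\mathscr D$ such that all relations in $P(\mathscr D)$ hold in the order $\mathbf c$. **Labelled graphs.** Graphs are undirected, with labels $i_v\in\hat T$ on vertices and $i_{v,v'}\in T$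 on edges. In the graph of links $\mathscr G_H$ the vertices are the elements of $H$, a vertex in $H_j$ has label $j$, and two classes $x\in H_j$, $y\in H_k$, $j\neq k$, are joined by an edge with label $i$ if (for one of the two ways to name them) adding a single block to the top of $C_k$ in some complete reduced representative of $x$ gives a representative of $y$, the added block having the entry $i$. $\mathscr G_{H(\mathbf c)}$ is its subgraph formed by $H(\mathbf c)$ and all links between elements of $H(\mathbf c)$. **Binary fusion.** $\mathscr G(\mathbf c)$ is defined by induction on $t$. For $t=0$ it is one vertex with label $1$. For $t\geq 1$ let $c_s$ be the largest element of $\mathbf c$, let $\mathbf c^-$ be the order on $\{1,\dots,t-1\}$ obtained by removing $c_s$ and renumbering, and, for any $u$, let $\psi_u(j)=j$ for $j<u$ and $\psi_u(j)=j+1$ for $j\ge u$. Take two copies $\mathscr G^+,\mathscr G^-$ of $\mathscr G(\mathbf c^-)$, with edge labels changed by $\psi_s$ in both and vertex labels changed by $\psi_s$ in $\mathscr G^+$ and by $\psi_{s+1}$ in $\mathscr G^-$; join every vertex of $\mathscr G^+$ with label $s+1$ to its copy in $\mathscr G^-$ by an edge with label $s$. (So for $t=1$ one gets two vertices with labels $1,2$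 joined by an edge with label $1$.) **$S$-graphs.** A labelled graph $\mathscr G$ is an $S$-graph with respect to $\mathbf c$ if: * ($P_1$) adjacent vertices have distinct labels; * ($P_2$) each edge has one label, and distinct edges at a vertex have distinct labels; * ($P_3$) regarding $c_1,\dots,c_t$ as indeterminates, there is a map $v\mapsto f_v\in\bigoplus_{k\in\hat T,\,j\in T}\mathbb Z\,c_jm^k$ with $f_v-f_{v'}=c_{i_{v,v'}}(r^{i_v}-r^{i_{v'}})$ for every edge $(v,v')$, where $r^i-r^{i+1}=m^i+m^{i+1}$; * ($P_4$) there is exactly one sequence of vertices $v_{t+1},v_t,\dots,v_1$ with $i_{v_i}=i$ and with $(v_{i+1},v_i)$ an edge with label $i$; * ($P_5$) $\mathscr G$ is connected; * ($P_6$) if $a,b,d,e$ are distinct vertices and $(a,b),(b,d),(d,e)$ are edges with $i_{a,b}=i_{d,e}$ (a triad), then $i_a=i_e$; moreover $c_{i_{a,b}}<c_{i_{b,d}}$ for every triad; * ($P_7$) for every vertex $v'$ and every $k\in\hat T$ there are a vertex $v$ with $i_v=k$ and a path from $v'$ to $v$ along which the labels of successive edges strictly increase in the order $\mathbf c$. **Theorem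 8.5.** Let $\mathbf c$ be a linear order on $T$. There is exactly one injective map $\theta$ from the vertices of $\mathscr G(\mathbf c)$ to those of $\mathscr G_{H(\mathbf c)}$ that takes edges to edges and preserves all vertex and edge labels, and this $\theta$ is an isomorphism of labelled graphs of $\mathscr G(\mathbf c)$ onto $\mathscr G_{H(\mathbf c)}$. Both graphs are $S$-graphs with respect to $\mathbf c$; in particular $\mathscr G_{H(\mathbf c)}$ has all the $S$-graph properties $P_1$–$P_7$. Moreover $|H(\mathbf c)|=2^t$. -/

import Mathlib

/-! Throughout, `T = {1, …, t}` is modelled by `Fin t` and `T̂ = {1, …, t+1}` by `Fin (t+1)`, the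
label `i` being the element with value `i - 1`.  For `i : Fin t` the labels `i` and `i + 1` of `T̂`
are `i.castSucc` and `i.succ`.  A linear order on `T` is given by an injective `c : Fin t → ℕ`:
`i` precedes `j` when `c i < c j`. -/

/-! ### Labelled graphs -/

/-- An undirected graph with vertex set `V`, vertex labels in `T̂` and edge labels in `T`;
`edge v i v'` says that `v` and `v'` are joined by an edge with label `i`.  That the label of an
edge is well defined is part of the property `P2` below. -/
structure LabelledGraph (t : ℕ) (V : Type) where
  vlabel : V → Fin (t + 1)
  edge : V → Fin t → V → Prop
  symm : ∀ v i v', edge v i v' → edge v' i v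

namespace LabelledGraph

variable {t : ℕ} {V W : Type}

/-- The underlying unlabelled graph. -/
def toSimpleGraph (G : LabelledGraph t V) : SimpleGraph V :=
  SimpleGraph.fromRel (fun v v' => ∃ i, G.edge v i v')

/-- The subgraph on a set `S` of vertices, with all the edges between elements of `S`. -/
def restrict (G : LabelledGraph t V) (S : Set V) : LabelledGraph t S where
  vlabel v := G.vlabel v
  edge v i v' := G.edge v i v'
  symm v i v' h := G.symm v i v' h

/-- An injective map of vertices that takes edges to edges and preserves all labels. -/
structure IsLabelledEmbedding (G : LabelledGraph t V) (G' : LabelledGraph t W) (θ : V → W) :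
    Prop where
  injective : Function.Injective θ
  map_vlabel : ∀ v, G'.vlabel (θ v) = G.vlabel v
  map_edge : ∀ v i v', G.edge v i v' → G'.edge (θ v) i (θ v')

/-- A bijective map of vertices under which edges, vertex labels and edge labels correspond. -/
structure IsLabelledIso (G : LabelledGraph t V) (G' : LabelledGraph t W) (θ : V → W) :
    Prop where
  bijective : Function.Bijective θ
  map_vlabel : ∀ v, G'.vlabel (θ v) = G.vlabel v
  map_edge_iff : ∀ v i v', G'.edge (θ v) i (θ v') ↔ G.edge v i v'

/-! ### `S`-graphs -/

/-- Adjacent vertices have distinct labels. -/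
def P1 (G : LabelledGraph t V) : Prop :=
  ∀ v i v', G.edge v i v' → G.vlabel v ≠ G.vlabel v'

/-- Every edge has exactly one label, and distinct edges at a vertex have distinct labels. -/
def P2 (G : LabelledGraph t V) : Prop :=
  (∀ v i j v', G.edge v i v' → G.edge v j v' → i = j) ∧
    ∀ v i v' v'', G.edge v i v' → G.edge v i v'' → v' = v''

/-- The linear form `r^i` in the indeterminates `m^k`, as its family of coefficients: the form
`m^i + 2 ∑_{k > i} m^k`, so that `r^i - r^{i+1} = m^i + m^{i+1}`. -/
def rForm (i k : Fin (t + 1)) : ℤ :=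
  if k = i then 1 else if i < k then 2 else 0

/-- Evaluation: there is a map `v ↦ f_v` to the bilinear forms `∑ a_{k,j} c_j m^k` with integer
coefficients (`f v k j` is the coefficient of `c_j m^k` in `f_v`, the `c_j` being indeterminates)
such that `f_v - f_{v'} = c_i (r^{i_v} - r^{i_{v'}})` for every edge `(v, v')` with label `i`. -/
def P3 (G : LabelledGraph t V) : Prop :=
  ∃ f : V → Fin (t + 1) → Fin t → ℤ, ∀ v i v', G.edge v i v' → ∀ k j,
    f v k j - f v' k j =
      if j = i then rForm (G.vlabel v) k - rForm (G.vlabel v') k else 0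

/-- There is exactly one pointed chain `(v_{t+1}, v_t, …, v_1)`: `v_i` has the label `i` and
`v_{i+1}`, `v_i` are joined by an edge with label `i`. -/
def P4 (G : LabelledGraph t V) : Prop :=
  ∃! w : Fin (t + 1) → V, (∀ i, G.vlabel (w i) = i) ∧
    ∀ i : Fin t, G.edge (w i.succ) i (w i.castSucc)

/-- The graph is connected. -/
def P5 (G : LabelledGraph t V) : Prop :=
  G.toSimpleGraph.Connected

/-- A triad: four distinct vertices `a, b, d, e`, successively joined by edges with labels
`i, j, i`. -/
def IsTriad (G : LabelledGraph t V) (a b d e : V) (i j : Fin t) : Prop :=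
  [a, b, d, e].Nodup ∧ G.edge a i b ∧ G.edge b j d ∧ G.edge d i e

/-- The graph is triadic: the end vertices of a triad have the same label. -/
def P6 (G : LabelledGraph t V) : Prop :=
  ∀ a b d e i j, G.IsTriad a b d e i j → G.vlabel a = G.vlabel e

/-- The relations `i < j` given by the triads hold in the linear order `c`. -/
def TriadsLiftTo (G : LabelledGraph t V) (c : Fin t → ℕ) : Prop :=
  ∀ a b d e i j, G.IsTriad a b d e i j → c i < c j

/-- There is an ordered path from `v'` to `v`: the labels of its successive edges are strictly
increasing in the linear order `c`. -/
def HasOrderedPath (G : LabelledGraph t V) (c : Fin t → ℕ) (v' v : V) : Prop :=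
  ∃ (n : ℕ) (w : Fin (n + 1) → V) (e : Fin n → Fin t),
    w 0 = v' ∧ w (Fin.last n) = v ∧
    (∀ i : Fin n, G.edge (w i.castSucc) (e i) (w i.succ)) ∧
    StrictMono (fun i => c (e i))

/-- The `S` condition with respect to the linear order `c`. -/
def P7 (G : LabelledGraph t V) (c : Fin t → ℕ) : Prop :=
  ∀ (v' : V) (k : Fin (t + 1)), ∃ v, G.vlabel v = k ∧ G.HasOrderedPath c v' v

/-- `G` is an `S`-graph with respect to the linear order `c`, which lifts the relations given by
the triads of `G`. -/
structure IsSGraph (G : LabelledGraph t V) (c : Fin t → ℕ) : Prop where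
  p1 : G.P1
  p2 : G.P2
  p3 : G.P3
  p4 : G.P4
  p5 : G.P5
  p6 : G.P6
  lift : G.TriadsLiftTo c
  p7 : G.P7 c

/-! ### Binary fusion -/

/-- Binary fusion at `s`: two copies `𝒢⁺` (`Sum.inl`) and `𝒢⁻` (`Sum.inr`) of `G`.  Edge labels are
shifted by `ψ_s` (skip the value `s`) in both; vertex labels are shifted by `ψ^s` (skip `s`) in
`𝒢⁺` and by `ψ^{s+1}` (skip `s + 1`) in `𝒢⁻`.  Each vertex of `𝒢⁺` with label `s + 1` is joined to
its copy in `𝒢⁻` by an edge with label `s`. -/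
def binaryFusion (G : LabelledGraph t V) (s : Fin (t + 1)) : LabelledGraph (t + 1) (V ⊕ V) where
  vlabel
    | .inl v => s.castSucc.succAbove (G.vlabel v)
    | .inr v => s.succ.succAbove (G.vlabel v)
  edge
    | .inl v, i, .inl v' => ∃ j, G.edge v j v' ∧ i = s.succAbove j
    | .inr v, i, .inr v' => ∃ j, G.edge v j v' ∧ i = s.succAbove j
    | .inl v, i, .inr v' => v' = v ∧ i = s ∧ s.castSucc.succAbove (G.vlabel v) = s.succ
    | .inr v', i, .inl v => v' = v ∧ i = s ∧ s.castSucc.succAbove (G.vlabel v) = s.succ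
  symm
    | .inl _, _, .inl _, ⟨j, h, e⟩ => ⟨j, G.symm _ _ _ h, e⟩
    | .inr _, _, .inr _, ⟨j, h, e⟩ => ⟨j, G.symm _ _ _ h, e⟩
    | .inl _, _, .inr _, h => h
    | .inr _, _, .inl _, h => h

end LabelledGraph

/-- The vertices of the graph built by `t` binary fusions. -/
def FusionVertex : ℕ → Type
  | 0 => Unit
  | t + 1 => FusionVertex t ⊕ FusionVertex t

/-- The index of the largest element of `c`. -/
noncomputable def topIndex {t : ℕ} (c : Fin (t + 1) → ℕ) : Fin (t + 1) :=
  Classical.choose (Finite.exists_max c)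

/-- The graph `𝒢(c)`: remove the largest element `c_s` of `c`, renumber the others by `ψ_s`, and
apply binary fusion at `s` to the graph of the remaining order.  For `t = 0` it is a single vertex
with label `1`; hence for `t = 1` it consists of two vertices with labels `1` and `2`, joined by an
edge with label `1`. -/
noncomputable def fusionGraph : {t : ℕ} → (c : Fin t → ℕ) → LabelledGraph t (FusionVertex t)
  | 0, _ => { vlabel := fun _ => 0, edge := fun _ _ _ => False, symm := fun _ _ _ h => h }
  | _ + 1, c =>
    (fusionGraph (fun j => c ((topIndex c).succAbove j))).binaryFusion (topIndex c)

/-! ### Diagrams -/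

/-- A diagram of order `t + 1`: the heights of its columns `C_1, …, C_{t+1}`, subject to the left
and right boundary conditions (a column is left, resp. right, extremal if it has no neighbour to the
left, resp. right, at the level of its own height). -/
@[ext]
structure Diagram (t : ℕ) where
  ht : Fin (t + 1) → ℕ
  left_boundary : ∀ i, (∀ k < i, ht k < ht i) → Even (ht i) ∨ ht i = Finset.univ.sup ht
  right_boundary : ∀ i, (∀ k > i, ht k < ht i) → Odd (ht i) ∨ ht i = Finset.univ.sup ht

namespace Diagram

variable {t : ℕ}

/-- The height of the diagram: the maximal height of a column. -/
def height (D : Diagram t) : ℕ := Finset.univ.sup D.ht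

/-- `C_p` is the left neighbour of `C_q` at level `j` (and `C_q` the right neighbour of `C_p`). -/
def Neighbours (D : Diagram t) (j : ℕ) (p q : Fin (t + 1)) : Prop :=
  p < q ∧ j ≤ D.ht p ∧ j ≤ D.ht q ∧ ∀ k, p < k → k < q → D.ht k < j

/-- `D'` is obtained from `D` by adjoining a left even or a right odd (vertical) domino. -/
def DominoAdj (D D' : Diagram t) : Prop :=
  ∃ k, D'.ht = Function.update D.ht k (D.ht k + 2) ∧
    ((Even (D.ht k) ∧ ∃ q, D'.Neighbours (D.ht k + 1) k q ∧ D'.Neighbours (D.ht k + 2) k q) ∨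
      (Odd (D.ht k) ∧ ∃ p, D'.Neighbours (D.ht k + 1) p k ∧ D'.Neighbours (D.ht k + 2) p k))

/-- No left even or right odd domino can be adjoined. -/
def IsComplete (D : Diagram t) : Prop := ∀ D', ¬ D.DominoAdj D'

/-- `C_i` is the strongly extremal column: the leftmost (resp. rightmost) column of maximal height
`r` if `r` is odd (resp. even).  For the empty diagram it is `C_{t+1}`. -/
def IsStronglyExtremal (D : Diagram t) (i : Fin (t + 1)) : Prop :=
  D.ht i = D.height ∧
    ((Odd D.height ∧ ∀ k < i, D.ht k < D.height) ∨ (Even D.height ∧ ∀ k > i, D.ht k < D.height))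

/-- `D'` is obtained from `D` by adding a single block to the top of the column `C_k`. -/
def AddBlock (D : Diagram t) (k : Fin (t + 1)) (D' : Diagram t) : Prop :=
  D'.ht = Function.update D.ht k (D.ht k + 1)

/-- `D'` is obtained from `D` by half-domino adjunction. -/
def HalfDominoAdj (D D' : Diagram t) : Prop :=
  ∃ k, D.IsStronglyExtremal k ∧ D.AddBlock k D'

/-- The rows `R_{i+1}` and `R_{i+2}` have the same number of blocks (the upper one being contained
in the lower one). -/
def EqualRows (D : Diagram t) (i : ℕ) : Prop :=
  ∀ k, i + 1 ≤ D.ht k → i + 2 ≤ D.ht k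

/-- `D'` is obtained from `D` by cancelling two equal adjacent rows. -/
def RowCancel (D D' : Diagram t) : Prop :=
  ∃ i, D.EqualRows i ∧ D'.ht = fun k => if i + 2 ≤ D.ht k then D.ht k - 2 else D.ht k

/-- No two adjacent (non-empty) rows can be cancelled. -/
def IsReduced (D : Diagram t) : Prop :=
  ∀ i, i + 2 ≤ D.height → ¬ D.EqualRows i

/-- The moves that generate the equivalence of diagrams. -/
def Move (D D' : Diagram t) : Prop :=
  D.DominoAdj D' ∨ D.HalfDominoAdj D' ∨ D.RowCancel D'

theorem le_height (D : Diagram t) (i : Fin (t + 1)) : D.ht i ≤ D.height :=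
  Finset.le_sup (Finset.mem_univ i)

theorem exists_ht_eq (D : Diagram t) : ∃ i, D.ht i = D.height := by
  obtain ⟨i, -, h⟩ := Finset.exists_mem_eq_sup Finset.univ Finset.univ_nonempty D.ht
  exact ⟨i, h.symm⟩

theorem height_eq (D : Diagram t) {n : ℕ} (h : ∀ i, D.ht i ≤ n) {i : Fin (t + 1)}
    (hi : D.ht i = n) : D.height = n :=
  le_antisymm (Finset.sup_le fun k _ => h k) (hi ▸ D.le_height i)

theorem IsStronglyExtremal.unique {D : Diagram t} {i j : Fin (t + 1)}
    (hi : D.IsStronglyExtremal i) (hj : D.IsStronglyExtremal j) : i = j := by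
  obtain ⟨hi, ⟨ho, h1⟩ | ⟨he, h1⟩⟩ := hi <;> obtain ⟨hj, ⟨ho', h2⟩ | ⟨he', h2⟩⟩ := hj
  · have := h1 j
    have := h2 i
    omega
  · exact absurd he' (Nat.not_even_iff_odd.2 ho)
  · exact absurd he (Nat.not_even_iff_odd.2 ho')
  · have := h1 j
    have := h2 i
    omega

theorem exists_isStronglyExtremal (D : Diagram t) : ∃ i, D.IsStronglyExtremal i := by
  have hne : (Finset.univ.filter fun i => D.ht i = D.height).Nonempty := by
    obtain ⟨i, hi⟩ := D.exists_ht_eq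
    exact ⟨i, by simpa using hi⟩
  rcases Nat.even_or_odd D.height with he | ho
  · refine ⟨_, (Finset.mem_filter.1 (Finset.max'_mem _ hne)).2, Or.inr ⟨he, fun k hk => ?_⟩⟩
    refine lt_of_le_of_ne (D.le_height k) fun h => ?_
    exact absurd (Finset.le_max' _ k (by simpa using h)) (not_le.2 hk)
  · refine ⟨_, (Finset.mem_filter.1 (Finset.min'_mem _ hne)).2, Or.inl ⟨ho, fun k hk => ?_⟩⟩
    refine lt_of_le_of_ne (D.le_height k) fun h => ?_
    exact absurd (Finset.min'_le _ k (by simpa using h)) (not_le.2 hk)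

/-- The `x` co-ordinate of the unique strongly extremal column. -/
noncomputable def strongCol (D : Diagram t) : Fin (t + 1) :=
  Classical.choose D.exists_isStronglyExtremal

theorem strongCol_spec (D : Diagram t) : D.IsStronglyExtremal D.strongCol :=
  Classical.choose_spec D.exists_isStronglyExtremal

theorem DominoAdj.strong {D D' : Diagram t} (h : D.DominoAdj D') {i : Fin (t + 1)}
    (hi : D.IsStronglyExtremal i) : D'.IsStronglyExtremal i := by
  obtain ⟨k, hD, hk⟩ := h
  have hk' : D'.ht k = D.ht k + 2 := by simp [hD]
  have hne : ∀ j, j ≠ k → D'.ht j = D.ht j := fun j hj => by simp [hD, hj]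
  have hcol : ∃ q, q ≠ k ∧ D.ht k + 2 ≤ D.ht q ∧ ((Even (D.ht k) ∧ k < q) ∨
      (Odd (D.ht k) ∧ q < k)) := by
    rcases hk with ⟨he, q, -, h2⟩ | ⟨ho, q, -, h2⟩
    · have := h2.2.2.1
      rw [hne q h2.1.ne'] at this
      exact ⟨q, h2.1.ne', this, Or.inl ⟨he, h2.1⟩⟩
    · have := h2.2.1
      rw [hne q h2.1.ne] at this
      exact ⟨q, h2.1.ne, this, Or.inr ⟨ho, h2.1⟩⟩
  obtain ⟨q, hqk, hq, hside⟩ := hcol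
  have hqh := D.le_height q
  have hik : i ≠ k := by
    rintro rfl
    have := hi.1
    omega
  have hH : D'.height = D.height := by
    refine D'.height_eq (i := i) (fun j => ?_) (by rw [hne i hik, hi.1])
    by_cases hj : j = k
    · subst hj; omega
    · rw [hne j hj]; exact D.le_height j
  refine ⟨by rw [hne i hik, hH, hi.1], ?_⟩
  rw [hH]
  rcases hi.2 with ⟨ho, h1⟩ | ⟨he, h1⟩
  · refine Or.inl ⟨ho, fun j hj => ?_⟩
    by_cases hjk : j = k
    · subst hjk
      rcases hside with ⟨he, -⟩ | ⟨-, hlt⟩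
      · rcases he with ⟨a, ha⟩
        rcases ho with ⟨b, hb⟩
        omega
      · have := h1 q (hlt.trans hj)
        omega
    · rw [hne j hjk]; exact h1 j hj
  · refine Or.inr ⟨he, fun j hj => ?_⟩
    by_cases hjk : j = k
    · subst hjk
      rcases hside with ⟨-, hlt⟩ | ⟨ho, -⟩
      · have := h1 q (lt_trans hj hlt)
        omega
      · rcases he with ⟨a, ha⟩
        rcases ho with ⟨b, hb⟩
        omega
    · rw [hne j hjk]; exact h1 j hj

theorem HalfDominoAdj.strong {D D' : Diagram t} (h : D.HalfDominoAdj D') {i : Fin (t + 1)}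
    (hi : D.IsStronglyExtremal i) : D'.IsStronglyExtremal i := by
  obtain ⟨k, hk, hD⟩ := h
  obtain rfl := hk.unique hi
  have hk' : D'.ht k = D.height + 1 := by
    rw [hD]; simp [hk.1]
  have hne : ∀ j, j ≠ k → D'.ht j ≤ D.height := fun j hj => by
    rw [hD]; simpa [hj] using D.le_height j
  have hH : D'.height = D.height + 1 := by
    refine D'.height_eq (i := k) (fun j => ?_) hk'
    by_cases hj : j = k
    · subst hj; omega
    · have := hne j hj
      omega
  refine ⟨by rw [hk', hH], ?_⟩
  rw [hH]
  rcases Nat.even_or_odd (D.height + 1) with he | ho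
  · exact Or.inr ⟨he, fun j hj => Nat.lt_succ_of_le (hne j hj.ne')⟩
  · exact Or.inl ⟨ho, fun j hj => Nat.lt_succ_of_le (hne j hj.ne)⟩

theorem RowCancel.strong {D D' : Diagram t} (h : D.RowCancel D') {i : Fin (t + 1)}
    (hi : D.IsStronglyExtremal i) : D'.IsStronglyExtremal i := by
  obtain ⟨m, hrow, hD⟩ := h
  have hv : ∀ j, D'.ht j = if m + 2 ≤ D.ht j then D.ht j - 2 else D.ht j := fun j => by rw [hD]
  by_cases hm : m + 2 ≤ D.height
  · have hH : D'.height = D.height - 2 := by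
      refine D'.height_eq (i := i) (fun j => ?_) (by rw [hv, hi.1, if_pos hm])
      have h1 := hrow j
      have h2 := D.le_height j
      rw [hv]
      split_ifs <;> omega
    refine ⟨by rw [hv, hi.1, if_pos hm, hH], ?_⟩
    rw [hH]
    rcases hi.2 with ⟨ho, h1⟩ | ⟨he, h1⟩
    · have ho' : Odd (D.height - 2) := by
        rcases ho with ⟨a, ha⟩
        exact ⟨a - 1, by omega⟩
      refine Or.inl ⟨ho', fun j => ?_⟩
      induction j using WellFounded.induction (wellFounded_lt (α := Fin (t + 1))) with
      | _ j ih =>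
        intro hj
        have h2 := h1 j hj
        have h3 := hrow j
        have h4 : ¬ (D.ht j = m ∧ m + 2 = D.height) := by
          rintro ⟨h5, h6⟩
          have h8 : ∀ k < j, D.ht k < D.ht j := by
            intro k hk
            have h7 := ih k hk (hk.trans hj)
            have h9 := hrow k
            rw [hv] at h7
            split_ifs at h7 <;> [have := h1 k (hk.trans hj); skip] <;> omega
          rcases D.left_boundary j h8 with ⟨b, hb⟩ | hb
          · rcases ho with ⟨a, ha⟩
            omega
          · change D.ht j = D.height at hb
            omega
        rw [hv]
        split_ifs <;> omega
    · have he' : Even (D.height - 2) := by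
        rcases he with ⟨a, ha⟩
        exact ⟨a - 1, by omega⟩
      refine Or.inr ⟨he', fun j => ?_⟩
      induction j using WellFounded.induction (wellFounded_gt (α := Fin (t + 1))) with
      | _ j ih =>
        intro hj
        have h2 := h1 j hj
        have h3 := hrow j
        have h4 : ¬ (D.ht j = m ∧ m + 2 = D.height) := by
          rintro ⟨h5, h6⟩
          have h8 : ∀ k > j, D.ht k < D.ht j := by
            intro k hk
            have h7 := ih k hk (gt_trans hk hj)
            have h9 := hrow k
            rw [hv] at h7
            split_ifs at h7 <;> [have := h1 k (gt_trans hk hj); skip] <;> omega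
          rcases D.right_boundary j h8 with ⟨b, hb⟩ | hb
          · rcases he with ⟨a, ha⟩
            omega
          · change D.ht j = D.height at hb
            omega
        rw [hv]
        split_ifs <;> omega
  · have hv' : D'.ht = D.ht := by
      funext j
      have := D.le_height j
      rw [hv, if_neg (by omega)]
    have : D' = D := Diagram.ext hv'
    rwa [this]

/-- The strongly extremal column does not change under the moves. -/
theorem Move.strongCol_eq {D D' : Diagram t} (h : D.Move D') : D.strongCol = D'.strongCol := by
  refine IsStronglyExtremal.unique (D := D') ?_ D'.strongCol_spec
  rcases h with h | h | h
  · exact h.strong D.strongCol_spec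
  · exact h.strong D.strongCol_spec
  · exact h.strong D.strongCol_spec

/-! ### Tableaux -/

/-- `D.Entry j i b` says that the block `B(i, j)` of the tableau of `D` has the entry `b`.
A block has no entry (a diagonal slash) if it is the extremal one of its row: the rightmost one of
an odd row, the leftmost one of an even row.  `b(i, 1) = i` for `i ≤ t`; a block `B(i, j + 1)` that
is not extremal takes over the entry at level `j` of the left (`j` odd) or right (`j` even)
neighbour of `C_i` at level `j`.  Row `0` is the conventional one, with `b(i, 0) = i - 1` for
`i ≥ 2`. -/
inductive Entry (D : Diagram t) : ℕ → Fin (t + 1) → Fin t → Prop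
  | zero (i : Fin t) : Entry D 0 i.succ i
  | one (i : Fin t) : 1 ≤ D.ht i.castSucc → Entry D 1 i.castSucc i
  | fromLeft {j : ℕ} {i k : Fin (t + 1)} {b : Fin t} : Odd j → j + 1 ≤ D.ht i →
      (∃ p < i, j + 1 ≤ D.ht p) → D.Neighbours j k i → Entry D j k b → Entry D (j + 1) i b
  | fromRight {j : ℕ} {i k : Fin (t + 1)} {b : Fin t} : Even j → 0 < j → j + 1 ≤ D.ht i →
      (∃ q > i, j + 1 ≤ D.ht q) → D.Neighbours j i k → Entry D j k b → Entry D (j + 1) i b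

/-- `a < b` is one of the relations that generate the partial order of the tableau of `D`.
At an even level `l + 1`: `C_p`, `C_q` are neighbours at this level, `C_n` is the left neighbour of
`C_q` at level `l`, the entry `a` of `B(q, l + 1)` is the one of `B(n, l)`, and `b` is the entry at
level `l` of one of the other columns `C_k` reaching level `l` with `p ≤ k < q`, that is with
`p ≤ k < n`.  At an odd level `l + 1` the same holds with left and right interchanged. -/
def Rel (D : Diagram t) (a b : Fin t) : Prop :=
  ∃ (l : ℕ) (p q n k : Fin (t + 1)), D.Neighbours (l + 1) p q ∧ l ≤ D.ht k ∧ D.Entry l k b ∧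
    ((Odd l ∧ D.Neighbours l n q ∧ p ≤ k ∧ k < n ∧ D.Entry (l + 1) q a) ∨
      (Even l ∧ D.Neighbours l p n ∧ n < k ∧ k ≤ q ∧ D.Entry (l + 1) p a))

end Diagram

/-! ### Equivalence classes and the graph of links -/

/-- The set `H = H^{t+1}` of equivalence classes of diagrams of order `t + 1`: the quotient by the
equivalence relation generated by adjunction and removal of dominoes, of half-dominoes and of equal
adjacent rows. -/
def DiagramClass (t : ℕ) : Type := Quot (Diagram.Move (t := t))

namespace DiagramClass

variable {t : ℕ}

/-- The class of a diagram. -/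
def mk (D : Diagram t) : DiagramClass t := Quot.mk _ D

/-- The `j` for which the class lies in `H_j`: the `x` co-ordinate of the strongly extremal column
of any representative. -/
noncomputable def index (x : DiagramClass t) : Fin (t + 1) :=
  Quot.lift Diagram.strongCol (fun _ _ h => h.strongCol_eq) x

/-- Single block linkage from `x` to `y` with label `i`: adding a single block, with entry `i`, to
the top of a column `C_k` in a complete reduced representative `D` of `x` gives a representative
`D'` of `y`, where `x ∈ H_j`, `y ∈ H_k` and `k ≠ j`. -/
def Linkage (x : DiagramClass t) (i : Fin t) (y : DiagramClass t) : Prop :=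
  ∃ (D D' : Diagram t) (k : Fin (t + 1)), D.IsComplete ∧ D.IsReduced ∧ mk D = x ∧
    D.AddBlock k D' ∧ mk D' = y ∧ y.index = k ∧ x.index ≠ k ∧ D'.Entry (D'.ht k) k i

end DiagramClass

/-- The (undirected) graph of links `𝒢_H`. -/
noncomputable def linkGraph (t : ℕ) : LabelledGraph t (DiagramClass t) where
  vlabel := DiagramClass.index
  edge x i y := x.Linkage i y ∨ y.Linkage i x
  symm _ _ _ h := h.symm

/-- The set `H(c)` of classes of complete tableaux all of whose relations hold in the linear order
`c`. -/
def orderClasses {t : ℕ} (c : Fin t → ℕ) : Set (DiagramClass t) :=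
  {x | ∃ D : Diagram t, DiagramClass.mk D = x ∧ D.IsComplete ∧ ∀ a b, D.Rel a b → c a < c b}

/-- The graph `𝒢_{H(c)}`: the subgraph of `𝒢_H` with vertex set `H(c)`. -/
noncomputable def orderLinkGraph {t : ℕ} (c : Fin t → ℕ) : LabelledGraph t (orderClasses c) :=
  (linkGraph t).restrict (orderClasses c)

/-! A class of diagrams has a canonical numerical invariant, its depth function `d` on the columns
`0, …, t`, and the proof compares both graphs with the set of depth functions.

*Classes and depth functions.*  Below the top of a diagram every column `k` has a parent: the
nearest higher column to its right or left, according as its height is even or odd.  A domino can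
be adjoined to `k` precisely if its parent is at least two blocks higher.  Adjunctions to different
columns commute, so every diagram has a unique completion (`Diagram.completion_unique`).  In a
complete diagram of odd height `r` let the depth of a column be the difference of `r` and its
height.  Half-domino adjunction and row cancellation change the completion in a way that can be
made explicit with the help of `Diagram.exists_cascade`, and this shows that the depth function,
suitably defined also for even heights, depends only on the class
(`Diagram.Move.depth_completion_eq`) and determines it (`DiagramClass.depth_injective`).  The
functions that occur are the tight ones (`TightDepth`), and the strongly extremal column is the
first zero of `d`.

*Entries.*  In a complete diagram the neighbour from which a block takes its entry is always the
adjacent column.  Hence the blocks of the `i`-th column have the entry `i` at odd and `i - 1` at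
even levels, and the relations say that the entry of a block is the least element of the interval
of `T` between the columns in question.  So membership in `H(c)` becomes a condition on `d`,
`CompatDepth` (`DiagramClass.mem_orderClasses_iff`), and linkage becomes the explicit relation
`DepthLink` (`DiagramClass.linkGraph_edge_iff`).

*Fusion.*  Let `c_s` be the largest element of `c`.  Then the compatible tight depth functions for
`c` arise from those for the order without `c_s` by doubling the column `s`, in exactly two ways,
`expandPlus` and `expandMinus` (`exists_expansion`).  First zeros and links behave under these two
expansions as the labels and edges of the two copies in a binary fusion do.  By induction the
vertices of `𝒢(c)` correspond to the compatible tight depth functions for `c`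
(`exists_isLabelledIso_fusionGraph`).

*`S`-graphs.*  The properties of an `S`-graph are shown for `𝒢(c)` by induction on the number of
fusions (`LabelledGraph.fusionGraph_isSGraph`); `P3` is strengthened by a normalization for this
purpose.  They are transported by the isomorphism.  An embedding is determined by the unique
pointed chain and the edge labels (`LabelledGraph.IsLabelledEmbedding.unique`). -/

/-! ### Binary fusion and the properties of `S`-graphs -/

namespace LabelledGraph

variable {t : ℕ} {V W : Type}

/-- The condition in `binaryFusion` that a vertex of `𝒢⁺` has label `s + 1` says that its label in
`G` is `s`. -/
theorem succAbove_castSucc_eq_succ_iff (s u : Fin (t + 1)) :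
    s.castSucc.succAbove u = s.succ ↔ u = s := by
  constructor
  · intro h
    rw [← Fin.succAbove_castSucc_self] at h
    exact Fin.succAbove_right_injective h
  · rintro rfl
    exact Fin.succAbove_castSucc_self _

/-- The two copies of a vertex have the same label in the fusion, unless they are joined by an
edge. -/
theorem succAbove_castSucc_eq_succAbove_succ {s u : Fin (t + 1)} (h : u ≠ s) :
    s.castSucc.succAbove u = s.succ.succAbove u := by
  rw [Ne, Fin.ext_iff] at h
  simp only [Fin.succAbove, Fin.lt_def, Fin.val_castSucc, Fin.val_succ]
  split_ifs <;> first | rfl | omega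

section Fusion

variable {G : LabelledGraph t V} {s : Fin (t + 1)}

@[simp] theorem binaryFusion_vlabel_inl (v : V) :
    (G.binaryFusion s).vlabel (.inl v) = s.castSucc.succAbove (G.vlabel v) := rfl

@[simp] theorem binaryFusion_vlabel_inr (v : V) :
    (G.binaryFusion s).vlabel (.inr v) = s.succ.succAbove (G.vlabel v) := rfl

@[simp] theorem binaryFusion_edge_inl_inl (v v' : V) (i : Fin (t + 1)) :
    (G.binaryFusion s).edge (.inl v) i (.inl v') ↔ ∃ j, G.edge v j v' ∧ i = s.succAbove j :=
  Iff.rfl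

@[simp] theorem binaryFusion_edge_inr_inr (v v' : V) (i : Fin (t + 1)) :
    (G.binaryFusion s).edge (.inr v) i (.inr v') ↔ ∃ j, G.edge v j v' ∧ i = s.succAbove j :=
  Iff.rfl

@[simp] theorem binaryFusion_edge_inl_inr (v v' : V) (i : Fin (t + 1)) :
    (G.binaryFusion s).edge (.inl v) i (.inr v') ↔ v' = v ∧ i = s ∧ G.vlabel v = s := by
  rw [← succAbove_castSucc_eq_succ_iff s (G.vlabel v)]
  exact Iff.rfl

@[simp] theorem binaryFusion_edge_inr_inl (v v' : V) (i : Fin (t + 1)) :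
    (G.binaryFusion s).edge (.inr v') i (.inl v) ↔ v' = v ∧ i = s ∧ G.vlabel v = s := by
  rw [← succAbove_castSucc_eq_succ_iff s (G.vlabel v)]
  exact Iff.rfl

theorem P1.binaryFusion (h : G.P1) (s : Fin (t + 1)) : (G.binaryFusion s).P1 := by
  rintro (v | v) i (v' | v')
  · rintro ⟨j, hj, -⟩ h'
    exact h _ _ _ hj (Fin.succAbove_right_injective h')
  · rw [binaryFusion_edge_inl_inr]
    rintro ⟨rfl, rfl, hs⟩
    simp [hs, Fin.ext_iff]
  · rw [binaryFusion_edge_inr_inl]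
    rintro ⟨rfl, rfl, hs⟩
    simp [hs, Fin.ext_iff]
  · rintro ⟨j, hj, -⟩ h'
    exact h _ _ _ hj (Fin.succAbove_right_injective h')

theorem P2.binaryFusion (h : G.P2) (s : Fin (t + 1)) : (G.binaryFusion s).P2 := by
  refine ⟨?_, ?_⟩
  · rintro (v | v) i j (v' | v') <;> simp
    · rintro i' h1 rfl j' h2 rfl
      rw [h.1 _ _ _ _ h1 h2]
    · rintro rfl rfl - - rfl -
      rfl
    · rintro rfl rfl - - rfl -
      rfl
    · rintro i' h1 rfl j' h2 rfl
      rw [h.1 _ _ _ _ h1 h2]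
  · rintro (v | v) i (v' | v') (v'' | v'') <;> simp
    · rintro i' h1 rfl j' h2 h3
      obtain rfl := Fin.succAbove_right_injective h3
      exact h.2 _ _ _ _ h1 h2
    · rintro i' h1 rfl - h3
      exact absurd h3 (Fin.succAbove_ne _ _)
    · rintro rfl rfl - i' h1 h3
      exact absurd h3.symm (Fin.succAbove_ne _ _)
    · rintro rfl rfl - rfl - -
      rfl
    · rintro rfl rfl - rfl - -
      rfl
    · rintro rfl rfl - i' h1 h3
      exact absurd h3.symm (Fin.succAbove_ne _ _)
    · rintro i' h1 rfl - h3
      exact absurd h3 (Fin.succAbove_ne _ _)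
    · rintro i' h1 rfl j' h2 h3
      obtain rfl := Fin.succAbove_right_injective h3
      exact h.2 _ _ _ _ h1 h2

/-- A sharpening of `P3` that is inherited by binary fusions.  The forms `f_v` are written as
`∑ a_{k,j} c_j r^k`, with `a v k j` the coefficient of `c_j r^k`, so that an edge with label `i` from
`v` to `v'` changes only two coefficients by `1`; and `f_v` is normalized so as not to involve
`r^{i_v}`, where `i_v` is the label of `v`. -/
def NormalizedEvaluation (G : LabelledGraph t V) : Prop :=
  ∃ a : V → Fin (t + 1) → Fin t → ℤ,
    (∀ v i v', G.edge v i v' → ∀ k j, a v k j - a v' k j =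
      if j = i then (if k = G.vlabel v then 1 else 0) - (if k = G.vlabel v' then 1 else 0) else 0) ∧
    ∀ v j, a v (G.vlabel v) j = 0

theorem NormalizedEvaluation.p3 (h : G.NormalizedEvaluation) : G.P3 := by
  obtain ⟨a, ha, -⟩ := h
  refine ⟨fun v k j => ∑ k', a v k' j * rForm k' k, fun v i v' hv k j => ?_⟩
  rw [← Finset.sum_sub_distrib]
  simp_rw [← sub_mul, ha v i v' hv]
  split_ifs
  · simp [sub_mul, Finset.sum_sub_distrib]
  · simp

theorem NormalizedEvaluation.binaryFusion (h : G.NormalizedEvaluation) (s : Fin (t + 1)) :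
    (G.binaryFusion s).NormalizedEvaluation := by
  obtain ⟨a, ha, h0⟩ := h
  -- The copy of `v` whose labels skip `p` takes over the coefficients of `f_v`.  In the row of
  -- `r^p`, which is new, the coefficient of `c_s` has to be `-1`: that of the other end of an edge
  -- with label `s`, whose label is `p`, is `0` there.
  let b (p : Fin (t + 2)) (v : V) : Fin (t + 2) → Fin (t + 1) → ℤ :=
    p.insertNth (s.insertNth (α := fun _ => ℤ) (-1) fun _ => 0)
      fun k => s.insertNth (α := fun _ => ℤ) 0 (a v k)
  have b1 : ∀ p v, b p v p s = -1 := fun p v => by simp [b]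
  have b2 : ∀ p v j, b p v p (s.succAbove j) = 0 := fun p v j => by simp [b]
  have b3 : ∀ p v k, b p v (p.succAbove k) s = 0 := fun p v k => by simp [b]
  have b4 : ∀ p v k j, b p v (p.succAbove k) (s.succAbove j) = a v k j := fun p v k j => by
    simp [b]
  have b5 : ∀ p v k j, b p v (p.succAbove k) j = s.insertNth (α := fun _ => ℤ) 0 (a v k) j :=
    fun p v k j => by simp [b]
  have same : ∀ p v i v', G.edge v i v' → ∀ k j, b p v k j - b p v' k j =
      if j = s.succAbove i then (if k = p.succAbove (G.vlabel v) then 1 else 0) -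
        (if k = p.succAbove (G.vlabel v') then 1 else 0) else 0 := by
    intro p v i v' hv k j
    induction k using Fin.succAboveCases p with
    | x =>
      induction j using Fin.succAboveCases s with
      | x => simp [b1, Fin.ne_succAbove]
      | p j => simp [b2, Fin.ne_succAbove]
    | p k =>
      induction j using Fin.succAboveCases s with
      | x => simp [b3, Fin.ne_succAbove]
      | p j => simp [b4, ha v i v' hv]
  -- Both copies of a vertex with label `s` have the row of `s` in `G`, which is zero by the
  -- normalization, in place of the row of the label of the copy.
  have cross : ∀ v, G.vlabel v = s → ∀ k j, b s.castSucc v k j - b s.succ v k j =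
      if j = s then (if k = s.succ then 1 else 0) - (if k = s.castSucc then 1 else 0) else 0 := by
    intro v hv k j
    have hne : s.castSucc ≠ s.succ := by simp [Fin.ext_iff]
    have e1 : s.castSucc = s.succ.succAbove s := by simp
    have e2 : s.succ = s.castSucc.succAbove s := by simp
    have h0' : ∀ j, a v s j = 0 := fun j => by rw [← h0 v j, hv]
    by_cases hk : k = s.castSucc
    · subst hk
      have e3 : b s.succ v s.castSucc j = s.insertNth (α := fun _ => ℤ) 0 (a v s) j := by
        have := b5 s.succ v s j
        rwa [← e1] at this
      rw [e3]
      induction j using Fin.succAboveCases s with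
      | x => simp [b1, hne]
      | p j => simp [b2, h0']
    by_cases hk' : k = s.succ
    · subst hk'
      have e3 : b s.castSucc v s.succ j = s.insertNth (α := fun _ => ℤ) 0 (a v s) j := by
        have := b5 s.castSucc v s j
        rwa [← e2] at this
      rw [e3]
      induction j using Fin.succAboveCases s with
      | x => simp [b1, hne.symm]
      | p j => simp [b2, h0']
    obtain ⟨k', rfl⟩ := Fin.exists_succAbove_eq hk
    have hk2 : k' ≠ s := by rintro rfl; exact hk' (by simp)
    rw [if_neg hk, if_neg hk']
    have e3 : b s.castSucc v (s.castSucc.succAbove k') j =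
        b s.succ v (s.castSucc.succAbove k') j := by
      rw [b5, succAbove_castSucc_eq_succAbove_succ hk2, b5]
    rw [e3]
    simp
  refine ⟨fun | .inl v => b s.castSucc v | .inr v => b s.succ v, ?_, ?_⟩
  · rintro (v | v) i (v' | v') he k j
    · obtain ⟨i', hi', rfl⟩ := he
      exact same _ v i' v' hi' k j
    · rw [binaryFusion_edge_inl_inr] at he
      obtain ⟨rfl, rfl, hv⟩ := he
      simpa [hv] using cross v' hv k j
    · rw [binaryFusion_edge_inr_inl] at he
      obtain ⟨rfl, rfl, hv⟩ := he
      have := cross v hv k j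
      simp only [binaryFusion_vlabel_inl, binaryFusion_vlabel_inr, hv, Fin.succAbove_castSucc_self,
        Fin.succAbove_succ_self]
      rw [← neg_inj, neg_sub, this]
      split_ifs <;> simp
    · obtain ⟨i', hi', rfl⟩ := he
      exact same _ v i' v' hi' k j
  · rintro (v | v) j
    · induction j using Fin.succAboveCases s with
      | x => simp [b3]
      | p j => simp [b4, h0]
    · induction j using Fin.succAboveCases s with
      | x => simp [b3]
      | p j => simp [b4, h0]

theorem predAbove_succ_of_succAbove (s : Fin (t + 1)) (j : Fin t) :
    s.predAbove (s.succAbove j).succ = j.succ ∧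
      s.predAbove (s.succAbove j).castSucc = j.castSucc := by
  rcases lt_or_ge j.castSucc s with h | h
  · rw [Fin.succAbove_of_castSucc_lt _ _ h, Fin.predAbove_castSucc_of_le _ _ h.le,
      Fin.succ_castSucc, Fin.predAbove_castSucc_of_le]
    · exact ⟨rfl, rfl⟩
    · rw [Fin.le_def, Fin.val_succ]
      rw [Fin.lt_def, Fin.val_castSucc] at h
      omega
  · rw [Fin.succAbove_of_le_castSucc _ _ h, ← Fin.succ_castSucc,
      Fin.predAbove_succ_of_le _ _ h, Fin.predAbove_succ_of_le]
    · exact ⟨rfl, rfl⟩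
    · rw [Fin.le_def, Fin.val_succ]
      rw [Fin.le_def, Fin.val_castSucc] at h
      omega

/-- The pointed chain of the fusion is that of `G`, traversed in `𝒢⁺` down to the label `s + 1` and
in `𝒢⁻` from the label `s` on.  Conversely a pointed chain can change from one copy to the other
only by its edge with label `s`, and projects to a pointed chain of `G`. -/
theorem P4.binaryFusion (h : G.P4) (s : Fin (t + 1)) : (G.binaryFusion s).P4 := by
  obtain ⟨w, ⟨hw1, hw2⟩, huniq⟩ := h
  let un : V ⊕ V → V := Sum.elim id id
  refine ⟨fun k => if k ≤ s.castSucc then .inr (w (s.predAbove k)) else .inl (w (s.predAbove k)),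
    ⟨fun k => ?_, fun i => ?_⟩, ?_⟩
  · dsimp only
    split_ifs with hk
    · rw [binaryFusion_vlabel_inr, hw1, Fin.succ_succAbove_predAbove]
      exact (lt_of_le_of_lt hk (Fin.castSucc_lt_succ)).ne
    · rw [binaryFusion_vlabel_inl, hw1, Fin.succAbove_predAbove]
      exact (not_le.1 hk).ne'
  · induction i using Fin.succAboveCases s with
    | x =>
      have h1 : s.castSucc ≤ s.castSucc := le_rfl
      have h2 : ¬ s.succ ≤ s.castSucc := by simp
      simp only [if_pos h1, if_neg h2, binaryFusion_edge_inl_inr, hw1]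
      simp
    | p j =>
      dsimp only
      rw [(predAbove_succ_of_succAbove s j).1, (predAbove_succ_of_succAbove s j).2]
      have hne := Fin.succAbove_ne s j
      have hlt : (s.succAbove j).succ ≤ s.castSucc ↔ (s.succAbove j).castSucc ≤ s.castSucc := by
        rw [Ne, Fin.ext_iff] at hne
        simp only [Fin.le_def, Fin.val_succ, Fin.val_castSucc]
        omega
      simp only [hlt]
      split_ifs
      · exact ⟨j, hw2 j, rfl⟩
      · exact ⟨j, hw2 j, rfl⟩
  · rintro u ⟨hu1, hu2⟩
    have side : ∀ x i y, (G.binaryFusion s).edge x i y → i ≠ s →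
        ((∃ v, x = .inl v) ∧ ∃ v, y = .inl v) ∨ ((∃ v, x = .inr v) ∧ ∃ v, y = .inr v) := by
      rintro (x | x) i (y | y) he hi
      · simp
      · rw [binaryFusion_edge_inl_inr] at he; exact absurd he.2.1 hi
      · rw [binaryFusion_edge_inr_inl] at he; exact absurd he.2.1 hi
      · simp
    obtain ⟨v, hv, hv'⟩ : ∃ v, u s.succ = .inl v ∧ u s.castSucc = .inr v := by
      have h1 := hu1 s.succ
      have h2 := hu1 s.castSucc
      have h3 := hu2 s
      rcases h4 : u s.succ with x | x <;> rcases h5 : u s.castSucc with y | y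
      · rw [h5] at h2; exact absurd h2 (Fin.succAbove_ne _ _)
      · rw [h4, h5, binaryFusion_edge_inl_inr] at h3
        exact ⟨x, rfl, by rw [h3.1]⟩
      · rw [h4] at h1; exact absurd h1 (Fin.succAbove_ne _ _)
      · rw [h4] at h1; exact absurd h1 (Fin.succAbove_ne _ _)
    -- the part of the chain above the edge with label `s` lies in `𝒢⁺`, the part below it in `𝒢⁻`
    have hL : ∀ n, s.val + 1 ≤ n → ∀ hn : n < t + 2, ∃ v, u ⟨n, hn⟩ = .inl v := by
      intro n hn
      induction n, hn using Nat.le_induction with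
      | base => intro hn; exact ⟨v, hv⟩
      | succ n hn ih =>
        intro hn'
        obtain ⟨x, hx⟩ := ih (by omega)
        rcases side _ _ _ (hu2 ⟨n, by omega⟩) (by simp [Fin.ext_iff]; omega) with h | h
        · exact h.1
        · obtain ⟨y, hy⟩ := h.2
          exact absurd (hx.symm.trans hy) (by simp)
    have hR : ∀ m, m ≤ s.val → ∃ v, u ⟨s.val - m, by omega⟩ = .inr v := by
      intro m
      induction m with
      | zero => intro _; exact ⟨v, hv'⟩
      | succ m ih =>
        intro hm
        obtain ⟨x, hx⟩ := ih (by omega)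
        have e1 : (⟨s.val - (m + 1), by omega⟩ : Fin (t + 1)).succ = ⟨s.val - m, by omega⟩ := by
          simp only [Fin.ext_iff, Fin.val_succ]; omega
        rcases side _ _ _ (hu2 ⟨s.val - (m + 1), by omega⟩)
          (by simp [Fin.ext_iff]; omega) with h | h
        · obtain ⟨y, hy⟩ := h.1
          rw [e1] at hy
          exact absurd (hx.symm.trans hy) (by simp)
        · exact h.2
    have hu3 : ∀ k, u k = if k ≤ s.castSucc then .inr (un (u k)) else .inl (un (u k)) := by
      intro k
      split_ifs with hk
      · obtain ⟨y, hy⟩ := hR (s.val - k.val) (by omega)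
        have : (⟨s.val - (s.val - k.val), by omega⟩ : Fin (t + 2)) = k := by
          simp only [Fin.le_def, Fin.val_castSucc, Fin.ext_iff] at *; omega
        rw [this] at hy
        rw [hy]; rfl
      · obtain ⟨y, hy⟩ := hL k.val (by simp only [Fin.le_def, Fin.val_castSucc] at hk; omega) k.2
        rw [Fin.eta] at hy
        rw [hy]; rfl
    have hx : (fun j => un (u (s.castSucc.succAbove j))) = w := by
      have hun : ∀ k, un (u k) = un (u (s.castSucc.succAbove (s.predAbove k))) := by
        intro k
        by_cases hk : k = s.castSucc
        · subst hk
          simp [hv, hv', un]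
        · rw [Fin.succAbove_predAbove hk]
      refine huniq _ ⟨fun j => ?_, fun j => ?_⟩
      · dsimp only
        have h1 := hu1 (s.castSucc.succAbove j)
        rw [hu3] at h1
        split_ifs at h1 with h2
        · have h3 : j ≠ s := by
            rintro rfl
            simp at h2
          exact Fin.succAbove_right_injective
            (h1.trans (succAbove_castSucc_eq_succAbove_succ h3))
        · exact Fin.succAbove_right_injective h1
      · dsimp only
        have h1 := hu2 (s.succAbove j)
        rw [hu3, hu3 (s.succAbove j).castSucc] at h1
        rw [hun (s.succAbove j).succ, hun (s.succAbove j).castSucc,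
          (predAbove_succ_of_succAbove s j).1, (predAbove_succ_of_succAbove s j).2] at h1
        have hne := Fin.succAbove_ne s j
        split_ifs at h1 with h2 h3 h3
        · obtain ⟨j', h4, h5⟩ := h1
          obtain rfl := Fin.succAbove_right_injective h5
          exact h4
        · rw [binaryFusion_edge_inr_inl] at h1
          exact absurd h1.2.1 hne
        · rw [binaryFusion_edge_inl_inr] at h1
          exact absurd h1.2.1 hne
        · obtain ⟨j', h4, h5⟩ := h1
          obtain rfl := Fin.succAbove_right_injective h5
          exact h4
    funext k
    rw [hu3 k, ← hx]
    have hun : un (u k) = un (u (s.castSucc.succAbove (s.predAbove k))) := by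
      by_cases hk : k = s.castSucc
      · subst hk
        simp [hv, hv', un]
      · rw [Fin.succAbove_predAbove hk]
    dsimp only
    rw [← hun]

end Fusion

end LabelledGraph

/-! ### Paths and triads of a binary fusion -/

namespace LabelledGraph

variable {t : ℕ} {V W : Type}

theorem reachable_of_edge {G : LabelledGraph t V} {v v' : V} {i : Fin t} (h : G.edge v i v') :
    G.toSimpleGraph.Reachable v v' := by
  by_cases hv : v = v'
  · rw [hv]
  · exact SimpleGraph.Adj.reachable ((SimpleGraph.fromRel_adj _ _ _).2 ⟨hv, Or.inl ⟨i, h⟩⟩)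

theorem reachable_induction {G : LabelledGraph t V} {p : V → Prop} {v v' : V}
    (h : G.toSimpleGraph.Reachable v v') (hv : p v)
    (step : ∀ x i y, G.edge x i y → p x → p y) : p v' := by
  rw [SimpleGraph.reachable_iff_reflTransGen] at h
  induction h with
  | refl => exact hv
  | tail _ hxy ih =>
    obtain ⟨-, ⟨i, hi⟩ | ⟨i, hi⟩⟩ := (SimpleGraph.fromRel_adj _ _ _).1 hxy
    · exact step _ i _ hi ih
    · exact step _ i _ (G.symm _ _ _ hi) ih

theorem Reachable.map {t' : ℕ} {G : LabelledGraph t V} {G' : LabelledGraph t' W} (f : V → W)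
    (hf : ∀ v i v', G.edge v i v' → ∃ j, G'.edge (f v) j (f v')) {v v' : V}
    (h : G.toSimpleGraph.Reachable v v') : G'.toSimpleGraph.Reachable (f v) (f v') := by
  refine reachable_induction (p := fun x => G'.toSimpleGraph.Reachable (f v) (f x)) h
    (SimpleGraph.Reachable.refl _) fun x i y hxy hx => ?_
  obtain ⟨j, hj⟩ := hf x i y hxy
  exact hx.trans (reachable_of_edge hj)

theorem HasOrderedPath.map {t' : ℕ} {G : LabelledGraph t V} {G' : LabelledGraph t' W}
    {c : Fin t → ℕ} {c' : Fin t' → ℕ} (f : V → W) (g : Fin t → Fin t')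
    (hf : ∀ v i v', G.edge v i v' → G'.edge (f v) (g i) (f v')) (hg : ∀ i, c' (g i) = c i)
    {v v' : V} (h : G.HasOrderedPath c v v') : G'.HasOrderedPath c' (f v) (f v') := by
  obtain ⟨n, w, e, rfl, rfl, hw, he⟩ := h
  refine ⟨n, f ∘ w, g ∘ e, rfl, rfl, fun i => hf _ _ _ (hw i), ?_⟩
  simpa only [Function.comp_apply, hg] using he

/-- An ordered path can be continued by an edge whose label exceeds all the others. -/
theorem HasOrderedPath.map_snoc {t' : ℕ} {G : LabelledGraph t V} {G' : LabelledGraph t' W}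
    {c : Fin t → ℕ} {c' : Fin t' → ℕ} (f : V → W) (g : Fin t → Fin t')
    (hf : ∀ v i v', G.edge v i v' → G'.edge (f v) (g i) (f v')) (hg : ∀ i, c' (g i) = c i)
    {v v' : V} (h : G.HasOrderedPath c v v') {i : Fin t'} {y : W} (hi : G'.edge (f v') i y)
    (hlt : ∀ j, c' (g j) < c' i) : G'.HasOrderedPath c' (f v) y := by
  obtain ⟨n, w, e, rfl, rfl, hw, he⟩ := h
  refine ⟨n + 1, Fin.snoc (α := fun _ => W) (f ∘ w) y, Fin.snoc (α := fun _ => Fin t') (g ∘ e) i,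
    ?_, by simp, fun j => ?_, fun a b hab => ?_⟩
  · have : (0 : Fin (n + 1 + 1)) = (0 : Fin (n + 1)).castSucc := rfl
    rw [this, Fin.snoc_castSucc]
    rfl
  · induction j using Fin.lastCases with
    | last => simpa using hi
    | cast j =>
      rw [Fin.succ_castSucc, Fin.snoc_castSucc, Fin.snoc_castSucc, Fin.snoc_castSucc]
      exact hf _ _ _ (hw j)
  · induction a using Fin.lastCases with
    | last => exact absurd hab (not_lt.2 (Fin.le_last b))
    | cast a =>
      induction b using Fin.lastCases with
      | last => simpa using hlt (e a)
      | cast b =>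
        simp only [Fin.snoc_castSucc, Function.comp_apply, hg]
        exact he (by simpa using hab)

section Fusion

variable {G : LabelledGraph t V} {s : Fin (t + 1)}

/-- The copies are joined by an edge, as the pointed chain of `G` has a vertex with label `s`. -/
theorem P5.binaryFusion (h : G.P5) (h4 : G.P4) (s : Fin (t + 1)) : (G.binaryFusion s).P5 := by
  obtain ⟨w, ⟨hw, -⟩, -⟩ := h4
  have hl : ∀ v, (G.binaryFusion s).toSimpleGraph.Reachable (.inl (w s)) (.inl v) := fun v =>
    Reachable.map (G' := G.binaryFusion s) Sum.inl (fun _ i _ he => ⟨s.succAbove i, i, he, rfl⟩)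
      (h.preconnected _ _)
  have hr : ∀ v, (G.binaryFusion s).toSimpleGraph.Reachable (.inr (w s)) (.inr v) := fun v =>
    Reachable.map (G' := G.binaryFusion s) Sum.inr (fun _ i _ he => ⟨s.succAbove i, i, he, rfl⟩)
      (h.preconnected _ _)
  have hc : (G.binaryFusion s).toSimpleGraph.Reachable (.inl (w s)) (.inr (w s)) :=
    reachable_of_edge (i := s) ((binaryFusion_edge_inl_inr _ _ _).2 ⟨rfl, rfl, hw s⟩)
  have hall : ∀ v, (G.binaryFusion s).toSimpleGraph.Reachable (.inl (w s)) v := by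
    rintro (v | v)
    · exact hl v
    · exact hc.trans (hr v)
  have : Nonempty (V ⊕ V) := ⟨.inl (w s)⟩
  exact ⟨fun v v' => (hall v).symm.trans (hall v')⟩

/-- A triad of the fusion either crosses from one copy to the other by its middle edge, or lies in
one of the copies. -/
theorem triad_binaryFusion (h1 : G.P1) (h2 : G.P2) {a b d e : V ⊕ V} {i j : Fin (t + 1)}
    (h : (G.binaryFusion s).IsTriad a b d e i j) :
    (i ≠ s ∧ j = s ∧ (G.binaryFusion s).vlabel a = (G.binaryFusion s).vlabel e) ∨
      ∃ a' b' d' e' i' j', G.IsTriad a' b' d' e' i' j' ∧ i = s.succAbove i' ∧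
        j = s.succAbove j' ∧
        ((a = .inl a' ∧ e = .inl e') ∨ (a = .inr a' ∧ e = .inr e')) := by
  obtain ⟨hnd, hab, hbd, hde⟩ := h
  -- the label `s` belongs to the edges between the two copies
  have hs : ∀ k, s.succAbove k ≠ s := fun k => Fin.succAbove_ne s k
  rcases b with b | b <;> rcases d with d | d
  · obtain ⟨j', hbd, rfl⟩ := hbd
    rcases a with a | a <;> rcases e with e | e
    · obtain ⟨i', hab, rfl⟩ := hab
      obtain ⟨i'', hde, hi⟩ := hde
      obtain rfl := Fin.succAbove_right_injective hi
      refine Or.inr ⟨a, b, d, e, i', j', ⟨?_, hab, hbd, hde⟩, rfl, rfl, Or.inl ⟨rfl, rfl⟩⟩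
      simpa using hnd
    · obtain ⟨i', hab, rfl⟩ := hab
      exact absurd ((binaryFusion_edge_inl_inr _ _ _).1 hde).2.1 (hs _)
    · obtain ⟨i', hde, rfl⟩ := hde
      exact absurd ((binaryFusion_edge_inr_inl _ _ _).1 hab).2.1 (hs _)
    · exact absurd (((binaryFusion_edge_inr_inl _ _ _).1 hab).2.2.trans
        ((binaryFusion_edge_inl_inr _ _ _).1 hde).2.2.symm) (h1 _ _ _ hbd)
  · obtain ⟨rfl, rfl, hv⟩ := (binaryFusion_edge_inl_inr _ _ _).1 hbd
    rcases a with a | a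
    · obtain ⟨i', hab, rfl⟩ := hab
      rcases e with e | e
      · exact absurd ((binaryFusion_edge_inr_inl _ _ _).1 hde).2.1 (hs _)
      · obtain ⟨i'', hde, hi⟩ := hde
        obtain rfl := Fin.succAbove_right_injective hi
        obtain rfl := h2.2 _ _ _ _ (G.symm _ _ _ hab) hde
        have hne := h1 _ _ _ hab
        rw [hv] at hne
        exact Or.inl ⟨hs _, rfl, succAbove_castSucc_eq_succAbove_succ hne⟩
    · obtain ⟨rfl, -⟩ := (binaryFusion_edge_inr_inl _ _ _).1 hab
      simp at hnd
  · obtain ⟨rfl, rfl, hv⟩ := (binaryFusion_edge_inr_inl _ _ _).1 hbd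
    rcases a with a | a
    · obtain ⟨rfl, -⟩ := (binaryFusion_edge_inl_inr _ _ _).1 hab
      simp at hnd
    · obtain ⟨i', hab, rfl⟩ := hab
      rcases e with e | e
      · obtain ⟨i'', hde, hi⟩ := hde
        obtain rfl := Fin.succAbove_right_injective hi
        obtain rfl := h2.2 _ _ _ _ (G.symm _ _ _ hab) hde
        have hne := h1 _ _ _ hab
        rw [hv] at hne
        exact Or.inl ⟨hs _, rfl, (succAbove_castSucc_eq_succAbove_succ hne).symm⟩
      · exact absurd ((binaryFusion_edge_inl_inr _ _ _).1 hde).2.1 (hs _)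
  · obtain ⟨j', hbd, rfl⟩ := hbd
    rcases a with a | a <;> rcases e with e | e
    · obtain ⟨rfl, -, hv⟩ := (binaryFusion_edge_inl_inr _ _ _).1 hab
      obtain ⟨rfl, -, hv'⟩ := (binaryFusion_edge_inr_inl _ _ _).1 hde
      exact absurd (hv.trans hv'.symm) (h1 _ _ _ hbd)
    · obtain ⟨i', hde, rfl⟩ := hde
      exact absurd ((binaryFusion_edge_inl_inr _ _ _).1 hab).2.1 (hs _)
    · obtain ⟨i', hab, rfl⟩ := hab
      exact absurd ((binaryFusion_edge_inr_inl _ _ _).1 hde).2.1 (hs _)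
    · obtain ⟨i', hab, rfl⟩ := hab
      obtain ⟨i'', hde, hi⟩ := hde
      obtain rfl := Fin.succAbove_right_injective hi
      refine Or.inr ⟨a, b, d, e, i', j', ⟨?_, hab, hbd, hde⟩, rfl, rfl, Or.inr ⟨rfl, rfl⟩⟩
      simpa using hnd

theorem P6.binaryFusion (h : G.P6) (h1 : G.P1) (h2 : G.P2) (s : Fin (t + 1)) :
    (G.binaryFusion s).P6 := by
  intro a b d e i j htr
  rcases triad_binaryFusion h1 h2 htr with ⟨-, -, h3⟩ |
    ⟨a', b', d', e', i', j', h3, -, -, ⟨rfl, rfl⟩ | ⟨rfl, rfl⟩⟩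
  · exact h3
  · exact congrArg s.castSucc.succAbove (h _ _ _ _ _ _ h3)
  · exact congrArg s.succ.succAbove (h _ _ _ _ _ _ h3)

theorem TriadsLiftTo.binaryFusion {c : Fin (t + 1) → ℕ}
    (h : G.TriadsLiftTo fun j => c (s.succAbove j)) (h1 : G.P1) (h2 : G.P2)
    (hs : ∀ i ≠ s, c i < c s) : (G.binaryFusion s).TriadsLiftTo c := by
  intro a b d e i j htr
  rcases triad_binaryFusion h1 h2 htr with ⟨hi, rfl, -⟩ |
    ⟨a', b', d', e', i', j', h3, rfl, rfl, -⟩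
  · exact hs i hi
  · exact h _ _ _ _ _ _ h3

/-- The label missing from a copy is reached by an ordered path to a vertex with label `s` of `G`,
followed by the edge to the other copy, whose label `s` is the largest of all. -/
theorem P7.binaryFusion {c : Fin (t + 1) → ℕ} (h : G.P7 fun j => c (s.succAbove j))
    (hs : ∀ i ≠ s, c i < c s) : (G.binaryFusion s).P7 c := by
  rintro (v | v) k
  · induction k using Fin.succAboveCases s.castSucc with
    | x =>
      obtain ⟨v', hv', hp⟩ := h v s
      refine ⟨.inr v', by simp [hv'], ?_⟩
      exact hp.map_snoc (G' := G.binaryFusion s) .inl s.succAbove (fun _ i _ he => ⟨i, he, rfl⟩)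
        (fun _ => rfl) ((binaryFusion_edge_inl_inr _ _ _).2 ⟨rfl, rfl, hv'⟩)
        fun j => hs _ (Fin.succAbove_ne s j)
    | p k =>
      obtain ⟨v', hv', hp⟩ := h v k
      refine ⟨.inl v', by simp [hv'], ?_⟩
      exact hp.map (G' := G.binaryFusion s) .inl s.succAbove (fun _ i _ he => ⟨i, he, rfl⟩)
        fun _ => rfl
  · induction k using Fin.succAboveCases s.succ with
    | x =>
      obtain ⟨v', hv', hp⟩ := h v s
      refine ⟨.inl v', by simp [hv'], ?_⟩
      exact hp.map_snoc (G' := G.binaryFusion s) .inr s.succAbove (fun _ i _ he => ⟨i, he, rfl⟩)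
        (fun _ => rfl) ((binaryFusion_edge_inr_inl _ _ _).2 ⟨rfl, rfl, hv'⟩)
        fun j => hs _ (Fin.succAbove_ne s j)
    | p k =>
      obtain ⟨v', hv', hp⟩ := h v k
      refine ⟨.inr v', by simp [hv'], ?_⟩
      exact hp.map (G' := G.binaryFusion s) .inr s.succAbove (fun _ i _ he => ⟨i, he, rfl⟩)
        fun _ => rfl

end Fusion

theorem topIndex_spec {c : Fin (t + 1) → ℕ} (hc : Function.Injective c) :
    ∀ i ≠ topIndex c, c i < c (topIndex c) := fun i hi =>
  lt_of_le_of_ne (Classical.choose_spec (Finite.exists_max c) i) fun h => hi (hc h)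

/-- The induction for the `S`-graph properties of `𝒢(c)` needs the normalized form of `P3`. -/
theorem fusionGraph_isSGraph_aux : ∀ {t : ℕ} (c : Fin t → ℕ), Function.Injective c →
    (fusionGraph c).IsSGraph c ∧ (fusionGraph c).NormalizedEvaluation
  | 0, c, _ => by
    have : Subsingleton (FusionVertex 0) := inferInstanceAs (Subsingleton Unit)
    have : Subsingleton (Fin (0 + 1)) := inferInstanceAs (Subsingleton (Fin 1))
    refine ⟨⟨fun _ i => i.elim0, ⟨fun _ i => i.elim0, fun _ i => i.elim0⟩,
      ⟨fun _ _ _ => 0, fun _ i => i.elim0⟩,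
      ⟨fun _ => Unit.unit, ⟨fun i => Subsingleton.elim _ _, fun i => i.elim0⟩,
        fun _ _ => funext fun _ => Subsingleton.elim _ _⟩, ?_, fun _ _ _ _ i => i.elim0,
      fun _ _ _ _ i => i.elim0, fun v k => ⟨v, Subsingleton.elim _ _,
        ⟨0, fun _ => v, Fin.elim0, rfl, rfl, fun i => i.elim0, fun i => i.elim0⟩⟩⟩,
      ⟨fun _ _ _ => 0, fun _ i => i.elim0, fun _ j => j.elim0⟩⟩
    have : Nonempty (FusionVertex 0) := ⟨Unit.unit⟩
    exact ⟨fun v v' => by rw [Subsingleton.elim v v']⟩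
  | t + 1, c, hc => by
    obtain ⟨h, he⟩ := fusionGraph_isSGraph_aux (fun j => c ((topIndex c).succAbove j))
      (hc.comp Fin.succAbove_right_injective)
    have hs := topIndex_spec hc
    exact ⟨⟨h.p1.binaryFusion _, h.p2.binaryFusion _, (he.binaryFusion _).p3, h.p4.binaryFusion _,
      h.p5.binaryFusion h.p4 _, h.p6.binaryFusion h.p1 h.p2 _, h.lift.binaryFusion h.p1 h.p2 hs,
      h.p7.binaryFusion hs⟩, he.binaryFusion _⟩

theorem fusionGraph_isSGraph {t : ℕ} {c : Fin t → ℕ} (hc : Function.Injective c) :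
    (fusionGraph c).IsSGraph c :=
  (fusionGraph_isSGraph_aux c hc).1

/-! ### Labelled embeddings and isomorphisms -/

/-- A labelled embedding maps the pointed chain of `G` to the only one of `G'`, and its values
spread along the edges of `G`, because distinct edges at a vertex of `G'` have distinct labels. -/
theorem IsLabelledEmbedding.unique {G : LabelledGraph t V} {G' : LabelledGraph t W} (h4 : G.P4)
    (h5 : G.P5) (h2' : G'.P2) (h4' : G'.P4) {θ θ' : V → W} (h : G.IsLabelledEmbedding G' θ)
    (h' : G.IsLabelledEmbedding G' θ') : θ' = θ := by
  obtain ⟨w, ⟨hw, hw'⟩, -⟩ := h4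
  have hchain : θ' ∘ w = θ ∘ w := h4'.unique
    ⟨fun i => by rw [Function.comp_apply, h'.map_vlabel, hw], fun i => h'.map_edge _ _ _ (hw' i)⟩
    ⟨fun i => by rw [Function.comp_apply, h.map_vlabel, hw], fun i => h.map_edge _ _ _ (hw' i)⟩
  funext v
  refine reachable_induction (p := fun v => θ' v = θ v) (h5.preconnected (w 0) v)
    (congrFun hchain 0) fun x i y hxy hx => ?_
  have h6 := h'.map_edge _ _ _ hxy
  rw [hx] at h6
  exact h2'.2 _ _ _ _ h6 (h.map_edge _ _ _ hxy)

theorem IsLabelledIso.isSGraph {G : LabelledGraph t V} {G' : LabelledGraph t W} {θ : V → W}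
    (h : G.IsLabelledIso G' θ) {c : Fin t → ℕ} (hG : G.IsSGraph c) : G'.IsSGraph c := by
  obtain ⟨σ, hσ⟩ : ∃ σ : W → V, ∀ w, θ (σ w) = w := h.bijective.2.hasRightInverse
  have hl : ∀ w, G.vlabel (σ w) = G'.vlabel w := fun w => by rw [← h.map_vlabel, hσ]
  have hE : ∀ w i w', G'.edge w i w' ↔ G.edge (σ w) i (σ w') := fun w i w' => by
    rw [← h.map_edge_iff, hσ, hσ]
  have hinj : Function.Injective σ := fun w w' hw => by rw [← hσ w, hw, hσ]
  have htri : ∀ a b d e i j, G'.IsTriad a b d e i j → G.IsTriad (σ a) (σ b) (σ d) (σ e) i j := by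
    rintro a b d e i j ⟨hnd, h1, h2, h3⟩
    exact ⟨by simpa using hnd.map hinj, (hE _ _ _).1 h1, (hE _ _ _).1 h2, (hE _ _ _).1 h3⟩
  refine ⟨fun v i v' he => ?_, ⟨fun v i j v' h1 h2 => ?_, fun v i v' v'' h1 h2 => ?_⟩, ?_, ?_, ?_,
    fun a b d e i j htr => ?_, fun a b d e i j htr => ?_, fun v' k => ?_⟩
  · rw [← hl, ← hl]; exact hG.p1 _ _ _ ((hE _ _ _).1 he)
  · exact hG.p2.1 _ _ _ _ ((hE _ _ _).1 h1) ((hE _ _ _).1 h2)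
  · exact hinj (hG.p2.2 _ _ _ _ ((hE _ _ _).1 h1) ((hE _ _ _).1 h2))
  · obtain ⟨f, hf⟩ := hG.p3
    refine ⟨fun w => f (σ w), fun v i v' he k j => ?_⟩
    rw [← hl, ← hl]
    exact hf _ _ _ ((hE _ _ _).1 he) k j
  · obtain ⟨w, ⟨h1, h2⟩, hu⟩ := hG.p4
    refine ⟨θ ∘ w, ⟨fun i => by rw [Function.comp_apply, h.map_vlabel, h1],
      fun i => (h.map_edge_iff _ _ _).2 (h2 i)⟩, ?_⟩
    rintro u ⟨h3, h4⟩
    rw [← hu (σ ∘ u) ⟨fun i => by rw [Function.comp_apply, hl, h3], fun i => (hE _ _ _).1 (h4 i)⟩]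
    funext i
    exact (hσ _).symm
  · have : Nonempty W := hG.p5.nonempty.map θ
    refine ⟨fun v v' => ?_⟩
    rw [← hσ v, ← hσ v']
    exact Reachable.map θ (fun x i y he => ⟨i, (h.map_edge_iff _ _ _).2 he⟩)
      (hG.p5.preconnected _ _)
  · rw [← hl, ← hl]; exact hG.p6 _ _ _ _ _ _ (htri _ _ _ _ _ _ htr)
  · exact hG.lift _ _ _ _ _ _ (htri _ _ _ _ _ _ htr)
  · obtain ⟨v, hv, hp⟩ := hG.p7 (σ v') k
    refine ⟨θ v, by rw [h.map_vlabel, hv], ?_⟩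
    have := hp.map θ id (fun x i y he => (h.map_edge_iff _ _ _).2 he) (c' := c) fun _ => rfl
    rwa [hσ] at this

end LabelledGraph

theorem card_fusionVertex : ∀ t : ℕ, Nat.card (FusionVertex t) = 2 ^ t
  | 0 => Nat.card_unique (α := Unit)
  | t + 1 => by
    have h := card_fusionVertex t
    have : Finite (FusionVertex t) := Nat.finite_of_card_ne_zero (by rw [h]; positivity)
    have h2 : Nat.card (FusionVertex t ⊕ FusionVertex t) = 2 ^ (t + 1) := by
      rw [Nat.card_sum, h, pow_succ]
      ring
    exact h2

/-! ### Depth functions -/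

/-- The depth functions of complete diagrams on the columns `0, …, N`; for a diagram of odd height
`r` the depth of a column of height `h` is `r - h`.  A column of even (resp. odd) depth `δ ≠ 0` has
to its left (resp. right) a column of depth `δ - 1`, and all columns in between have depth at least
`δ`. Depth functions are defined on `ℕ`, but only their values on `0, …, N` matter. -/
structure TightDepth (N : ℕ) (d : ℕ → ℕ) : Prop where
  exists_zero : ∃ k ≤ N, d k = 0
  left : ∀ k ≤ N, d k ≠ 0 → d k % 2 = 0 →
    ∃ p < k, d p + 1 = d k ∧ ∀ m, p < m → m < k → d k ≤ d m
  right : ∀ k ≤ N, d k % 2 = 1 →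
    ∃ q ≤ N, k < q ∧ d q + 1 = d k ∧ ∀ m, k < m → m < q → d k ≤ d m

/-- The relations of a complete diagram with depth function `d` hold in the order `c`.  They are
stated for all the elements of `T` between two columns `p < q` that are neighbours at depth `δ - 1`:
the least of the elements `p, …, q - 1` is `q - 1` if `δ` is even and `p` if `δ` is odd.  Here the
element `i` of `T` lies between the columns `i` and `i + 1`. -/
def CompatDepth (N : ℕ) (c d : ℕ → ℕ) : Prop :=
  ∀ p q δ, p < q → q ≤ N → d p < δ → d q < δ → (∀ m, p < m → m < q → δ ≤ d m) →
    (δ % 2 = 0 → ∀ x, p ≤ x → x + 1 < q → c (q - 1) < c x) ∧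
    (δ % 2 = 1 → ∀ x, p < x → x < q → c p < c x)

/-- The map `ψ_s`, which skips the value `s`. -/
def skip (s i : ℕ) : ℕ := if i < s then i else i + 1

/-- The map that identifies the columns `s` and `s + 1`. -/
def collapse (s i : ℕ) : ℕ := if i ≤ s then i else i - 1

/-- `D` arises from `d` by doubling the column `s`.  The depths of the two columns `s`, `s + 1` that
replace it are both `d s`, or one of them is raised by `1`: the left one if `d s` is even, the right
one if `d s` is odd.  In all the cases a raised column has its neighbour as parent. -/
structure IsExpansion (s : ℕ) (d D : ℕ → ℕ) : Prop where
  lt : ∀ i, i < s → D i = d i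
  gt : ∀ i, s < i → D (i + 1) = d i
  pair : (D s = d s ∧ D (s + 1) = d s) ∨ (D s = d s + 1 ∧ D (s + 1) = d s ∧ d s % 2 = 0) ∨
    (D s = d s ∧ D (s + 1) = d s + 1 ∧ d s % 2 = 1)

namespace IsExpansion

variable {N s : ℕ} {d D c c' : ℕ → ℕ}

theorem exists_eq (h : IsExpansion s d D) (m : ℕ) : ∃ m', collapse s m' = m ∧ D m' = d m := by
  rcases lt_trichotomy m s with hm | rfl | hm
  · exact ⟨m, by simp [collapse, hm.le], h.lt m hm⟩
  · rcases h.pair with h1 | h1 | h1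
    · exact ⟨m, by simp [collapse], h1.1⟩
    · exact ⟨m + 1, by simp [collapse], h1.2.1⟩
    · exact ⟨m, by simp [collapse], h1.1⟩
  · exact ⟨m + 1, by simp only [collapse]; split_ifs <;> omega, h.gt m hm⟩

theorem eq_collapse (h : IsExpansion s d D) {i : ℕ} (h1 : i ≠ s) (h2 : i ≠ s + 1) :
    D i = d (collapse s i) := by
  by_cases hi : i < s
  · rw [h.lt i hi, collapse, if_pos hi.le]
  · obtain ⟨j, rfl⟩ : ∃ j, i = j + 1 := ⟨i - 1, by omega⟩
    rw [h.gt j (by omega), collapse, if_neg (by omega)]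
    simp

theorem le (h : IsExpansion s d D) (i : ℕ) : d (collapse s i) ≤ D i := by
  by_cases h1 : i = s
  · subst h1
    have := h.pair
    simp only [collapse, le_refl, if_true]
    omega
  by_cases h2 : i = s + 1
  · subst h2
    have := h.pair
    have : collapse s (s + 1) = s := by simp [collapse]
    rw [this]
    omega
  exact (h.eq_collapse h1 h2).ge

theorem collapse_lt {i j : ℕ} (h : collapse s i < collapse s j) : i < j := by
  simp only [collapse] at h
  split_ifs at h <;> omega

theorem between (h : IsExpansion s d D) {p q δ : ℕ} (hb : ∀ m, p < m → m < q → δ ≤ D m) :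
    ∀ m, collapse s p < m → m < collapse s q → δ ≤ d m := by
  intro m h1 h2
  obtain ⟨m', rfl, h3⟩ := h.exists_eq m
  rw [← h3]
  exact hb m' (collapse_lt h1) (collapse_lt h2)

/-- By the parity of the depth of a raised column no relation requires `s` to precede another
element. So the relations that involve `s` hold if it is the last element of the order, and the
others are relations for `d`. -/
theorem compat (h : IsExpansion s d D) (hs : s ≤ N) (hc : ∀ i < N, c' i = c (skip s i))
    (htop : ∀ i ≤ N, i ≠ s → c i < c s) (hd : CompatDepth N c' d) : CompatDepth (N + 1) c D := by
  intro p q δ hpq hq hp hq' hb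
  have hb' := h.between hb
  have hp1 := h.le p
  have hq1 := h.le q
  have hpair := h.pair
  constructor
  · intro hδ x hpx hxq
    by_cases hqs : q = s + 1
    · subst hqs
      have := hb s (by omega) (by omega)
      omega
    by_cases hxs : x = s
    · subst hxs
      exact htop _ (by omega) (by omega)
    have key := (hd (collapse s p) (collapse s q) δ
      (by simp only [collapse]; split_ifs <;> omega) (by simp only [collapse]; split_ifs <;> omega)
      (by omega) (by omega) hb').1 hδ (if x < s then x else x - 1)
      (by simp only [collapse]; split_ifs <;> omega) (by simp only [collapse]; split_ifs <;> omega)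
    rw [hc _ (by simp only [collapse]; split_ifs <;> omega), hc _ (by split_ifs <;> omega)] at key
    convert key using 2
    · simp only [collapse, skip]; split_ifs <;> omega
    · simp only [skip]; split_ifs <;> omega
  · intro hδ x hpx hxq
    by_cases hps : p = s
    · subst hps
      have := hb (p + 1) (by omega) (by omega)
      omega
    by_cases hxs : x = s
    · subst hxs
      exact htop _ (by omega) (by omega)
    have key := (hd (collapse s p) (collapse s q) δ
      (by simp only [collapse]; split_ifs <;> omega) (by simp only [collapse]; split_ifs <;> omega)
      (by omega) (by omega) hb').2 hδ (if x < s then x else x - 1)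
      (by simp only [collapse]; split_ifs <;> omega) (by simp only [collapse]; split_ifs <;> omega)
    rw [hc _ (by simp only [collapse]; split_ifs <;> omega), hc _ (by split_ifs <;> omega)] at key
    convert key using 2
    · simp only [collapse, skip]; split_ifs <;> omega
    · simp only [skip]; split_ifs <;> omega

/-- Lower bounds between two columns lift. -/
theorem between_lift (h : IsExpansion s d D) {p q δ : ℕ}
    (hb : ∀ m, collapse s p < m → m < collapse s q → δ ≤ d m)
    (hp : p = s → s + 1 < q → δ ≤ D (s + 1)) (hq : q = s + 1 → p < s → δ ≤ D s) :
    ∀ m, p < m → m < q → δ ≤ D m := by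
  intro m h1 h2
  by_cases h3 : p = s ∧ m = s + 1
  · obtain ⟨rfl, rfl⟩ := h3
    exact hp rfl h2
  by_cases h4 : q = s + 1 ∧ m = s
  · obtain ⟨rfl, rfl⟩ := h4
    exact hq rfl h1
  refine (hb (collapse s m) ?_ ?_).trans (h.le m)
  · simp only [collapse]; split_ifs <;> omega
  · simp only [collapse]; split_ifs <;> omega

/-- If `p` (resp. `q`) is the column `s`, it is lifted to `s + 1` (resp. to `s`) provided that the
depth there is less than `δ`, so that no column gets between `p` and `q` needlessly. -/
theorem compat_of (h : IsExpansion s d D) (hs : s ≤ N) (hc : ∀ i < N, c' i = c (skip s i))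
    (hD : CompatDepth (N + 1) c D) : CompatDepth N c' d := by
  intro p q δ hpq hq hp hq' hb
  have hpair := h.pair
  obtain ⟨p', hp1, hp2, hp3⟩ : ∃ p', collapse s p' = p ∧ D p' < δ ∧
      (p' = s → δ ≤ D (s + 1) ∧ δ % 2 = 0) := by
    by_cases hps : p = s
    · subst hps
      by_cases h1 : D (p + 1) < δ
      · exact ⟨p + 1, by simp [collapse], h1, by omega⟩
      · exact ⟨p, by simp [collapse], by omega, by omega⟩
    · obtain ⟨p', rfl, h2⟩ := h.exists_eq p
      refine ⟨p', rfl, by omega, fun h3 => ?_⟩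
      simp [h3, collapse] at hps
  obtain ⟨q', hq1, hq2, hq3⟩ : ∃ q', collapse s q' = q ∧ D q' < δ ∧
      (q' = s + 1 → δ ≤ D s ∧ δ % 2 = 1) := by
    by_cases hqs : q = s
    · subst hqs
      by_cases h1 : D q < δ
      · exact ⟨q, by simp [collapse], h1, by omega⟩
      · exact ⟨q + 1, by simp [collapse], by omega, by omega⟩
    · obtain ⟨q', rfl, h2⟩ := h.exists_eq q
      refine ⟨q', rfl, by omega, fun h3 => ?_⟩
      simp [h3, collapse] at hqs
  subst hp1 hq1
  have key := hD p' q' δ (collapse_lt hpq)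
    (by simp only [collapse] at hq; split_ifs at hq <;> omega) hp2 hq2
    (h.between_lift hb (fun h1 _ => (hp3 h1).1) (fun h1 _ => (hq3 h1).1))
  have hq4 : q' ≤ N + 1 := by simp only [collapse] at hq; split_ifs at hq <;> omega
  refine ⟨fun hδ x h1 h2 => ?_, fun hδ x h1 h2 => ?_⟩
  · have h3 : q' ≠ s + 1 := fun h4 => by have := hq3 h4; omega
    rw [hc _ (by simp only [collapse] at *; split_ifs at * <;> omega),
      hc _ (by simp only [collapse] at *; split_ifs at * <;> omega)]
    have := key.1 hδ (skip s x) (by simp only [collapse, skip] at *; split_ifs at * <;> omega)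
      (by simp only [collapse, skip] at *; split_ifs at * <;> omega)
    convert this using 2
    simp only [collapse, skip] at *; split_ifs at * <;> omega
  · have h3 : p' ≠ s := fun h4 => by have := hp3 h4; omega
    rw [hc _ (by simp only [collapse] at *; split_ifs at * <;> omega),
      hc _ (by simp only [collapse] at *; split_ifs at * <;> omega)]
    have := key.2 hδ (skip s x) (by simp only [collapse, skip] at *; split_ifs at * <;> omega)
      (by simp only [collapse, skip] at *; split_ifs at * <;> omega)
    convert this using 2
    simp only [collapse, skip] at *; split_ifs at * <;> omega

theorem tight (h : IsExpansion s d D) (hs : s ≤ N) (hd : TightDepth N d) :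
    TightDepth (N + 1) D := by
  have hpair := h.pair
  refine ⟨?_, ?_, ?_⟩
  · obtain ⟨k, hk, hk0⟩ := hd.exists_zero
    obtain ⟨k', rfl, h2⟩ := h.exists_eq k
    refine ⟨k', ?_, by omega⟩
    simp only [collapse] at hk; split_ifs at hk <;> omega
  · intro k hk h0 h2
    by_cases hks : k = s + 1 ∧ D (s + 1) = D s + 1
    · obtain ⟨rfl, h3⟩ := hks
      exact ⟨s, by omega, by omega, fun m h4 h5 => by omega⟩
    have hDk : D k = d (collapse s k) := by
      by_cases h3 : k = s
      · subst h3; simp only [collapse, le_refl, if_true]; omega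
      by_cases h4 : k = s + 1
      · subst h4
        have : collapse s (s + 1) = s := by simp [collapse]
        rw [this]; omega
      exact h.eq_collapse h3 h4
    obtain ⟨p, hp, hp1, hp2⟩ := hd.left (collapse s k)
      (by simp only [collapse]; split_ifs <;> omega) (by omega) (by omega)
    obtain ⟨p', h3, h4, h5⟩ : ∃ p', collapse s p' = p ∧ D p' = d p ∧
        (p' = s → D k ≤ D (s + 1)) := by
      by_cases hps : p = s
      · subst hps
        by_cases h6 : D (p + 1) = d p
        · exact ⟨p + 1, by simp [collapse], h6, by omega⟩
        · exact ⟨p, by simp [collapse], by omega, by omega⟩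
      · obtain ⟨p', rfl, h2⟩ := h.exists_eq p
        refine ⟨p', rfl, by omega, fun h3 => ?_⟩
        simp [h3, collapse] at hps
    subst h3
    refine ⟨p', collapse_lt hp, by omega, h.between_lift (by rwa [hDk])
      (fun h6 _ => h5 h6) fun h6 _ => ?_⟩
    subst h6
    have : collapse s (s + 1) = s := by simp [collapse]
    rw [this] at hDk
    omega
  · intro k hk h2
    by_cases hks : k = s ∧ D s = D (s + 1) + 1
    · obtain ⟨rfl, h3⟩ := hks
      exact ⟨k + 1, by omega, by omega, by omega, fun m h4 h5 => by omega⟩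
    have hDk : D k = d (collapse s k) := by
      by_cases h3 : k = s
      · subst h3; simp only [collapse, le_refl, if_true]; omega
      by_cases h4 : k = s + 1
      · subst h4
        have : collapse s (s + 1) = s := by simp [collapse]
        rw [this]; omega
      exact h.eq_collapse h3 h4
    obtain ⟨q, hqN, hq, hq1, hq2⟩ := hd.right (collapse s k)
      (by simp only [collapse]; split_ifs <;> omega) (by omega)
    obtain ⟨q', h3, h4, h5⟩ : ∃ q', collapse s q' = q ∧ D q' = d q ∧
        (q' = s + 1 → D k ≤ D s) := by
      by_cases hqs : q = s
      · subst hqs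
        by_cases h6 : D q = d q
        · exact ⟨q, by simp [collapse], h6, by omega⟩
        · exact ⟨q + 1, by simp [collapse], by omega, by omega⟩
      · obtain ⟨q', rfl, h2⟩ := h.exists_eq q
        refine ⟨q', rfl, by omega, fun h3 => ?_⟩
        simp [h3, collapse] at hqs
    subst h3
    refine ⟨q', by simp only [collapse] at hqN; split_ifs at hqN <;> omega, collapse_lt hq,
      by omega, h.between_lift (by rwa [hDk])
      (fun h6 _ => ?_) fun h6 _ => h5 h6⟩
    subst h6
    have : collapse k k = k := by simp [collapse]
    rw [this] at hDk
    omega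

theorem tight_of (h : IsExpansion s d D) (hs : s ≤ N) (hD : TightDepth (N + 1) D) :
    TightDepth N d := by
  have hpair := h.pair
  have e1 : collapse s s = s := by simp [collapse]
  have e2 : collapse s (s + 1) = s := by simp [collapse]
  refine ⟨?_, ?_, ?_⟩
  · obtain ⟨k, hk, hk0⟩ := hD.exists_zero
    have := h.le k
    exact ⟨collapse s k, by simp only [collapse]; split_ifs <;> omega, by omega⟩
  · intro k hk h0 h2
    obtain ⟨k', rfl, h3⟩ := h.exists_eq k
    obtain ⟨p, hp, hp1, hp2⟩ := hD.left k'
      (by simp only [collapse] at hk; split_ifs at hk <;> omega) (by omega) (by omega)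
    have hDp : D p = d (collapse s p) := by
      by_cases h4 : p = s
      · subst h4
        rw [e1]
        by_contra h5
        by_cases h6 : k' = p + 1
        · subst h6
          rw [e2] at h3
          omega
        · have := hp2 (p + 1) (by omega) (by omega)
          omega
      by_cases h5 : p = s + 1
      · subst h5
        rw [e2]
        omega
      exact h.eq_collapse h4 h5
    have hne : collapse s p ≠ collapse s k' := fun h4 => by rw [h4] at hDp; omega
    refine ⟨collapse s p, ?_, by omega, ?_⟩
    · simp only [collapse] at *; split_ifs at * <;> omega
    · rw [← h3]
      exact h.between hp2
  · intro k hk h2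
    obtain ⟨k', rfl, h3⟩ := h.exists_eq k
    obtain ⟨q, hqN, hq, hq1, hq2⟩ := hD.right k'
      (by simp only [collapse] at hk; split_ifs at hk <;> omega) (by omega)
    have hDq : D q = d (collapse s q) := by
      by_cases h5 : q = s + 1
      · subst h5
        rw [e2]
        by_contra h5
        by_cases h6 : k' = s
        · subst h6
          rw [e1] at h3
          omega
        · have := hq2 s (by omega) (by omega)
          omega
      by_cases h4 : q = s
      · subst h4
        rw [e1]
        omega
      exact h.eq_collapse h4 h5
    have hne : collapse s q ≠ collapse s k' := fun h4 => by rw [h4] at hDq; omega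
    refine ⟨collapse s q, ?_, ?_, by omega, ?_⟩
    · simp only [collapse] at *; split_ifs at * <;> omega
    · simp only [collapse] at *; split_ifs at * <;> omega
    · rw [← h3]
      exact h.between hq2

end IsExpansion

/-! ### The two expansions at a column -/

/-- The expansion that belongs to the copy `𝒢⁺`: the depths of the columns `s`, `s + 1` are
`d s + 1`, `d s` if `d s` is even and `d s`, `d s` if it is odd.  So the depth of the column `s` is
odd. -/
def expandPlus (s : ℕ) (d : ℕ → ℕ) (i : ℕ) : ℕ :=
  d (collapse s i) + if i = s ∧ d s % 2 = 0 then 1 else 0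

/-- The expansion that belongs to the copy `𝒢⁻`: the depths of the columns `s`, `s + 1` are
`d s`, `d s` if `d s` is even and `d s`, `d s + 1` if it is odd.  So the depth of the column `s + 1`
is even. -/
def expandMinus (s : ℕ) (d : ℕ → ℕ) (i : ℕ) : ℕ :=
  d (collapse s i) + if i = s + 1 ∧ d s % 2 = 1 then 1 else 0

theorem expandPlus_lt {s i : ℕ} {d : ℕ → ℕ} (h : i < s) : expandPlus s d i = d i := by
  simp [expandPlus, collapse, h.ne, h.le]

theorem expandPlus_gt {s i : ℕ} {d : ℕ → ℕ} (h : s < i) : expandPlus s d (i + 1) = d i := by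
  simp [expandPlus, collapse, show ¬ i + 1 ≤ s by omega, show ¬ i + 1 = s by omega]

theorem expandMinus_lt {s i : ℕ} {d : ℕ → ℕ} (h : i < s) : expandMinus s d i = d i := by
  simp [expandMinus, collapse, show ¬ i = s + 1 by omega, h.le]

theorem expandMinus_gt {s i : ℕ} {d : ℕ → ℕ} (h : s < i) : expandMinus s d (i + 1) = d i := by
  simp [expandMinus, collapse, show ¬ i + 1 ≤ s by omega, show ¬ i = s by omega]

theorem expandPlus_self (s : ℕ) (d : ℕ → ℕ) :
    expandPlus s d s = d s + if d s % 2 = 0 then 1 else 0 := by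
  simp [expandPlus, collapse]

theorem expandPlus_succ (s : ℕ) (d : ℕ → ℕ) : expandPlus s d (s + 1) = d s := by
  simp [expandPlus, collapse]

theorem expandMinus_self (s : ℕ) (d : ℕ → ℕ) : expandMinus s d s = d s := by
  simp [expandMinus, collapse]

theorem expandMinus_succ (s : ℕ) (d : ℕ → ℕ) :
    expandMinus s d (s + 1) = d s + if d s % 2 = 1 then 1 else 0 := by
  simp [expandMinus, collapse]

theorem isExpansion_expandPlus (s : ℕ) (d : ℕ → ℕ) : IsExpansion s d (expandPlus s d) := by
  refine ⟨fun i h => expandPlus_lt h, fun i h => expandPlus_gt h, ?_⟩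
  rw [expandPlus_self, expandPlus_succ]
  split_ifs <;> omega

theorem isExpansion_expandMinus (s : ℕ) (d : ℕ → ℕ) : IsExpansion s d (expandMinus s d) := by
  refine ⟨fun i h => expandMinus_lt h, fun i h => expandMinus_gt h, ?_⟩
  rw [expandMinus_self, expandMinus_succ]
  split_ifs <;> omega

theorem CompatDepth.congr {N : ℕ} {c d d' : ℕ → ℕ} (h : CompatDepth N c d)
    (he : ∀ i ≤ N, d i = d' i) : CompatDepth N c d' := by
  intro p q δ hpq hq hp hq' hb
  refine h p q δ hpq hq (by rwa [he p (by omega)]) (by rwa [he q hq]) fun m h1 h2 => ?_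
  rw [he m (by omega)]
  exact hb m h1 h2

/-- If `s` is the last element of the order, then every compatible tight depth function is an
expansion at `s`.  If, say, the column `s` is deeper than the column `s + 1`, then its parent has
to be `s + 1`: a parent `p < s` would be a neighbour of `s + 1` at depth `D s - 1`, with the
relation `c s < c p`. -/
theorem exists_expansion {N s : ℕ} {c D : ℕ → ℕ} (hs : s ≤ N)
    (htop : ∀ i ≤ N, i ≠ s → c i < c s) (hD : TightDepth (N + 1) D)
    (hc : CompatDepth (N + 1) c D) :
    ∃ d, (∀ i, D i = expandPlus s d i) ∨ ∀ i, D i = expandMinus s d i := by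
  have h1 : D (s + 1) < D s → D s = D (s + 1) + 1 ∧ D (s + 1) % 2 = 0 := by
    intro hlt
    rcases Nat.mod_two_eq_zero_or_one (D s) with h2 | h2
    · obtain ⟨p, hp, hp1, hb⟩ := hD.left s (by omega) (by omega) h2
      have := (hc p (s + 1) (D s) (by omega) (by omega) (by omega) hlt (fun m h3 h4 => by
        rcases Nat.lt_or_ge m s with h5 | h5
        · exact hb m h3 h5
        · rw [show m = s by omega])).1 h2 p le_rfl (by omega)
      have := htop p (by omega) (by omega)
      simp only [Nat.add_sub_cancel] at *
      omega
    · obtain ⟨q, hqN, hq, hq1, hb⟩ := hD.right s (by omega) h2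
      by_cases h3 : q = s + 1
      · subst h3; omega
      · have := hb (s + 1) (by omega) (by omega)
        omega
  have h1' : D s < D (s + 1) → D (s + 1) = D s + 1 ∧ D s % 2 = 1 := by
    intro hlt
    rcases Nat.mod_two_eq_zero_or_one (D (s + 1)) with h2 | h2
    · obtain ⟨p, hp, hp1, hb⟩ := hD.left (s + 1) (by omega) (by omega) h2
      by_cases h3 : p = s
      · subst h3; omega
      · have := hb s (by omega) (by omega)
        omega
    · obtain ⟨q, hqN, hq, hq1, hb⟩ := hD.right (s + 1) (by omega) h2
      have := (hc s q (D (s + 1)) (by omega) (by omega) hlt (by omega) (fun m h3 h4 => by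
        rcases Nat.lt_or_ge (s + 1) m with h5 | h5
        · exact hb m h5 h4
        · rw [show m = s + 1 by omega])).2 h2 (s + 1) (by omega) (by omega)
      have := htop (s + 1) (by omega) (by omega)
      omega
  -- the column `s` of the contracted depth function has the smaller one of the two depths
  refine ⟨fun i => if i < s then D i else if i = s then min (D s) (D (s + 1)) else D (i + 1), ?_⟩
  have key : ∀ E : ℕ → ℕ, IsExpansion s
      (fun i => if i < s then D i else if i = s then min (D s) (D (s + 1)) else D (i + 1)) E →
      E s = D s → E (s + 1) = D (s + 1) → ∀ i, D i = E i := by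
    intro E hE e1 e2 i
    rcases lt_trichotomy i s with h | h | h
    · rw [hE.lt i h, if_pos h]
    · rw [h, e1]
    · rcases Nat.lt_or_ge (s + 1) i with h3 | h3
      · obtain ⟨j, rfl⟩ : ∃ j, i = j + 1 := ⟨i - 1, by omega⟩
        rw [hE.gt j (by omega), if_neg (by omega), if_neg (by omega)]
      · rw [show i = s + 1 by omega, e2]
  by_cases hcase : D (s + 1) < D s ∨ (D s = D (s + 1) ∧ D s % 2 = 1)
  · left
    apply key _ (isExpansion_expandPlus s _)
    · simp only [expandPlus_self, lt_irrefl, if_true, if_false]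
      split_ifs <;> omega
    · simp only [expandPlus_succ, lt_irrefl, if_true, if_false]
      omega
  · right
    apply key _ (isExpansion_expandMinus s _)
    · simp only [expandMinus_self, lt_irrefl, if_true, if_false]
      omega
    · simp only [expandMinus_succ, lt_irrefl, if_true, if_false]
      split_ifs <;> omega

/-! ### Links between depth functions -/

/-- `e` is the leftmost column of depth zero, that is the strongly extremal column of a diagram of
odd height. -/
def IsFirstZero (d : ℕ → ℕ) (e : ℕ) : Prop := d e = 0 ∧ ∀ m < e, d m ≠ 0

/-- Single block linkage with label `i` in terms of depth functions.  In a complete diagram of odd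
height with depth function `d` a block is added at the top of the column `k`, of depth `1`, which
lies to the left of all columns of depth `0` and so becomes the strongly extremal one.  The column
`i + 1` is the right neighbour of `k` at the level below the new block, so that the entry of the
block is `i`. Dominoes can then be adjoined precisely to the columns between `k` and `i + 1`; they
give the depth function `d'`. -/
structure DepthLinkAt (N : ℕ) (d : ℕ → ℕ) (k i : ℕ) (d' : ℕ → ℕ) : Prop where
  le : k ≤ i
  lt : i < N
  eq_one : d k = 1
  ne_zero : ∀ m ≤ i, d m ≠ 0
  succ_le : d (i + 1) ≤ 1
  eq_zero : d' k = 0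
  lower : ∀ m, k < m → m ≤ i → d' m + 2 = d m
  eq : ∀ m ≤ N, m < k ∨ i < m → d' m = d m

/-- Linkage with label `i`, by a block added to some column. -/
def DepthLink (N : ℕ) (d : ℕ → ℕ) (i : ℕ) (d' : ℕ → ℕ) : Prop := ∃ k, DepthLinkAt N d k i d'

theorem IsFirstZero.unique {d : ℕ → ℕ} {e e' : ℕ} (h : IsFirstZero d e) (h' : IsFirstZero d e') :
    e = e' := by
  rcases lt_trichotomy e e' with hl | hl | hl
  · exact absurd h.1 (h'.2 e hl)
  · exact hl
  · exact absurd h'.1 (h.2 e' hl)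

theorem skip_cases (s i : ℕ) : (i < s ∧ skip s i = i) ∨ (s ≤ i ∧ skip s i = i + 1) := by
  rw [skip]; split_ifs <;> omega

theorem collapse_cases (s i : ℕ) :
    (i ≤ s ∧ collapse s i = i) ∨ (s < i ∧ collapse s i + 1 = i) := by
  rw [collapse]; split_ifs <;> omega

theorem expandPlus_pair (s : ℕ) (d : ℕ → ℕ) :
    ((d s % 2 = 0 ∧ expandPlus s d s = d s + 1) ∨ (d s % 2 = 1 ∧ expandPlus s d s = d s)) ∧
      expandPlus s d (s + 1) = d s := by
  rw [expandPlus_self, expandPlus_succ]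
  split_ifs <;> omega

theorem expandMinus_pair (s : ℕ) (d : ℕ → ℕ) :
    ((d s % 2 = 1 ∧ expandMinus s d (s + 1) = d s + 1) ∨
      (d s % 2 = 0 ∧ expandMinus s d (s + 1) = d s)) ∧ expandMinus s d s = d s := by
  rw [expandMinus_self, expandMinus_succ]
  split_ifs <;> omega

theorem index_cases (s m : ℕ) : m < s ∨ m = s ∨ m = s + 1 ∨ ∃ j, s < j ∧ m = j + 1 := by
  by_cases h : s + 1 < m
  · exact Or.inr (Or.inr (Or.inr ⟨m - 1, by omega, by omega⟩))
  · omega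

theorem IsFirstZero.expandPlus {d : ℕ → ℕ} {e : ℕ} (h : IsFirstZero d e) (s : ℕ) :
    IsFirstZero (expandPlus s d) (skip s e) := by
  have hE := isExpansion_expandPlus s d
  have hp := expandPlus_pair s d
  have hsk := skip_cases s e
  refine ⟨?_, fun m hm => ?_⟩
  · rcases lt_trichotomy e s with hl | rfl | hl
    · rw [skip, if_pos hl, hE.lt e hl, h.1]
    · rw [skip, if_neg (by omega), hp.2, h.1]
    · rw [skip, if_neg (by omega), hE.gt e hl, h.1]
  · rcases index_cases s m with hl | rfl | rfl | ⟨j, hl, rfl⟩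
    · rw [hE.lt m hl]; exact h.2 m (by omega)
    · have := h.2 m
      omega
    · have := h.2 s (by omega)
      omega
    · rw [hE.gt j hl]; exact h.2 j (by omega)

theorem IsFirstZero.expandMinus {d : ℕ → ℕ} {e : ℕ} (h : IsFirstZero d e) (s : ℕ) :
    IsFirstZero (expandMinus s d) (skip (s + 1) e) := by
  have hE := isExpansion_expandMinus s d
  have hp := expandMinus_pair s d
  have hsk := skip_cases (s + 1) e
  refine ⟨?_, fun m hm => ?_⟩
  · rcases lt_trichotomy e s with hl | rfl | hl
    · rw [skip, if_pos (by omega), hE.lt e hl, h.1]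
    · rw [skip, if_pos (by omega), hp.2, h.1]
    · rw [skip, if_neg (by omega), hE.gt e hl, h.1]
  · rcases index_cases s m with hl | rfl | rfl | ⟨j, hl, rfl⟩
    · rw [hE.lt m hl]; exact h.2 m (by omega)
    · have := h.2 m
      omega
    · have := h.2 s (by omega)
      omega
    · rw [hE.gt j hl]; exact h.2 j (by omega)

/-- The edge of a binary fusion which joins the two copies of a vertex with label `s`. -/
theorem depthLink_cross {N s : ℕ} {d : ℕ → ℕ} (hs : s ≤ N) (h : IsFirstZero d s) :
    DepthLink (N + 1) (expandPlus s d) s (expandMinus s d) := by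
  have hp := expandPlus_pair s d
  have hm := expandMinus_pair s d
  have h0 := h.1
  refine ⟨s, le_rfl, by omega, by omega, fun m hm => ?_, by omega, by omega,
    fun m _ _ => by omega, fun m hm => ?_⟩
  · rcases hm.eq_or_lt with rfl | hm
    · omega
    · rw [expandPlus_lt hm]; exact h.2 m hm
  · rcases index_cases s m with hl | rfl | rfl | ⟨j, hl, rfl⟩
    · rw [expandPlus_lt hl, expandMinus_lt hl]; simp
    · omega
    · omega
    · rw [expandPlus_gt (by omega), expandMinus_gt (by omega)]; simp

theorem DepthLink.expandPlus {N s i : ℕ} {d d' : ℕ → ℕ} (hs : s ≤ N) (h : DepthLink N d i d') :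
    DepthLink (N + 1) (expandPlus s d) (skip s i) (expandPlus s d') := by
  obtain ⟨k, h⟩ := h
  have e := expandPlus_pair s d
  have e' := expandPlus_pair s d'
  have hsi := skip_cases s i
  have hsk := skip_cases (s) k
  have b1 := h.eq_one
  have b2 := h.eq_zero
  have b3 := h.lower s
  have b4 := h.eq s hs
  have b5 := h.ne_zero s
  have b6 := h.le
  have b7 := h.lt
  have b8 := h.succ_le
  have hks : s = k → d s = 1 ∧ d' s = 0 := by rintro rfl; exact ⟨b1, b2⟩
  have his : s = i + 1 → d s ≤ 1 := by rintro rfl; exact b8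
  refine ⟨skip (s) k, by omega, by omega, ?_, fun m hm => ?_, ?_, ?_, fun m hm hm' => ?_,
    fun m hm hm' => ?_⟩
  · rcases index_cases s (skip (s) k) with hl | hl | hl | ⟨j, hl, hj⟩
    · rw [expandPlus_lt hl]; exact (congrArg d (by omega)).trans b1
    · rw [hl]; omega
    · rw [hl]; omega
    · rw [hj, expandPlus_gt hl]; exact (congrArg d (by omega)).trans b1
  · rcases index_cases s m with hl | rfl | rfl | ⟨j, hl, rfl⟩
    · rw [expandPlus_lt hl]; exact h.ne_zero m (by omega)
    · omega
    · omega
    · rw [expandPlus_gt hl]; exact h.ne_zero j (by omega)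
  · rcases index_cases s (skip s i + 1) with hl | hl | hl | ⟨j, hl, hj⟩
    · rw [expandPlus_lt hl]; convert b8 using 2; omega
    · rw [hl]; omega
    · omega
    · rw [hj, expandPlus_gt hl]; convert b8 using 2; omega
  · rcases index_cases s (skip (s) k) with hl | hl | hl | ⟨j, hl, hj⟩
    · rw [expandPlus_lt hl, ← b2]; congr 1; omega
    · rw [hl]; omega
    · rw [hl]; omega
    · rw [hj, expandPlus_gt hl, ← b2]; congr 1; omega
  · rcases index_cases s m with hl | rfl | rfl | ⟨j, hl, rfl⟩
    · rw [expandPlus_lt hl, expandPlus_lt hl]; exact h.lower m (by omega) (by omega)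
    · omega
    · omega
    · rw [expandPlus_gt hl, expandPlus_gt hl]; exact h.lower j (by omega) (by omega)
  · rcases index_cases s m with hl | rfl | rfl | ⟨j, hl, rfl⟩
    · rw [expandPlus_lt hl, expandPlus_lt hl]; exact h.eq m (by omega) (by omega)
    · omega
    · omega
    · rw [expandPlus_gt hl, expandPlus_gt hl]; exact h.eq j (by omega) (by omega)

theorem DepthLink.expandMinus {N s i : ℕ} {d d' : ℕ → ℕ} (hs : s ≤ N) (h : DepthLink N d i d') :
    DepthLink (N + 1) (expandMinus s d) (skip s i) (expandMinus s d') := by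
  obtain ⟨k, h⟩ := h
  have e := expandMinus_pair s d
  have e' := expandMinus_pair s d'
  have hsi := skip_cases s i
  have hsk := skip_cases (s + 1) k
  have b1 := h.eq_one
  have b2 := h.eq_zero
  have b3 := h.lower s
  have b4 := h.eq s hs
  have b5 := h.ne_zero s
  have b6 := h.le
  have b7 := h.lt
  have b8 := h.succ_le
  have hks : s = k → d s = 1 ∧ d' s = 0 := by rintro rfl; exact ⟨b1, b2⟩
  have his : s = i + 1 → d s ≤ 1 := by rintro rfl; exact b8
  refine ⟨skip (s + 1) k, by omega, by omega, ?_, fun m hm => ?_, ?_, ?_, fun m hm hm' => ?_,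
    fun m hm hm' => ?_⟩
  · rcases index_cases s (skip (s + 1) k) with hl | hl | hl | ⟨j, hl, hj⟩
    · rw [expandMinus_lt hl]; exact (congrArg d (by omega)).trans b1
    · rw [hl]; omega
    · rw [hl]; omega
    · rw [hj, expandMinus_gt hl]; exact (congrArg d (by omega)).trans b1
  · rcases index_cases s m with hl | rfl | rfl | ⟨j, hl, rfl⟩
    · rw [expandMinus_lt hl]; exact h.ne_zero m (by omega)
    · omega
    · omega
    · rw [expandMinus_gt hl]; exact h.ne_zero j (by omega)
  · rcases index_cases s (skip s i + 1) with hl | hl | hl | ⟨j, hl, hj⟩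
    · rw [expandMinus_lt hl]; convert b8 using 2; omega
    · rw [hl]; omega
    · omega
    · rw [hj, expandMinus_gt hl]; convert b8 using 2; omega
  · rcases index_cases s (skip (s + 1) k) with hl | hl | hl | ⟨j, hl, hj⟩
    · rw [expandMinus_lt hl, ← b2]; congr 1; omega
    · rw [hl]; omega
    · rw [hl]; omega
    · rw [hj, expandMinus_gt hl, ← b2]; congr 1; omega
  · rcases index_cases s m with hl | rfl | rfl | ⟨j, hl, rfl⟩
    · rw [expandMinus_lt hl, expandMinus_lt hl]; exact h.lower m (by omega) (by omega)
    · omega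
    · omega
    · rw [expandMinus_gt hl, expandMinus_gt hl]; exact h.lower j (by omega) (by omega)
  · rcases index_cases s m with hl | rfl | rfl | ⟨j, hl, rfl⟩
    · rw [expandMinus_lt hl, expandMinus_lt hl]; exact h.eq m (by omega) (by omega)
    · omega
    · omega
    · rw [expandMinus_gt hl, expandMinus_gt hl]; exact h.eq j (by omega) (by omega)

set_option maxHeartbeats 800000 in
/-- A link between expansions whose label is not `s` is one between the depth functions that are
expanded: the two columns `s`, `s + 1` are contracted. -/
theorem DepthLink.of_expansion {N s i : ℕ} {d d' D D' : ℕ → ℕ} (hs : s ≤ N)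
    (hD : IsExpansion s d D) (hD' : IsExpansion s d' D') (his : i ≠ s)
    (h : DepthLink (N + 1) D i D') : ∃ i', i = skip s i' ∧ DepthLink N d i' d' := by
  obtain ⟨k, h⟩ := h
  have p1 := hD.pair
  have p2 := hD'.pair
  have hc := collapse_cases s k
  obtain ⟨i', hi'⟩ : ∃ i', i = skip s i' :=
    ⟨if i < s then i else i - 1, by simp only [skip]; split_ifs <;> omega⟩
  have hsi := skip_cases s i'
  have b1 := h.eq_one
  have b2 := h.eq_zero
  have b3 := h.lower s
  have b3' := h.lower (s + 1)
  have b4 := h.eq s (by omega)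
  have b4' := h.eq (s + 1) (by omega)
  have b5 := h.ne_zero s
  have b5' := h.ne_zero (s + 1)
  have b6 := h.le
  have b7 := h.lt
  have b8 := h.succ_le
  have hks : s = k → D s = 1 ∧ D' s = 0 := by rintro rfl; exact ⟨b1, b2⟩
  have hks' : s + 1 = k → D (s + 1) = 1 ∧ D' (s + 1) = 0 := by rintro rfl; exact ⟨b1, b2⟩
  have his' : s = i + 1 → D s ≤ 1 := by rintro rfl; exact b8
  refine ⟨i', hi', collapse s k, by omega, by omega, ?_, fun m hm => ?_, ?_, ?_, fun m hm hm' => ?_,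
    fun m hm hm' => ?_⟩
  · rcases lt_trichotomy (collapse s k) s with hl | hl | hl
    · rw [← hD.lt _ hl, ← b1]; congr 1; omega
    · rw [hl]; omega
    · rw [← hD.gt _ hl, ← b1]; congr 1; omega
  · rcases lt_trichotomy m s with hl | rfl | hl
    · rw [← hD.lt m hl]; exact h.ne_zero m (by omega)
    · omega
    · rw [← hD.gt m hl]; exact h.ne_zero _ (by omega)
  · rcases lt_trichotomy (i' + 1) s with hl | hl | hl
    · rw [← hD.lt _ hl]; convert b8 using 2; omega
    · rw [hl]; omega
    · rw [← hD.gt _ hl]; convert b8 using 2; omega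
  · rcases lt_trichotomy (collapse s k) s with hl | hl | hl
    · rw [← hD'.lt _ hl, ← b2]; congr 1; omega
    · rw [hl]; omega
    · rw [← hD'.gt _ hl, ← b2]; congr 1; omega
  · rcases lt_trichotomy m s with hl | rfl | hl
    · rw [← hD.lt m hl, ← hD'.lt m hl]; exact h.lower m (by omega) (by omega)
    · have b3 := b3 (by omega) (by omega)
      have b3' := b3' (by omega) (by omega)
      clear b4 b4' b5 b5' hks hks' his' hc hsi
      omega
    · rw [← hD.gt m hl, ← hD'.gt m hl]; exact h.lower _ (by omega) (by omega)
  · rcases lt_trichotomy m s with hl | rfl | hl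
    · rw [← hD.lt m hl, ← hD'.lt m hl]; exact h.eq m (by omega) (by omega)
    · clear b3 b3' b5 b5' b8 his'
      rcases hm' with hm' | hm'
      · by_cases hk : k = m + 1
        · omega
        · have b4 := b4 (by omega)
          have b4' := b4' (by omega)
          omega
      · have b4 := b4 (by omega)
        have b4' := b4' (by omega)
        clear hks hks' hc hsi
        omega
    · rw [← hD.gt m hl, ← hD'.gt m hl]; exact h.eq _ (by omega) (by omega)

/-- A link with label `s` between expansions at `s` adds a block to the column `s`, and nothing else
changes. -/
theorem DepthLink.expansion_self {N s : ℕ} {d d' D D' : ℕ → ℕ} (hs : s ≤ N)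
    (hD : IsExpansion s d D) (hD' : IsExpansion s d' D') (h : DepthLink (N + 1) D s D') :
    IsFirstZero d s ∧ D s = 1 ∧ D' s = 0 ∧ ∀ m ≤ N, d' m = d m := by
  obtain ⟨k, h⟩ := h
  have p1 := hD.pair
  have p2 := hD'.pair
  have b3 := h.lower s
  have b4 := h.eq (s + 1) (by omega) (by omega)
  have b5 := h.ne_zero s
  have b1 := h.eq_one
  have b2 := h.eq_zero
  have b6 := h.le
  have b8 := h.succ_le
  have hks : k = s := by omega
  subst hks
  have h0 : d k = 0 ∧ d' k = 0 := by omega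
  refine ⟨⟨h0.1, fun m hm => ?_⟩, b1, b2, fun m hm => ?_⟩
  · rw [← hD.lt m hm]; exact h.ne_zero m hm.le
  · rcases lt_trichotomy m k with hl | rfl | hl
    · rw [← hD.lt m hl, ← hD'.lt m hl, h.eq m (by omega) (by omega)]
    · omega
    · rw [← hD.gt m hl, ← hD'.gt m hl, h.eq _ (by omega) (by omega)]

/-! ### The two ends of a link -/

section

variable {N : ℕ} {d d' : ℕ → ℕ}

theorem DepthLinkAt.congr {e e' : ℕ → ℕ} {k i : ℕ} (h : DepthLinkAt N d k i d')
    (he : ∀ m ≤ N, d m = e m) (he' : ∀ m ≤ N, d' m = e' m) : DepthLinkAt N e k i e' := by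
  have h1 := h.le
  have h2 := h.lt
  refine ⟨h1, h2, ?_, fun m hm => ?_, ?_, ?_, fun m hm hm' => ?_, fun m hm hm' => ?_⟩
  · rw [← he k (by omega)]; exact h.eq_one
  · rw [← he m (by omega)]; exact h.ne_zero m hm
  · rw [← he _ (by omega)]; exact h.succ_le
  · rw [← he' k (by omega)]; exact h.eq_zero
  · rw [← he m (by omega), ← he' m (by omega)]; exact h.lower m hm hm'
  · rw [← he m (by omega), ← he' m (by omega)]; exact h.eq m hm hm'

theorem DepthLinkAt.isFirstZero {k i : ℕ} (h : DepthLinkAt N d k i d') : IsFirstZero d' k := by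
  refine ⟨h.eq_zero, fun m hm => ?_⟩
  have h1 := h.le
  have h2 := h.lt
  rw [h.eq m (by omega) (Or.inl hm)]
  exact h.ne_zero m (by omega)

/-- No parent relation crosses the border of the columns `k, …, i` of lowered depth, as `d ≤ 1` at
the columns `k` and `i + 1`. -/
theorem DepthLinkAt.tightDepth {k i : ℕ} (h : DepthLinkAt N d k i d') (hd : TightDepth N d) :
    TightDepth N d' := by
  have h1 := h.le
  have h2 := h.lt
  have h3 := h.eq_one
  have h4 := h.eq_zero
  have h5 := h.succ_le
  refine ⟨⟨k, by omega, h4⟩, fun m hm hm0 hm2 => ?_, fun m hm hm2 => ?_⟩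
  · have hmk : m ≠ k := by rintro rfl; exact hm0 h4
    by_cases hmi : k < m ∧ m ≤ i
    · have e1 := h.lower m hmi.1 hmi.2
      obtain ⟨p, hp, hp1, hb⟩ := hd.left m hm (by omega) (by omega)
      have hkp : k < p := by
        have := hb k
        have : p = k → d p = d k := by rintro rfl; rfl
        omega
      have e2 := h.lower p hkp (by omega)
      refine ⟨p, hp, by omega, fun u hu hu' => ?_⟩
      have := hb u hu hu'
      have := h.lower u (by omega) (by omega)
      omega
    · have e1 := h.eq m hm (by omega)
      obtain ⟨p, hp, hp1, hb⟩ := hd.left m hm (by omega) (by omega)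
      have hp' : m < k ∨ i < p := by
        have := hb (i + 1)
        have : m = i + 1 → d m = d (i + 1) := by rintro rfl; rfl
        omega
      have e2 := h.eq p (by omega) (by omega)
      refine ⟨p, hp, by omega, fun u hu hu' => ?_⟩
      rw [h.eq u (by omega) (by omega), e1]
      exact hb u hu hu'
  · have hmk : m ≠ k := by rintro rfl; omega
    by_cases hmi : k < m ∧ m ≤ i
    · have e1 := h.lower m hmi.1 hmi.2
      obtain ⟨q, hqN, hq, hq1, hb⟩ := hd.right m hm (by omega)
      have hqi : q ≤ i := by
        have := hb (i + 1)
        have : q = i + 1 → d q = d (i + 1) := by rintro rfl; rfl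
        omega
      have e2 := h.lower q (by omega) hqi
      refine ⟨q, hqN, hq, by omega, fun u hu hu' => ?_⟩
      have := hb u hu hu'
      have := h.lower u (by omega) (by omega)
      omega
    · have e1 := h.eq m hm (by omega)
      by_cases hm1 : m < k ∧ d m = 1
      · refine ⟨k, by omega, hm1.1, by omega, fun u hu hu' => ?_⟩
        rw [h.eq u (by omega) (by omega)]
        have := h.ne_zero u (by omega)
        omega
      obtain ⟨q, hqN, hq, hq1, hb⟩ := hd.right m hm (by omega)
      have hq' : q < k ∨ i < m := by
        have := hb k
        have : q = k → d q = d k := by rintro rfl; rfl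
        omega
      have e2 := h.eq q hqN (by omega)
      refine ⟨q, hqN, hq, by omega, fun u hu hu' => ?_⟩
      rw [h.eq u (by omega) (by omega), e1]
      exact hb u hu hu'

/-- The column to the right of a column of depth zero has depth at most one. -/
theorem TightDepth.succ_le_one (hd : TightDepth N d) {i : ℕ} (hi : i < N) (h0 : d i = 0) :
    d (i + 1) ≤ 1 := by
  by_contra hlt
  rcases Nat.mod_two_eq_zero_or_one (d (i + 1)) with h2 | h2
  · obtain ⟨p, hp, hp1, hb⟩ := hd.left (i + 1) (by omega) (by omega) h2
    have := hb i
    have : p = i → d p = d i := by rintro rfl; rfl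
    omega
  · obtain ⟨q, hqN, hq, hq1, hb⟩ := hd.right (i + 1) (by omega) h2
    obtain ⟨p, hp, hp1, hb'⟩ := hd.left q hqN (by omega) (by omega)
    have := hb p
    have := hb' i
    have : p = i → d p = d i := by rintro rfl; rfl
    have : p = i + 1 → d p = d (i + 1) := by rintro rfl; rfl
    omega

/-- The depth function that has a link with label `i` to `d`, whose first zero is `e`: the linkage
that adds a block to the column `e` is undone. -/
def linkSource (d : ℕ → ℕ) (e i m : ℕ) : ℕ :=
  if m = e then 1 else if e < m ∧ m ≤ i then d m + 2 else d m

theorem depthLinkAt_linkSource (hd : TightDepth N d) {e i : ℕ} (he : IsFirstZero d e) (hei : e ≤ i)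
    (hi : i < N) (hi0 : d i = 0) : DepthLinkAt N (linkSource d e i) e i d := by
  have h1 := hd.succ_le_one hi hi0
  refine ⟨hei, hi, by simp [linkSource], fun m hm => ?_, ?_, he.1, fun m hm hm' => ?_,
    fun m hm hm' => ?_⟩
  · have := he.2 m
    rw [linkSource]; split_ifs <;> omega
  · rw [linkSource]; split_ifs <;> omega
  · rw [linkSource]; split_ifs <;> omega
  · rw [linkSource]; split_ifs <;> omega

/-- Another zero `k > i` of `d` is needed, as the zeros of `d` at `e, …, i` are removed; the
columns of depth `1` to the left of `k`, among them `e`, get `k` as parent. -/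
theorem TightDepth.linkSource (hd : TightDepth N d) {e i k : ℕ} (he : IsFirstZero d e)
    (hei : e ≤ i) (hi0 : d i = 0) (hik : i < k) (hkN : k ≤ N) (hk0 : d k = 0)
    (hb : ∀ m, i < m → m < k → d m ≠ 0) : TightDepth N (linkSource d e i) := by
  have z1 : ∀ m, m < e ∨ i < m → _root_.linkSource d e i m = d m := fun m hm => by
    rw [_root_.linkSource, if_neg (by omega), if_neg (by omega)]
  have z2 : _root_.linkSource d e i e = 1 := by simp [_root_.linkSource]
  have z3 : ∀ m, e < m → m ≤ i → _root_.linkSource d e i m = d m + 2 := fun m hm hm' => by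
    rw [_root_.linkSource, if_neg (by omega), if_pos ⟨hm, hm'⟩]
  generalize _root_.linkSource d e i = z at *
  have he0 := he.1
  have hpos : ∀ m < k, 1 ≤ z m := by
    intro m hm
    have := he.2 m
    have := hb m
    rcases lt_trichotomy m e with h | rfl | h
    · rw [z1 m (Or.inl h)]; omega
    · omega
    · by_cases h' : m ≤ i
      · rw [z3 m h h']; omega
      · rw [z1 m (by omega)]; omega
  have hkz : z k = 0 := by rw [z1 k (by omega), hk0]
  refine ⟨⟨k, hkN, hkz⟩, fun m hm hm0 hm2 => ?_, fun m hm hm2 => ?_⟩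
  · have hme : m ≠ e := by rintro rfl; omega
    by_cases hmi : e < m ∧ m ≤ i
    · have e1 := z3 m hmi.1 hmi.2
      by_cases hdm : d m = 0
      · refine ⟨e, hmi.1, by omega, fun u hu hu' => ?_⟩
        rw [z3 u hu (by omega)]; omega
      obtain ⟨p, hp, hp1, hb⟩ := hd.left m hm (by omega) (by omega)
      have hep : e < p := by
        have := hb e
        have : p = e → d p = d e := by rintro rfl; rfl
        omega
      refine ⟨p, hp, by rw [z3 p hep (by omega)]; omega, fun u hu hu' => ?_⟩
      have := hb u hu hu'
      rw [z3 u (by omega) (by omega)]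
      omega
    · have e1 := z1 m (by omega)
      obtain ⟨p, hp, hp1, hb⟩ := hd.left m hm (by omega) (by omega)
      have hp' : m < e ∨ i < p := by
        have := hb i
        have : p = i → d p = d i := by rintro rfl; rfl
        omega
      refine ⟨p, hp, by rw [z1 p (by omega)]; omega, fun u hu hu' => ?_⟩
      rw [z1 u (by omega), e1]
      exact hb u hu hu'
  · by_cases hm1 : z m = 1 ∧ m < k
    · exact ⟨k, hkN, hm1.2, by omega, fun u hu hu' => by have := hpos u hu'; omega⟩
    have hme : m ≠ e := by rintro rfl; omega
    by_cases hmi : e < m ∧ m ≤ i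
    · have e1 := z3 m hmi.1 hmi.2
      obtain ⟨q, hqN, hq, hq1, hb⟩ := hd.right m hm (by omega)
      have hqi : q ≤ i := by
        have := hb i
        have : m = i → d m = d i := by rintro rfl; rfl
        omega
      refine ⟨q, hqN, hq, by rw [z3 q (by omega) hqi]; omega, fun u hu hu' => ?_⟩
      have := hb u hu hu'
      rw [z3 u (by omega) (by omega)]
      omega
    · have e1 := z1 m (by omega)
      obtain ⟨q, hqN, hq, hq1, hb⟩ := hd.right m hm (by omega)
      have hq' : q < e ∨ i < m := by
        have := hb e
        have : q = e → d q = d e := by rintro rfl; rfl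
        omega
      refine ⟨q, hqN, hq, by rw [z1 q (by omega)]; omega, fun u hu hu' => ?_⟩
      rw [z1 u (by omega), e1]
      exact hb u hu hu'

end

/-! ### Dominoes and completion -/

theorem Fin.exists_first {n : ℕ} {P : Fin n → Prop} (h : ∃ k, P k) : ∃ k, P k ∧ ∀ m < k, ¬ P m := by
  obtain ⟨k, hk, hm⟩ := wellFounded_lt.has_min {k | P k} h
  exact ⟨k, hk, fun m hm' hP => hm m hP hm'⟩

theorem Fin.exists_last {n : ℕ} {P : Fin n → Prop} (h : ∃ k, P k) : ∃ k, P k ∧ ∀ m > k, ¬ P m := by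
  obtain ⟨k, hk, hm⟩ := wellFounded_gt.has_min {k | P k} h
  exact ⟨k, hk, fun m hm' hP => hm m hP hm'⟩

namespace Diagram

variable {t : ℕ}

/-- The parent `q` of a column `k` is the nearest higher column to its right (left) if the height
of `k` is even (odd).  This is the only column that can serve as the neighbour of `k` in a domino
adjunction. -/
def IsParent (h : Fin (t + 1) → ℕ) (k q : Fin (t + 1)) : Prop :=
  h k < h q ∧ ((h k % 2 = 0 ∧ k < q ∧ ∀ m, k < m → m < q → h m ≤ h k) ∨
    (h k % 2 = 1 ∧ q < k ∧ ∀ m, q < m → m < k → h m ≤ h k))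

/-- A domino can be adjoined to the column `k`. -/
def Raisable (h : Fin (t + 1) → ℕ) (k : Fin (t + 1)) : Prop :=
  ∃ q, IsParent h k q ∧ h k + 2 ≤ h q

theorem IsParent.unique {h : Fin (t + 1) → ℕ} {k q q' : Fin (t + 1)} (hq : IsParent h k q)
    (hq' : IsParent h k q') : q = q' := by
  obtain ⟨h1, ⟨h2, h3, h4⟩ | ⟨h2, h3, h4⟩⟩ := hq <;>
    obtain ⟨h1', ⟨h2', h3', h4'⟩ | ⟨h2', h3', h4'⟩⟩ := hq'
  · have := h4 q'
    have := h4' q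
    omega
  · omega
  · omega
  · have := h4 q'
    have := h4' q
    omega

theorem exists_isParent_of_higher {h : Fin (t + 1) → ℕ} {k q : Fin (t + 1)} (hq : h k < h q)
    (hside : (h k % 2 = 0 ∧ k < q) ∨ (h k % 2 = 1 ∧ q < k)) : ∃ q, IsParent h k q := by
  rcases hside with ⟨h2, hkq⟩ | ⟨h2, hkq⟩
  · obtain ⟨p, ⟨hp, hp'⟩, hmin⟩ := Fin.exists_first (P := fun m => k < m ∧ h k < h m) ⟨q, hkq, hq⟩
    refine ⟨p, hp', Or.inl ⟨h2, hp, fun m h3 h4 => ?_⟩⟩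
    have := hmin m h4
    omega
  · obtain ⟨p, ⟨hp, hp'⟩, hmin⟩ := Fin.exists_last (P := fun m => m < k ∧ h k < h m) ⟨q, hkq, hq⟩
    refine ⟨p, hp', Or.inr ⟨h2, hp, fun m h3 h4 => ?_⟩⟩
    have := hmin m h3
    omega

/-- This is what the boundary conditions amount to: if no column on the side of the parent of `k` is
higher than `k`, then the outermost one of the height of `k` on this side violates them. -/
theorem exists_isParent (D : Diagram t) {k : Fin (t + 1)} (hk : D.ht k < D.height) :
    ∃ q, IsParent D.ht k q := by
  by_contra hno
  rcases Nat.mod_two_eq_zero_or_one (D.ht k) with h2 | h2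
  · have hle : ∀ m, k < m → D.ht m ≤ D.ht k := fun m hm => by
      by_contra hlt
      exact hno (exists_isParent_of_higher (not_le.1 hlt) (Or.inl ⟨h2, hm⟩))
    obtain ⟨p, ⟨hp, hp'⟩, hmax⟩ := Fin.exists_last (P := fun m => k ≤ m ∧ D.ht m = D.ht k)
      ⟨k, le_rfl, rfl⟩
    rcases D.right_boundary p (fun m hm => by
      have := hle m (by omega)
      have := hmax m hm
      omega) with h3 | h3
    · rw [Nat.odd_iff] at h3; omega
    · change D.ht p = D.height at h3; omega
  · have hle : ∀ m, m < k → D.ht m ≤ D.ht k := fun m hm => by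
      by_contra hlt
      exact hno (exists_isParent_of_higher (not_le.1 hlt) (Or.inr ⟨h2, hm⟩))
    obtain ⟨p, ⟨hp, hp'⟩, hmax⟩ := Fin.exists_first (P := fun m => m ≤ k ∧ D.ht m = D.ht k)
      ⟨k, le_rfl, rfl⟩
    rcases D.left_boundary p (fun m hm => by
      have := hle m (by omega)
      have := hmax m hm
      omega) with h3 | h3
    · rw [Nat.even_iff] at h3; omega
    · change D.ht p = D.height at h3; omega

/-- A height function in which every column below the maximum has a parent is a diagram. -/
def ofParent (h : Fin (t + 1) → ℕ)
    (hp : ∀ k, h k ≠ Finset.univ.sup h → ∃ q, IsParent h k q) : Diagram t where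
  ht := h
  left_boundary i hi := by
    by_cases hs : h i = Finset.univ.sup h
    · exact Or.inr hs
    · obtain ⟨q, hq, ⟨h2, -⟩ | ⟨-, h3, -⟩⟩ := hp i hs
      · exact Or.inl (Nat.even_iff.2 h2)
      · have := hi q h3
        omega
  right_boundary i hi := by
    by_cases hs : h i = Finset.univ.sup h
    · exact Or.inr hs
    · obtain ⟨q, hq, ⟨-, h3, -⟩ | ⟨h2, -⟩⟩ := hp i hs
      · have := hi q h3
        omega
      · exact Or.inl (Nat.odd_iff.2 h2)

/-- A criterion for a height function to be a diagram of height `r`, with higher columns in place of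
parents. -/
theorem exists_diagram {h : Fin (t + 1) → ℕ} {r : ℕ} (hr : ∀ k, h k ≤ r) (hr' : ∃ k, h k = r)
    (hp : ∀ k, h k < r → ∃ q, h k < h q ∧ ((h k % 2 = 0 ∧ k < q) ∨ (h k % 2 = 1 ∧ q < k))) :
    ∃ D : Diagram t, D.ht = h ∧ D.height = r := by
  have hsup : Finset.univ.sup h = r := by
    obtain ⟨k, hk⟩ := hr'
    exact le_antisymm (Finset.sup_le fun k _ => hr k) (hk ▸ Finset.le_sup (Finset.mem_univ k))
  refine ⟨ofParent h fun k hk => ?_, rfl, hsup⟩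
  rw [hsup] at hk
  obtain ⟨q, h1, h2⟩ := hp k (lt_of_le_of_ne (hr k) hk)
  exact exists_isParent_of_higher h1 h2

theorem dominoAdj_iff {D D' : Diagram t} : D.DominoAdj D' ↔
    ∃ k, Raisable D.ht k ∧ D'.ht = Function.update D.ht k (D.ht k + 2) := by
  constructor
  · rintro ⟨k, hD, hk⟩
    refine ⟨k, ?_, hD⟩
    rcases hk with ⟨he, q, ⟨h1, -, -, h4⟩, ⟨-, -, h3, -⟩⟩ | ⟨he, q, ⟨h1, -, -, h4⟩, ⟨-, h3, -, -⟩⟩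
    · rw [hD, Function.update_of_ne h1.ne'] at h3
      refine ⟨q, ⟨by omega, Or.inl ⟨Nat.even_iff.1 he, h1, fun m h5 h6 => ?_⟩⟩, h3⟩
      have := h4 m h5 h6
      rw [hD, Function.update_of_ne h5.ne'] at this
      omega
    · rw [hD, Function.update_of_ne h1.ne] at h3
      refine ⟨q, ⟨by omega, Or.inr ⟨Nat.odd_iff.1 he, h1, fun m h5 h6 => ?_⟩⟩, h3⟩
      have := h4 m h5 h6
      rw [hD, Function.update_of_ne h6.ne] at this
      omega
  · rintro ⟨k, ⟨q, ⟨h1, hside⟩, h2⟩, hD⟩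
    have hk : D'.ht k = D.ht k + 2 := by rw [hD]; simp
    have hne : ∀ m, m ≠ k → D'.ht m = D.ht m := fun m hm => by rw [hD]; simp [hm]
    refine ⟨k, hD, ?_⟩
    rcases hside with ⟨h3, h4, h5⟩ | ⟨h3, h4, h5⟩
    · refine Or.inl ⟨Nat.even_iff.2 h3, q, ⟨h4, by omega, by rw [hne q h4.ne']; omega, ?_⟩,
        ⟨h4, by omega, by rw [hne q h4.ne']; omega, ?_⟩⟩ <;>
      · intro m h6 h7
        rw [hne m h6.ne']
        have := h5 m h6 h7
        omega
    · refine Or.inr ⟨Nat.odd_iff.2 h3, q, ⟨h4, by rw [hne q h4.ne]; omega, by omega, ?_⟩,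
        ⟨h4, by rw [hne q h4.ne]; omega, by omega, ?_⟩⟩ <;>
      · intro m h6 h7
        rw [hne m h7.ne]
        have := h5 m h6 h7
        omega

theorem exists_raise (D : Diagram t) {k : Fin (t + 1)} (hk : Raisable D.ht k) :
    ∃ D' : Diagram t, D'.ht = Function.update D.ht k (D.ht k + 2) ∧ D'.height = D.height := by
  obtain ⟨q, ⟨h1, hside⟩, h2⟩ := hk
  have hqr := D.le_height q
  have hqk : q ≠ k := by rintro rfl; omega
  refine exists_diagram (fun m => ?_) ?_ fun m hm => ?_
  · by_cases hmk : m = k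
    · subst hmk; simp; omega
    · simp [hmk, D.le_height m]
  · obtain ⟨m, hm⟩ := D.exists_ht_eq
    have : m ≠ k := by rintro rfl; omega
    exact ⟨m, by simp [this, hm]⟩
  · by_cases hmk : m = k
    · subst hmk
      simp only [Function.update_self] at hm ⊢
      by_cases hq : D.ht q = D.ht m + 2
      · obtain ⟨p, hp1, hp2⟩ := D.exists_isParent (k := q) (by omega)
        refine ⟨p, ?_, ?_⟩
        · rw [Function.update_of_ne (by rintro rfl; omega)]; omega
        · omega
      · refine ⟨q, ?_, ?_⟩
        · rw [Function.update_of_ne hqk]; omega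
        · omega
    · simp only [Function.update_of_ne hmk] at hm ⊢
      obtain ⟨p, hp1, hp2⟩ := D.exists_isParent hm
      refine ⟨p, ?_, ?_⟩
      · by_cases hpk : p = k
        · subst hpk; simp; omega
        · simpa [hpk] using hp1
      · omega

/-- Domino adjunctions to different columns do not interfere.  If `k` stands between `k'` and the
parent of `k'`, and gets higher than `k'`, then both have had the same height, and `k` becomes the
parent of `k'`. -/
theorem Raisable.update {h : Fin (t + 1) → ℕ} {k k' : Fin (t + 1)} (hk : Raisable h k)
    (hk' : Raisable h k') (hne : k' ≠ k) : Raisable (Function.update h k (h k + 2)) k' := by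
  obtain ⟨q, ⟨h1, hside⟩, h2⟩ := hk
  obtain ⟨q', ⟨h1', hside'⟩, h2'⟩ := hk'
  have e : ∀ m, Function.update h k (h k + 2) m = if m = k then h k + 2 else h m := fun m => by
    by_cases hm : m = k
    · subst hm; simp
    · simp [hm]
  have eq' : h q' ≤ Function.update h k (h k + 2) q' := by
    rw [e]; split_ifs with hm
    · subst hm; omega
    · exact le_rfl
  have ek' : Function.update h k (h k + 2) k' = h k' := by simp [hne]
  by_cases hb : ((k' < k ∧ k < q') ∨ (q' < k ∧ k < k')) ∧ h k' < h k + 2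
  · obtain ⟨hb, hlt⟩ := hb
    have hkk : h k = h k' := by
      rcases hside' with ⟨h3, h4, h5⟩ | ⟨h3, h4, h5⟩
      · have h6 := h5 k (by omega) (by omega)
        rcases hside with ⟨h3', h4', h5'⟩ | ⟨h3', h4', h5'⟩
        · omega
        · have := h5' k'
          have := h5 q
          by_contra
          have : q = k' ∨ k' < q := by omega
          rcases this with rfl | this <;> omega
      · have h6 := h5 k (by omega) (by omega)
        rcases hside with ⟨h3', h4', h5'⟩ | ⟨h3', h4', h5'⟩
        · have := h5' k'
          have := h5 q
          by_contra
          have : q = k' ∨ q < k' := by omega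
          rcases this with rfl | this <;> omega
        · omega
    refine ⟨k, ⟨by simp [hne]; omega, ?_⟩, by simp [hne]; omega⟩
    rw [ek']
    rcases hside' with ⟨h3, h4, h5⟩ | ⟨h3, h4, h5⟩
    · refine Or.inl ⟨h3, by omega, fun m h6 h7 => ?_⟩
      rw [Function.update_of_ne h7.ne]
      exact h5 m h6 (by omega)
    · refine Or.inr ⟨h3, by omega, fun m h6 h7 => ?_⟩
      rw [Function.update_of_ne h6.ne']
      exact h5 m (by omega) h7
  · refine ⟨q', ⟨by omega, ?_⟩, by omega⟩
    rw [ek']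
    rcases hside' with ⟨h3, h4, h5⟩ | ⟨h3, h4, h5⟩
    · refine Or.inl ⟨h3, h4, fun m h6 h7 => ?_⟩
      have := h5 m h6 h7
      rw [e]
      split_ifs with hm
      · subst hm; omega
      · exact this
    · refine Or.inr ⟨h3, h4, fun m h6 h7 => ?_⟩
      have := h5 m h6 h7
      rw [e]
      split_ifs with hm
      · subst hm; omega
      · exact this

theorem DominoAdj.diamond {D D₁ D₂ : Diagram t} (h₁ : D.DominoAdj D₁) (h₂ : D.DominoAdj D₂) :
    ∃ E, Relation.ReflGen DominoAdj D₁ E ∧ Relation.ReflTransGen DominoAdj D₂ E := by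
  obtain ⟨k₁, hk₁, e₁⟩ := dominoAdj_iff.1 h₁
  obtain ⟨k₂, hk₂, e₂⟩ := dominoAdj_iff.1 h₂
  by_cases hk : k₁ = k₂
  · subst hk
    obtain rfl : D₁ = D₂ := Diagram.ext (e₁.trans e₂.symm)
    exact ⟨D₁, .refl, .refl⟩
  · have r₁ : Raisable D₁.ht k₂ := e₁ ▸ hk₁.update hk₂ (Ne.symm hk)
    have r₂ : Raisable D₂.ht k₁ := e₂ ▸ hk₂.update hk₁ hk
    obtain ⟨E, hE, -⟩ := D₁.exists_raise r₁
    refine ⟨E, .single (dominoAdj_iff.2 ⟨k₂, r₁, hE⟩),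
      .single (dominoAdj_iff.2 ⟨k₁, r₂, hE.trans ?_⟩)⟩
    rw [e₁, e₂, Function.update_of_ne hk, Function.update_of_ne (Ne.symm hk),
      Function.update_comm hk]

theorem DominoAdj.height_eq {D D' : Diagram t} (h : D.DominoAdj D') : D'.height = D.height := by
  obtain ⟨k, hk, e⟩ := dominoAdj_iff.1 h
  obtain ⟨E, hE, hE'⟩ := D.exists_raise hk
  rw [show D' = E from Diagram.ext (e.trans hE.symm), hE']

/-- Domino adjunction raises columns but not the height of the diagram, and so terminates. -/
theorem exists_completion (D : Diagram t) :
    ∃ E, Relation.ReflTransGen DominoAdj D E ∧ E.IsComplete := by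
  induction hn : ∑ k, (D.height - D.ht k) using Nat.strong_induction_on generalizing D with
  | _ n ih =>
    by_cases hD : D.IsComplete
    · exact ⟨D, .refl, hD⟩
    · simp only [IsComplete, not_forall, not_not] at hD
      obtain ⟨D', hD'⟩ := hD
      have hH := hD'.height_eq
      obtain ⟨k, ⟨q, -, hq⟩, e⟩ := dominoAdj_iff.1 hD'
      have hqr := D.le_height q
      obtain ⟨E, hE, hE'⟩ := ih (∑ k, (D'.height - D'.ht k)) (by
        rw [← hn]
        refine Finset.sum_lt_sum (fun m _ => ?_) ⟨k, Finset.mem_univ k, ?_⟩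
        · rw [hH, e]
          by_cases hm : m = k
          · subst hm; simp; omega
          · simp [hm]
        · rw [hH, e]; simp; omega) D' rfl
      exact ⟨E, .head hD' hE, hE'⟩

theorem IsComplete.eq_of_reflTransGen {D E : Diagram t} (hD : D.IsComplete)
    (h : Relation.ReflTransGen DominoAdj D E) : D = E := by
  rcases h.cases_head with h | ⟨D', h, -⟩
  · exact h
  · exact absurd h (hD D')

/-- The complete diagram obtained by adjoining dominoes. -/
noncomputable def completion (D : Diagram t) : Diagram t := Classical.choose D.exists_completion

theorem reflTransGen_completion (D : Diagram t) :
    Relation.ReflTransGen DominoAdj D D.completion := (Classical.choose_spec D.exists_completion).1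

theorem isComplete_completion (D : Diagram t) : D.completion.IsComplete :=
  (Classical.choose_spec D.exists_completion).2

/-- By the diamond property the completion does not depend on the order of the adjunctions. -/
theorem completion_unique {D E : Diagram t} (h : Relation.ReflTransGen DominoAdj D E)
    (hE : E.IsComplete) : D.completion = E := by
  obtain ⟨F, h1, h2⟩ := Relation.church_rosser (fun _ _ _ h h' => DominoAdj.diamond h h')
    D.reflTransGen_completion h
  rw [D.isComplete_completion.eq_of_reflTransGen h1, hE.eq_of_reflTransGen h2]

theorem completion_eq_of_reflTransGen {D E : Diagram t}
    (h : Relation.ReflTransGen DominoAdj D E) : D.completion = E.completion :=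
  completion_unique (h.trans E.reflTransGen_completion) E.isComplete_completion

/-- A diagram is complete if each column below the top is one block lower than its parent. -/
theorem isComplete_iff {D : Diagram t} : D.IsComplete ↔
    ∀ k, D.ht k < D.height → ∃ q, IsParent D.ht k q ∧ D.ht q = D.ht k + 1 := by
  constructor
  · intro h k hk
    obtain ⟨q, hq⟩ := D.exists_isParent hk
    refine ⟨q, hq, ?_⟩
    by_contra hne
    have hr : Raisable D.ht k := ⟨q, hq, by have := hq.1; omega⟩
    obtain ⟨D', hD', -⟩ := D.exists_raise hr
    exact h D' (dominoAdj_iff.2 ⟨k, hr, hD'⟩)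
  · intro h D' hD'
    obtain ⟨k, ⟨q, hq, hq2⟩, -⟩ := dominoAdj_iff.1 hD'
    have := D.le_height q
    obtain ⟨q', hq', h1⟩ := h k (by omega)
    obtain rfl := hq.unique hq'
    omega

/-- A set `S` of columns can be raised by one domino each, if the parent of every column of `S` is
high enough or belongs to `S`: begin with a column of maximal height in `S`, whose parent cannot
belong to `S`. -/
theorem exists_cascade (D : Diagram t) (S : Finset (Fin (t + 1)))
    (hS : ∀ k ∈ S, ∃ q, IsParent D.ht k q ∧ (D.ht k + 2 ≤ D.ht q ∨ q ∈ S)) :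
    ∃ D' : Diagram t, D'.ht = (fun k => if k ∈ S then D.ht k + 2 else D.ht k) ∧
      Relation.ReflTransGen DominoAdj D D' := by
  induction S using Finset.strongInduction generalizing D with
  | _ S ih =>
    rcases S.eq_empty_or_nonempty with rfl | hne
    · exact ⟨D, by simp, .refl⟩
    obtain ⟨k, hkS, hmax⟩ := S.exists_max_image D.ht hne
    have hr : Raisable D.ht k := by
      obtain ⟨q, hq, h2 | h2⟩ := hS k hkS
      · exact ⟨q, hq, h2⟩
      · have := hmax q h2
        have := hq.1
        omega
    obtain ⟨D₁, hD₁, -⟩ := D.exists_raise hr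
    have ek : D₁.ht k = D.ht k + 2 := by rw [hD₁]; simp
    have ene : ∀ m, m ≠ k → D₁.ht m = D.ht m := fun m hm => by rw [hD₁]; simp [hm]
    obtain ⟨D', hD', hD''⟩ := ih (S.erase k) (Finset.erase_ssubset hkS) D₁ (fun u hu => by
      obtain ⟨huk, huS⟩ := Finset.mem_erase.1 hu
      obtain ⟨q, ⟨hq, hside⟩, hq2⟩ := hS u huS
      have huk' := hmax u huS
      by_cases hb : ((u < k ∧ k < q) ∨ (q < k ∧ k < u)) ∧ D.ht u = D.ht k
      · obtain ⟨hb, he⟩ := hb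
        refine ⟨k, ⟨by rw [ek, ene u huk]; omega, ?_⟩, Or.inl (by rw [ek, ene u huk]; omega)⟩
        rw [ene u huk]
        rcases hside with ⟨h3, h4, h5⟩ | ⟨h3, h4, h5⟩
        · refine Or.inl ⟨h3, by omega, fun m h6 h7 => ?_⟩
          rw [ene m h7.ne]; exact h5 m h6 (by omega)
        · refine Or.inr ⟨h3, by omega, fun m h6 h7 => ?_⟩
          rw [ene m h6.ne']; exact h5 m (by omega) h7
      · have hqle : D.ht q ≤ D₁.ht q := by
          by_cases hqk : q = k
          · subst hqk; omega
          · rw [ene q hqk]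
        refine ⟨q, ⟨by rw [ene u huk]; omega, ?_⟩, ?_⟩
        · rw [ene u huk]
          rcases hside with ⟨h3, h4, h5⟩ | ⟨h3, h4, h5⟩
          · refine Or.inl ⟨h3, h4, fun m h6 h7 => ?_⟩
            have h8 := h5 m h6 h7
            by_cases hmk : m = k
            · subst hmk; omega
            · rwa [ene m hmk]
          · refine Or.inr ⟨h3, h4, fun m h6 h7 => ?_⟩
            have h8 := h5 m h6 h7
            by_cases hmk : m = k
            · subst hmk; omega
            · rwa [ene m hmk]
        · by_cases hqk : q = k
          · subst hqk
            left; rw [ene u huk]; omega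
          · rw [ene u huk, Finset.mem_erase]
            rcases hq2 with h | h
            · left; omega
            · exact Or.inr ⟨hqk, h⟩)
    refine ⟨D', ?_, .head (dominoAdj_iff.2 ⟨k, hr, hD₁⟩) hD''⟩
    rw [hD']
    funext m
    by_cases hmk : m = k
    · subst hmk; simp [hkS, ek]
    · simp [hmk, ene m hmk]

end Diagram

/-! ### The depth function of a class -/

namespace Diagram

variable {t : ℕ}

theorem ht_strongCol (D : Diagram t) : D.ht D.strongCol = D.height := D.strongCol_spec.1

theorem ht_lt_of_lt_strongCol (D : Diagram t) (h : D.height % 2 = 1) {k : Fin (t + 1)}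
    (hk : k < D.strongCol) : D.ht k < D.height := by
  rcases D.strongCol_spec.2 with ⟨-, h2⟩ | ⟨h1, -⟩
  · exact h2 k hk
  · rw [Nat.even_iff] at h1; omega

theorem ht_lt_of_strongCol_lt (D : Diagram t) (h : D.height % 2 = 0) {k : Fin (t + 1)}
    (hk : D.strongCol < k) : D.ht k < D.height := by
  rcases D.strongCol_spec.2 with ⟨h1, -⟩ | ⟨-, h2⟩
  · rw [Nat.odd_iff] at h1; omega
  · exact h2 k hk

theorem strongCol_eq_of_odd {D : Diagram t} {e : Fin (t + 1)} (h : D.height % 2 = 1)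
    (he : D.ht e = D.height) (hlt : ∀ k < e, D.ht k < D.height) : D.strongCol = e :=
  D.strongCol_spec.unique ⟨he, Or.inl ⟨Nat.odd_iff.2 h, hlt⟩⟩

theorem strongCol_eq_of_even {D : Diagram t} {e : Fin (t + 1)} (h : D.height % 2 = 0)
    (he : D.ht e = D.height) (hlt : ∀ k > e, D.ht k < D.height) : D.strongCol = e :=
  D.strongCol_spec.unique ⟨he, Or.inr ⟨Nat.even_iff.2 h, hlt⟩⟩

/-- The depth of the column `k`, for a complete diagram.  At odd height `r` it is the difference to
the maximal height `r`.  At even height it is defined so as to agree with that of the diagram of odd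
height `r + 1` which arises by half-domino adjunction and completion; there the columns to the right
of the strongly extremal one are two blocks higher. -/
noncomputable def depth (D : Diagram t) (k : Fin (t + 1)) : ℕ :=
  if D.height % 2 = 1 then D.height - D.ht k
  else if k < D.strongCol then D.height + 1 - D.ht k
  else if k = D.strongCol then 0 else D.height - 1 - D.ht k

/-- A half-domino can always be adjoined. -/
theorem exists_halfDomino (D : Diagram t) : ∃ D' : Diagram t,
    D'.ht = Function.update D.ht D.strongCol (D.height + 1) ∧ D'.height = D.height + 1 := by
  have he := D.ht_strongCol
  refine exists_diagram (fun k => ?_) ⟨D.strongCol, by simp⟩ fun k hk => ?_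
  · have := D.le_height k
    by_cases hk : k = D.strongCol
    · subst hk; simp
    · simp [hk]; omega
  · have hke : k ≠ D.strongCol := by rintro rfl; simp at hk
    have hle := D.le_height k
    rw [Function.update_of_ne hke]
    by_cases hlt : D.ht k < D.height
    · obtain ⟨q, h1, h2⟩ := D.exists_isParent hlt
      refine ⟨q, ?_, by omega⟩
      by_cases hq : q = D.strongCol
      · subst hq; simp; omega
      · simpa [hq] using h1
    · refine ⟨D.strongCol, by simp; omega, ?_⟩
      have h1 := D.ht_lt_of_lt_strongCol (k := k)
      have h2 := D.ht_lt_of_strongCol_lt (k := k)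
      omega

/-- After half-domino adjunction to a complete diagram of odd (even) height, completion adds one
domino to each column to the left (right) of the strongly extremal one. -/
theorem IsComplete.exists_halfDomino_completion {D : Diagram t} (hD : D.IsComplete) :
    ∃ D₁ D₂ : Diagram t, D₁.ht = Function.update D.ht D.strongCol (D.height + 1) ∧
      Relation.ReflTransGen DominoAdj D₁ D₂ ∧ D₂.height = D.height + 1 ∧
      D₂.strongCol = D.strongCol ∧ D₂.IsComplete ∧
      ∀ k, D₂.ht k = if k = D.strongCol then D.height + 1
        else if (D.height % 2 = 1 ∧ k < D.strongCol) ∨ (D.height % 2 = 0 ∧ D.strongCol < k)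
        then D.ht k + 2 else D.ht k := by
  obtain ⟨D₁, hD₁, hH₁⟩ := D.exists_halfDomino
  have he := D.ht_strongCol
  have hlt := fun k => D.ht_lt_of_lt_strongCol (k := k)
  have hgt := fun k => D.ht_lt_of_strongCol_lt (k := k)
  generalize hee : D.strongCol = e at *
  have e1 : D₁.ht e = D.height + 1 := by rw [hD₁]; simp
  have e2 : ∀ m, m ≠ e → D₁.ht m = D.ht m := fun m hm => by rw [hD₁]; simp [hm]
  rw [isComplete_iff] at hD
  obtain ⟨D₂, hD₂, hgen⟩ := D₁.exists_cascade
    (Finset.univ.filter fun k => (D.height % 2 = 1 ∧ k < e) ∨ (D.height % 2 = 0 ∧ e < k))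
    fun k hk => by
      simp only [Finset.mem_filter, Finset.mem_univ, true_and] at hk ⊢
      have hke : k ≠ e := by rintro rfl; simp at hk
      have hk1 : D.ht k < D.height := by
        rcases hk with hk | hk
        · exact hlt k hk.1 hk.2
        · exact hgt k hk.1 hk.2
      obtain ⟨q, ⟨hq1, hside⟩, hq2⟩ := hD k hk1
      have hle : D.ht q ≤ D₁.ht q := by
        by_cases hq : q = e
        · subst hq; omega
        · rw [e2 q hq]
      refine ⟨q, ⟨by rw [e2 k hke]; omega, ?_⟩, ?_⟩
      · rw [e2 k hke]
        rcases hside with ⟨h3, h4, h5⟩ | ⟨h3, h4, h5⟩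
        · refine Or.inl ⟨h3, h4, fun m h6 h7 => ?_⟩
          have := h5 m h6 h7
          rw [e2 m (by rintro rfl; omega)]; exact this
        · refine Or.inr ⟨h3, h4, fun m h6 h7 => ?_⟩
          have := h5 m h6 h7
          rw [e2 m (by rintro rfl; omega)]; exact this
      · rw [e2 k hke]
        by_cases hq : q = e
        · subst hq; left; omega
        · right
          rcases hside with ⟨h3, h4, h5⟩ | ⟨h3, h4, h5⟩
          · have := h5 e
            omega
          · have := h5 e
            omega
  have key : ∀ k, D₂.ht k = if k = e then D.height + 1
        else if (D.height % 2 = 1 ∧ k < e) ∨ (D.height % 2 = 0 ∧ e < k)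
        then D.ht k + 2 else D.ht k := by
    intro k
    rw [hD₂]
    simp only [Finset.mem_filter, Finset.mem_univ, true_and]
    by_cases hk : k = e
    · subst hk; simp [e1]
    · rw [e2 k hk, if_neg hk]
  have hle : ∀ k, D₂.ht k ≤ D.height + 1 := by
    intro k
    have h1 := key k
    have h2 := D.le_height k
    have h3 := hlt k
    have h4 := hgt k
    split_ifs at h1 with h5 h6 <;> omega
  have hH : D₂.height = D.height + 1 := D₂.height_eq hle (i := e) (by rw [key, if_pos rfl])
  refine ⟨D₁, D₂, hD₁, hgen, hH, ?_, ?_, key⟩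
  · rcases Nat.mod_two_eq_zero_or_one D.height with h2 | h2
    · refine strongCol_eq_of_odd (by omega) (by rw [key, if_pos rfl, hH]) fun k hk => ?_
      have h1 := key k
      have h3 := D.le_height k
      rw [if_neg hk.ne, if_neg (by omega)] at h1
      omega
    · refine strongCol_eq_of_even (by omega) (by rw [key, if_pos rfl, hH]) fun k hk => ?_
      have h1 := key k
      have h3 := D.le_height k
      rw [if_neg hk.ne', if_neg (by omega)] at h1
      omega
  · rw [isComplete_iff]
    intro k hk
    rw [hH] at hk
    have hke : k ≠ e := by rintro rfl; rw [key, if_pos rfl] at hk; omega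
    have k1 := key k
    rw [if_neg hke] at k1
    have k2 := D.le_height k
    have k3 := hlt k
    have k4 := hgt k
    by_cases htop : D.ht k = D.height
    · have k5 := key e
      rw [if_pos rfl] at k5
      rw [if_neg (by omega)] at k1
      refine ⟨e, ⟨by omega, ?_⟩, by omega⟩
      rcases Nat.mod_two_eq_zero_or_one D.height with h2 | h2
      · refine Or.inl ⟨by omega, by omega, fun m h6 h7 => ?_⟩
        rw [key m, if_neg h7.ne, if_neg (by omega), k1, htop]
        exact D.le_height m
      · refine Or.inr ⟨by omega, by omega, fun m h6 h7 => ?_⟩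
        rw [key m, if_neg h6.ne', if_neg (by omega), k1, htop]
        exact D.le_height m
    · obtain ⟨q, ⟨hq1, hside⟩, hq2⟩ := hD k (by omega)
      have kq := key q
      have h5e : (D.ht k % 2 = 0 → k < e → e < q → D.height ≤ D.ht k) ∧
          (D.ht k % 2 = 1 → q < e → e < k → D.height ≤ D.ht k) := by
        rcases hside with ⟨h3, h4, h5⟩ | ⟨h3, h4, h5⟩
        · have := h5 e
          omega
        · have := h5 e
          omega
      have hqe : q ≠ e := by
        rintro rfl
        rw [if_pos rfl] at kq
        split_ifs at k1 <;> omega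
      rw [if_neg hqe] at kq
      have hsame : ((D.height % 2 = 1 ∧ k < e) ∨ (D.height % 2 = 0 ∧ e < k)) ↔
          ((D.height % 2 = 1 ∧ q < e) ∨ (D.height % 2 = 0 ∧ e < q)) := by omega
      simp only [← hsame] at kq
      refine ⟨q, ⟨by split_ifs at k1 kq <;> omega, ?_⟩, by split_ifs at k1 kq <;> omega⟩
      rcases hside with ⟨h3, h4, h5⟩ | ⟨h3, h4, h5⟩
      · refine Or.inl ⟨by split_ifs at k1 <;> omega, h4, fun m h6 h7 => ?_⟩
        have k6 := key m
        have := h5 m h6 h7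
        have hme : m ≠ e := by rintro rfl; omega
        rw [if_neg hme] at k6
        split_ifs at k1 k6 <;> omega
      · refine Or.inr ⟨by split_ifs at k1 <;> omega, h4, fun m h6 h7 => ?_⟩
        have k6 := key m
        have := h5 m h6 h7
        have hme : m ≠ e := by rintro rfl; omega
        rw [if_neg hme] at k6
        split_ifs at k1 k6 <;> omega

theorem HalfDominoAdj.ht_eq {D D' : Diagram t} (h : D.HalfDominoAdj D') :
    D'.ht = Function.update D.ht D.strongCol (D.height + 1) := by
  obtain ⟨k, hk, hD⟩ := h
  obtain rfl := hk.unique D.strongCol_spec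
  rw [hD, D.ht_strongCol]

theorem halfDominoAdj_of_ht_eq {D D' : Diagram t}
    (h : D'.ht = Function.update D.ht D.strongCol (D.height + 1)) : D.HalfDominoAdj D' :=
  ⟨D.strongCol, D.strongCol_spec, by rw [AddBlock, h, D.ht_strongCol]⟩

/-- Half-domino adjunction commutes with domino adjunction. -/
theorem DominoAdj.halfDomino {D E D' E' : Diagram t} (h : D.DominoAdj E)
    (hD : D.HalfDominoAdj D') (hE : E.HalfDominoAdj E') : D'.DominoAdj E' := by
  have hs := h.strong D.strongCol_spec
  have hs' := hs.unique E.strongCol_spec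
  have e1 := hD.ht_eq
  have e2 := hE.ht_eq
  rw [← hs', h.height_eq] at e2
  obtain ⟨k, ⟨q, ⟨hq, hside⟩, hq2⟩, hk⟩ := dominoAdj_iff.1 h
  have hqr := D.le_height q
  have he := D.ht_strongCol
  generalize D.strongCol = e at *
  have hke : k ≠ e := by rintro rfl; omega
  have f1 : ∀ m, m ≠ e → D'.ht m = D.ht m := fun m hm => by rw [e1]; simp [hm]
  have f2 : D'.ht e = D.height + 1 := by rw [e1]; simp
  have hle : D.ht q ≤ D'.ht q := by
    by_cases hq : q = e
    · subst hq; omega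
    · rw [f1 q hq]
  refine dominoAdj_iff.2 ⟨k, ⟨q, ⟨by rw [f1 k hke]; omega, ?_⟩, by rw [f1 k hke]; omega⟩, ?_⟩
  · rw [f1 k hke]
    rcases hside with ⟨h3, h4, h5⟩ | ⟨h3, h4, h5⟩
    · refine Or.inl ⟨h3, h4, fun m h6 h7 => ?_⟩
      have := h5 m h6 h7
      rw [f1 m (by rintro rfl; omega)]; exact this
    · refine Or.inr ⟨h3, h4, fun m h6 h7 => ?_⟩
      have := h5 m h6 h7
      rw [f1 m (by rintro rfl; omega)]; exact this
  · rw [e2, hk, f1 k hke, e1, Function.update_comm hke]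

theorem reflTransGen_halfDomino {D E D' : Diagram t} (h : Relation.ReflTransGen DominoAdj D E)
    (hD : D.HalfDominoAdj D') :
    ∃ E', E.HalfDominoAdj E' ∧ Relation.ReflTransGen DominoAdj D' E' := by
  induction h with
  | refl => exact ⟨D', hD, .refl⟩
  | @tail F E h1 h2 ih =>
    obtain ⟨F', hF, hF'⟩ := ih
    obtain ⟨E', hE', -⟩ := E.exists_halfDomino
    exact ⟨E', halfDominoAdj_of_ht_eq hE',
      hF'.tail (h2.halfDomino hF (halfDominoAdj_of_ht_eq hE'))⟩

/-- The diagram with two full rows added at the bottom.  It is equivalent to `D` by a row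
cancellation. -/
def shift (D : Diagram t) : Diagram t :=
  ofParent (fun k => D.ht k + 2) fun k hk => by
    have h1 : Finset.univ.sup (fun k => D.ht k + 2) = D.height + 2 := by
      obtain ⟨i, hi⟩ := D.exists_ht_eq
      refine le_antisymm (Finset.sup_le fun k _ => Nat.add_le_add_right (D.le_height k) 2) ?_
      rw [← hi]
      exact Finset.le_sup (f := fun k => D.ht k + 2) (Finset.mem_univ i)
    rw [h1] at hk
    have := D.le_height k
    obtain ⟨q, h2, h3⟩ := D.exists_isParent (k := k) (by omega)
    exact exists_isParent_of_higher (q := q) (by omega) (by omega)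

@[simp] theorem ht_shift (D : Diagram t) (k : Fin (t + 1)) : D.shift.ht k = D.ht k + 2 := rfl

theorem height_shift (D : Diagram t) : D.shift.height = D.height + 2 := by
  obtain ⟨i, hi⟩ := D.exists_ht_eq
  refine D.shift.height_eq (i := i) (fun k => ?_) ?_
  · have := D.le_height k
    simpa using this
  · simpa using hi

theorem isParent_shift {D : Diagram t} {k q : Fin (t + 1)} :
    IsParent D.shift.ht k q ↔ IsParent D.ht k q := by
  simp only [IsParent, ht_shift, Nat.add_mod_right, add_lt_add_iff_right, add_le_add_iff_right]

theorem isComplete_shift {D : Diagram t} : D.shift.IsComplete ↔ D.IsComplete := by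
  simp only [isComplete_iff, isParent_shift, height_shift, ht_shift, add_lt_add_iff_right]
  refine forall_congr' fun k => imp_congr_right fun _ => exists_congr fun q =>
    and_congr_right fun _ => ?_
  omega

theorem DominoAdj.shift {D E : Diagram t} (h : D.DominoAdj E) : D.shift.DominoAdj E.shift := by
  obtain ⟨k, ⟨q, hq, hq2⟩, hk⟩ := dominoAdj_iff.1 h
  refine dominoAdj_iff.2 ⟨k, ⟨q, isParent_shift.2 hq, by simp; omega⟩, ?_⟩
  funext m
  rw [ht_shift, hk]
  by_cases hm : m = k
  · subst hm; simp
  · simp [hm]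

theorem strongCol_shift (D : Diagram t) : D.shift.strongCol = D.strongCol := by
  rcases Nat.mod_two_eq_zero_or_one D.height with h | h
  · refine strongCol_eq_of_even (by rw [height_shift]; omega)
      (by rw [height_shift, ht_shift, D.ht_strongCol]) fun k hk => ?_
    have := D.ht_lt_of_strongCol_lt h hk
    rw [height_shift, ht_shift]; omega
  · refine strongCol_eq_of_odd (by rw [height_shift]; omega)
      (by rw [height_shift, ht_shift, D.ht_strongCol]) fun k hk => ?_
    have := D.ht_lt_of_lt_strongCol h hk
    rw [height_shift, ht_shift]; omega

theorem depth_shift (D : Diagram t) : D.shift.depth = D.depth := by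
  funext k
  have h1 := D.le_height k
  have h2 : k ≠ D.strongCol → ¬ k < D.strongCol → D.height % 2 = 0 → D.ht k < D.height :=
    fun h3 h4 h5 => D.ht_lt_of_strongCol_lt h5 (by omega)
  simp only [depth, strongCol_shift, height_shift, ht_shift]
  split_ifs <;> omega

theorem completion_shift (D : Diagram t) : D.shift.completion = D.completion.shift :=
  completion_unique (Relation.ReflTransGen.lift shift
    (fun _ _ (h : DominoAdj _ _) => h.shift) _ _ D.reflTransGen_completion)
    (isComplete_shift.2 D.isComplete_completion)

/-- Cancelling two equal rows and adding two full rows at the bottom amounts to adjoining a domino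
to each of the columns which do not reach the equal rows. -/
theorem RowCancel.reflTransGen_shift {D D' : Diagram t} {i : ℕ} (hi : i + 2 ≤ D.height)
    (hrow : D.EqualRows i) (h : D'.ht = fun k => if i + 2 ≤ D.ht k then D.ht k - 2 else D.ht k) :
    Relation.ReflTransGen DominoAdj D D'.shift := by
  obtain ⟨E, hE, hgen⟩ := D.exists_cascade (Finset.univ.filter fun k => D.ht k ≤ i) fun k hk => by
    simp only [Finset.mem_filter, Finset.mem_univ, true_and] at hk ⊢
    obtain ⟨q, hq⟩ := D.exists_isParent (k := k) (by omega)
    refine ⟨q, hq, ?_⟩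
    have := hrow q
    have := hq.1
    omega
  convert hgen
  refine Diagram.ext ?_
  funext k
  have := hrow k
  rw [ht_shift, h, hE]
  simp only [Finset.mem_filter, Finset.mem_univ, true_and]
  split_ifs <;> omega

theorem IsComplete.depth_halfDomino {D : Diagram t} (hD : D.IsComplete) {D₁ : Diagram t}
    (h : D.HalfDominoAdj D₁) : D₁.completion.depth = D.depth := by
  obtain ⟨E₁, D₂, h1, h2, h3, h4, h5, h6⟩ := hD.exists_halfDomino_completion
  obtain rfl : D₁ = E₁ := Diagram.ext (h.ht_eq.trans h1.symm)
  rw [completion_unique h2 h5]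
  funext k
  have k1 := h6 k
  have k2 := D.le_height k
  have k3 := D.ht_lt_of_lt_strongCol (k := k)
  have k4 := D.ht_lt_of_strongCol_lt (k := k)
  have k5 : k = D.strongCol → D.ht k = D.height := by rintro rfl; exact D.ht_strongCol
  simp only [depth, h3, h4]
  split_ifs at * <;> omega

/-- The depth function of the completion is an invariant of the equivalence of diagrams. -/
theorem Move.depth_completion_eq {D D' : Diagram t} (h : D.Move D') :
    D.completion.depth = D'.completion.depth := by
  rcases h with h | h | ⟨i, hrow, h⟩
  · rw [completion_eq_of_reflTransGen (.single h)]
  · obtain ⟨E', hE', h1⟩ := reflTransGen_halfDomino D.reflTransGen_completion h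
    rw [completion_eq_of_reflTransGen h1, D.isComplete_completion.depth_halfDomino hE']
  · by_cases hi : i + 2 ≤ D.height
    · rw [completion_eq_of_reflTransGen (RowCancel.reflTransGen_shift hi hrow h),
        completion_shift, depth_shift]
    -- rows above the top of the diagram are empty, and their cancellation has no effect
    · congr 2
      refine Diagram.ext ?_
      funext k
      have := D.le_height k
      rw [h]
      simp only
      rw [if_neg (by omega)]

end Diagram

namespace DiagramClass

variable {t : ℕ}

open Diagram

/-- The depth function of a class: that of any complete representative. -/
noncomputable def depth (x : DiagramClass t) : Fin (t + 1) → ℕ :=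
  Quot.lift (fun D => D.completion.depth) (fun _ _ h => h.depth_completion_eq) x

theorem depth_mk {D : Diagram t} (hD : D.IsComplete) : (mk D).depth = D.depth := by
  change D.completion.depth = D.depth
  rw [completion_unique .refl hD]

theorem mk_eq_of_reflTransGen {D E : Diagram t} (h : Relation.ReflTransGen DominoAdj D E) :
    mk D = mk E := by
  induction h with
  | refl => rfl
  | tail _ h ih => exact ih.trans (Quot.sound (Or.inl h))

theorem mk_shift (D : Diagram t) : mk D.shift = mk D := by
  refine Quot.sound (Or.inr (Or.inr ⟨0, fun k _ => ?_, ?_⟩))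
  · simp
  · funext k
    simp

theorem mk_halfDomino {D E : Diagram t} (h : D.HalfDominoAdj E) : mk E = mk D :=
  (Quot.sound (r := Move) (Or.inr (Or.inl h))).symm

/-- Every class has a complete representative of odd height. -/
theorem exists_odd_rep (x : DiagramClass t) :
    ∃ D : Diagram t, D.IsComplete ∧ D.height % 2 = 1 ∧ mk D = x := by
  obtain ⟨D, rfl⟩ := Quot.exists_rep x
  have h1 := mk_eq_of_reflTransGen D.reflTransGen_completion
  rcases Nat.mod_two_eq_zero_or_one D.completion.height with h | h
  · obtain ⟨D₁, D₂, h2, h3, h4, -, h5, -⟩ :=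
      D.isComplete_completion.exists_halfDomino_completion
    refine ⟨D₂, h5, by omega, ?_⟩
    rw [← mk_eq_of_reflTransGen h3, mk_halfDomino (halfDominoAdj_of_ht_eq h2), ← h1]
    rfl
  · exact ⟨D.completion, D.isComplete_completion, h, h1.symm⟩

theorem depth_of_odd {D : Diagram t} (h : D.height % 2 = 1) (k : Fin (t + 1)) :
    D.depth k = D.height - D.ht k := by
  rw [Diagram.depth, if_pos h]

/-- Diagrams with equal depths whose heights have the same parity differ by full rows at the
bottom. -/
theorem mk_eq_mk_of_height {n : ℕ} {D E : Diagram t} (h : E.height = D.height + 2 * n)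
    (hd : ∀ k, D.height - D.ht k = E.height - E.ht k) : mk D = mk E := by
  induction n generalizing D with
  | zero =>
    congr 1
    refine Diagram.ext ?_
    funext k
    have := hd k
    have := D.le_height k
    have := E.le_height k
    omega
  | succ n ih =>
    rw [← mk_shift D]
    refine ih (by rw [height_shift]; omega) fun k => ?_
    rw [height_shift, ht_shift, ← hd]
    omega

theorem depth_injective : Function.Injective (depth (t := t)) := by
  intro x y hxy
  obtain ⟨D, hD, hD2, rfl⟩ := exists_odd_rep x
  obtain ⟨E, hE, hE2, rfl⟩ := exists_odd_rep y
  rw [depth_mk hD, depth_mk hE] at hxy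
  have hd : ∀ k, D.height - D.ht k = E.height - E.ht k := fun k => by
    rw [← depth_of_odd hD2, ← depth_of_odd hE2, hxy]
  rcases le_total D.height E.height with h | h
  · exact mk_eq_mk_of_height (n := (E.height - D.height) / 2) (by omega) hd
  · exact (mk_eq_mk_of_height (n := (D.height - E.height) / 2) (by omega) fun k => (hd k).symm).symm

theorem index_mk (D : Diagram t) : (mk D).index = D.strongCol := rfl

end DiagramClass

/-! ### Entries and relations of complete diagrams -/

/-- Extension by zero of a finite sequence; only its values below `n` matter. -/
def extend {n : ℕ} (f : Fin n → ℕ) (i : ℕ) : ℕ := if h : i < n then f ⟨i, h⟩ else 0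

@[simp] theorem extend_val {n : ℕ} (f : Fin n → ℕ) (i : Fin n) : extend f i = f i := by
  simp [extend]

theorem extend_of_lt {n : ℕ} (f : Fin n → ℕ) {i : ℕ} (h : i < n) : extend f i = f ⟨i, h⟩ := by
  simp [extend, h]

/-- The relations of a complete diagram with heights `H`, for all the elements of `T` between two
columns `p < q` that are neighbours at level `l + 1`.  It is the counterpart of `CompatDepth`. -/
def HeightCompat (N : ℕ) (c H : ℕ → ℕ) : Prop :=
  ∀ p q l, p < q → q ≤ N → l < H p → l < H q → (∀ m, p < m → m < q → H m ≤ l) →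
    (l % 2 = 1 → ∀ x, p ≤ x → x + 1 < q → c (q - 1) < c x) ∧
    (l % 2 = 0 → ∀ x, p < x → x < q → c p < c x)

theorem exists_first_gt {P : ℕ → Prop} {x q : ℕ} (hxq : x < q) (hq : P q) :
    ∃ k, x < k ∧ k ≤ q ∧ P k ∧ ∀ m, x < m → m < k → ¬ P m := by
  classical
  have hex : ∃ k, x < k ∧ P k := ⟨q, hxq, hq⟩
  refine ⟨Nat.find hex, (Nat.find_spec hex).1, Nat.find_min' hex ⟨hxq, hq⟩, (Nat.find_spec hex).2,
    fun m h1 h2 h3 => Nat.find_min hex h2 ⟨h1, h3⟩⟩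

theorem exists_last_le {P : ℕ → Prop} {x p : ℕ} (hpx : p ≤ x) (hp : P p) :
    ∃ k, p ≤ k ∧ k ≤ x ∧ P k ∧ ∀ m, k < m → m ≤ x → ¬ P m := by
  classical
  refine ⟨Nat.findGreatest P x, Nat.le_findGreatest hpx hp, Nat.findGreatest_le x,
    Nat.findGreatest_spec hpx hp, fun m h1 h2 => Nat.findGreatest_is_greatest h1 h2⟩

/-- The relations between adjacent levels imply that the entry of a block is the least element of
the whole interval of `T` which lies between the two neighbouring columns.  An element `x` of this
interval that is not an entry at level `l` lies between two neighbours at level `l`, and is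
preceded by one that is, by induction.  The hypotheses `hodd` and `heven` are those of
`AdjacentAt`, and `h` is the family of relations, with the entries at level `l` expressed by their
columns. -/
theorem heightCompat_of_local {N : ℕ} {c H : ℕ → ℕ}
    (hodd : ∀ p q l, l % 2 = 1 → p < q → q ≤ N → l ≤ H p → l < H q → l ≤ H (q - 1))
    (heven : ∀ p q l, l % 2 = 0 → p < q → q ≤ N → l < H p → l ≤ H q → l ≤ H (p + 1))
    (h : ∀ p q l, p < q → q ≤ N → l < H p → l < H q → (∀ m, p < m → m < q → H m ≤ l) →
      (l % 2 = 1 → ∀ k, p ≤ k → k + 1 < q → l ≤ H k → c (q - 1) < c k) ∧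
      (l % 2 = 0 → ∀ k, p < k → k < q → l ≤ H (k + 1) → c p < c k)) :
    HeightCompat N c H := by
  intro p q l hpq
  induction hn : q - p using Nat.strong_induction_on generalizing p q l with
  | _ n ih =>
    intro hq hlp hlq hb
    refine ⟨fun hl x hx hx' => ?_, fun hl x hx hx' => ?_⟩
    · obtain ⟨k, hk1, hk2, hk3, hk4⟩ := exists_last_le (P := fun m => l ≤ H m) hx hlp.le
      obtain ⟨k', hk1', hk2', hk3', hk4'⟩ := exists_first_gt (P := fun m => l ≤ H m)
        (show x < q - 1 by omega) (hodd p q l hl hpq hq hlp.le hlq)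
      have h1 := (h p q l hpq hq hlp hlq hb).1 hl k hk1 (by omega) hk3
      rcases hk2.eq_or_lt with rfl | hkx
      · exact h1
      · have h2 := (ih (k' - k) (by omega) k k' (l - 1) (by omega) rfl (by omega) (by omega)
          (by omega) (fun m h3 h4 => by
            rcases le_or_gt m x with h5 | h5
            · have := hk4 m h3 h5; omega
            · have := hk4' m h5 h4; omega)).2 (by omega) x hkx hk1'
        omega
    · obtain ⟨k', hk1', hk2', hk3', hk4'⟩ := exists_first_gt (P := fun m => l ≤ H m) hx' hlq.le
      obtain ⟨k, hk1, hk2, hk3, hk4⟩ := exists_last_le (P := fun m => l ≤ H m)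
        (show p + 1 ≤ x from hx) (heven p q l hl hpq hq hlp hlq.le)
      have h1 := (h p q l hpq hq hlp hlq hb).2 hl (k' - 1) (by omega) (by omega)
        (by rwa [show k' - 1 + 1 = k' by omega])
      by_cases hxk : x + 1 = k'
      · rwa [show k' - 1 = x by omega] at h1
      · have hl0 : l ≠ 0 := fun h0 => hk4' (x + 1) (by omega) (by omega) (by omega)
        have h2 := (ih (k' - k) (by omega) k k' (l - 1) (by omega) rfl (by omega) (by omega)
          (by omega) (fun m h3 h4 => by
            rcases le_or_gt m x with h5 | h5
            · have := hk4 m h3 h5; omega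
            · have := hk4' m h5 h4; omega)).1 (by omega) x hk2 (by omega)
        omega

namespace Diagram

variable {t : ℕ}

/-- The left (`j` odd) or right (`j` even) neighbour at level `j` of a column that reaches the level
`j + 1` is the adjacent column. -/
def AdjacentAt (D : Diagram t) (j : ℕ) : Prop :=
  ∀ b : Fin t,
    (j % 2 = 1 → j + 1 ≤ D.ht b.succ → (∃ p < b.succ, j ≤ D.ht p) → j ≤ D.ht b.castSucc) ∧
    (j % 2 = 0 → j + 1 ≤ D.ht b.castSucc → (∃ q > b.castSucc, j ≤ D.ht q) → j ≤ D.ht b.succ)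

theorem exists_max_between {n : ℕ} (h : Fin n → ℕ) {p q : Fin n} {x : Fin n} (hpx : p < x)
    (hxq : x < q) : ∃ k, p < k ∧ k < q ∧ ∀ m, p < m → m < q → h m ≤ h k := by
  obtain ⟨k, hk, hmax⟩ := (Finset.Ioo p q).exists_max_image h ⟨x, Finset.mem_Ioo.2 ⟨hpx, hxq⟩⟩
  rw [Finset.mem_Ioo] at hk
  exact ⟨k, hk.1, hk.2, fun m h1 h2 => hmax m (Finset.mem_Ioo.2 ⟨h1, h2⟩)⟩

/-- Otherwise the highest column between the two neighbours could be raised by a domino. -/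
theorem IsComplete.adjacentAt {D : Diagram t} (hD : D.IsComplete) (j : ℕ) : D.AdjacentAt j := by
  rw [isComplete_iff] at hD
  intro b
  have hbb : b.castSucc < b.succ := Fin.castSucc_lt_succ
  refine ⟨fun hj h1 hp => ?_, fun hj h1 hq => ?_⟩
  · by_contra hlt
    obtain ⟨p, ⟨hp1, hp2⟩, hlast⟩ := Fin.exists_last hp
    have hpb : p < b.castSucc := by
      have : p ≠ b.castSucc := by rintro rfl; exact hlt hp2
      rw [Fin.lt_def, Fin.val_succ] at hp1
      rw [Ne, Fin.ext_iff, Fin.val_castSucc] at this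
      rw [Fin.lt_def, Fin.val_castSucc]
      omega
    obtain ⟨k, hk1, hk2, hk3⟩ := exists_max_between D.ht hpb hbb
    have hkj : D.ht k < j := by
      by_contra h
      exact hlast k hk1 ⟨hk2, not_lt.1 h⟩
    have hpr := D.le_height p
    obtain ⟨q, ⟨hq1, ⟨h3, h4, h5⟩ | ⟨h3, h4, h5⟩⟩, hq2⟩ := hD k (by omega)
    · have := h5 b.succ
      have := hk3 q
      have : q = b.succ → D.ht q = D.ht b.succ := by rintro rfl; rfl
      omega
    · have := h5 p
      have := hk3 q
      have : q = p → D.ht q = D.ht p := by rintro rfl; rfl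
      omega
  · by_contra hlt
    obtain ⟨q, ⟨hq1, hq2⟩, hfirst⟩ := Fin.exists_first hq
    have hqb : b.succ < q := by
      have : q ≠ b.succ := by rintro rfl; exact hlt hq2
      rw [gt_iff_lt, Fin.lt_def, Fin.val_castSucc] at hq1
      rw [Ne, Fin.ext_iff, Fin.val_succ] at this
      rw [Fin.lt_def, Fin.val_succ]
      omega
    obtain ⟨k, hk1, hk2, hk3⟩ := exists_max_between D.ht hbb hqb
    have hkj : D.ht k < j := by
      by_contra h
      exact hfirst k hk2 ⟨hk1, not_lt.1 h⟩
    have hpr := D.le_height q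
    obtain ⟨p, ⟨hp1, ⟨h3, h4, h5⟩ | ⟨h3, h4, h5⟩⟩, hp2⟩ := hD k (by omega)
    · have := h5 q
      have := hk3 p
      have : p = q → D.ht p = D.ht q := by rintro rfl; rfl
      omega
    · have := h5 b.castSucc
      have := hk3 p
      have : p = b.castSucc → D.ht p = D.ht b.castSucc := by rintro rfl; rfl
      omega

/-- By induction on the level: the entries of a column at all odd (even) levels agree, so that the
block of the `i`-th column (counted from `1`) has the entry `i` at odd and `i - 1` at even levels. -/
theorem entry_eq_and_step {D : Diagram t} {j : ℕ} (hD : ∀ l < j, D.AdjacentAt l) :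
    (∀ i b, D.Entry j i b → (j % 2 = 0 → i = b.succ) ∧ (j % 2 = 1 → i = b.castSucc)) ∧
    ∀ i b, D.Entry (j + 1) i b → (j % 2 = 0 → D.Neighbours j i b.succ) ∧
      (j % 2 = 1 → D.Neighbours j b.castSucc i) := by
  induction j with
  | zero =>
    refine ⟨fun i b h => ?_, fun i b h => ?_⟩
    · cases h
      simp
    · refine ⟨fun _ => ?_, by simp⟩
      cases h with
      | one _ h =>
        refine ⟨Fin.castSucc_lt_succ, Nat.zero_le _, Nat.zero_le _, fun k h1 h2 => ?_⟩
        rw [Fin.lt_def] at h1 h2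
        rw [Fin.val_castSucc] at h1
        rw [Fin.val_succ] at h2
        omega
      | fromLeft h => exact absurd h (by decide)
      | fromRight _ h => exact absurd h (by decide)
  | succ j ih =>
    obtain ⟨ih1, ih2⟩ := ih fun l hl => hD l (by omega)
    have key : ∀ i b, D.Entry (j + 1) i b →
        ((j + 1) % 2 = 0 → i = b.succ) ∧ ((j + 1) % 2 = 1 → i = b.castSucc) := by
      intro i b h
      have h1 := ih2 i b h
      have hht : j + 1 ≤ D.ht i := by
        cases h <;> assumption
      refine ⟨fun h2 => ?_, fun h2 => ?_⟩
      · obtain ⟨h3, h4, h5, h6⟩ := h1.2 (by omega)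
        have hi0 : i ≠ 0 := by rintro rfl; exact absurd h3 (Fin.not_lt_zero _)
        obtain ⟨b', rfl⟩ := Fin.exists_succ_eq.2 hi0
        have h7 := (hD j (by omega) b').1 (by omega) hht ⟨_, h3, h4⟩
        by_contra hne
        refine absurd h7 (not_le.2 (h6 b'.castSucc ?_ Fin.castSucc_lt_succ))
        rw [Fin.ext_iff, Fin.val_succ, Fin.val_succ] at hne
        rw [Fin.lt_def, Fin.val_castSucc, Fin.val_succ] at h3
        rw [Fin.lt_def, Fin.val_castSucc, Fin.val_castSucc]
        omega
      · obtain ⟨h3, h4, h5, h6⟩ := h1.1 (by omega)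
        have hi0 : i ≠ Fin.last t := by
          rintro rfl; exact absurd (Fin.le_last b.succ) (not_le.2 h3)
        obtain ⟨b', rfl⟩ := Fin.exists_castSucc_eq.2 hi0
        have h7 := (hD j (by omega) b').2 (by omega) hht ⟨_, h3, h5⟩
        by_contra hne
        refine absurd h7 (not_le.2 (h6 b'.succ Fin.castSucc_lt_succ ?_))
        rw [Fin.ext_iff, Fin.val_castSucc, Fin.val_castSucc] at hne
        rw [Fin.lt_def, Fin.val_castSucc, Fin.val_succ] at h3
        rw [Fin.lt_def, Fin.val_succ, Fin.val_succ]
        omega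
    refine ⟨key, fun i b h => ⟨fun h2 => ?_, fun h2 => ?_⟩⟩
    · cases h with
      | fromLeft h => rw [Nat.odd_iff] at h; omega
      | fromRight _ _ h3 _ hn he => rwa [(key _ _ he).1 h2] at hn
    · cases h with
      | fromLeft _ h3 _ hn he => rwa [(key _ _ he).2 h2] at hn
      | fromRight h => rw [Nat.even_iff] at h; omega

theorem entry_eq {D : Diagram t} {j : ℕ} (hD : ∀ l < j, D.AdjacentAt l) {i : Fin (t + 1)}
    {b : Fin t} (h : D.Entry j i b) : (j % 2 = 0 → i = b.succ) ∧ (j % 2 = 1 → i = b.castSucc) :=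
  (entry_eq_and_step hD).1 i b h

theorem neighbours_of_entry {D : Diagram t} {j : ℕ} (hD : ∀ l < j, D.AdjacentAt l)
    {i : Fin (t + 1)} {b : Fin t} (h : D.Entry (j + 1) i b) :
    (j % 2 = 0 → D.Neighbours j i b.succ) ∧ (j % 2 = 1 → D.Neighbours j b.castSucc i) :=
  (entry_eq_and_step hD).2 i b h

theorem neighbours_castSucc_succ {D : Diagram t} {j : ℕ} {b : Fin t} (h1 : j ≤ D.ht b.castSucc)
    (h2 : j ≤ D.ht b.succ) : D.Neighbours j b.castSucc b.succ := by
  refine ⟨Fin.castSucc_lt_succ, h1, h2, fun k h3 h4 => ?_⟩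
  rw [Fin.lt_def] at h3 h4
  rw [Fin.val_castSucc] at h3
  rw [Fin.val_succ] at h4
  omega

/-- Every block that is not extremal has an entry. -/
theorem exists_entry {D : Diagram t} {j : ℕ} (hD : ∀ l < j, D.AdjacentAt l) (b : Fin t) :
    (j % 2 = 1 → j ≤ D.ht b.castSucc → (∃ q > b.castSucc, j ≤ D.ht q) → D.Entry j b.castSucc b) ∧
    (j % 2 = 0 → j ≤ D.ht b.succ → (∃ p < b.succ, j ≤ D.ht p) → D.Entry j b.succ b) := by
  induction j with
  | zero => exact ⟨by simp, fun _ _ _ => .zero b⟩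
  | succ j ih =>
    have ih := ih fun l hl => hD l (by omega)
    refine ⟨fun h2 h3 h4 => ?_, fun h2 h3 h4 => ?_⟩
    · rcases Nat.eq_zero_or_pos j with rfl | hj
      · exact .one b h3
      · obtain ⟨q, hq, hq'⟩ := h4
        have h5 := (hD j (by omega) b).2 (by omega) h3 ⟨q, hq, by omega⟩
        exact .fromRight (Nat.even_iff.2 (by omega)) hj h3 ⟨q, hq, hq'⟩
          (neighbours_castSucc_succ (by omega) h5)
          (ih.2 (by omega) h5 ⟨_, Fin.castSucc_lt_succ, by omega⟩)
    · obtain ⟨p, hp, hp'⟩ := h4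
      have h5 := (hD j (by omega) b).1 (by omega) h3 ⟨p, hp, by omega⟩
      exact .fromLeft (Nat.odd_iff.2 (by omega)) h3 ⟨p, hp, hp'⟩
        (neighbours_castSucc_succ h5 (by omega))
        (ih.1 (by omega) h5 ⟨_, Fin.castSucc_lt_succ, by omega⟩)

theorem IsComplete.heightCompat_of_rel {D : Diagram t} (hD : D.IsComplete) {c : Fin t → ℕ}
    (h : ∀ a b, D.Rel a b → c a < c b) : HeightCompat t (extend c) (extend D.ht) := by
  have hadj := fun j => hD.adjacentAt j
  have hodd : ∀ p q l, l % 2 = 1 → p < q → q ≤ t → l ≤ extend D.ht p → l < extend D.ht q →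
      l ≤ extend D.ht (q - 1) := by
    intro p q l hl hpq hq h1 h2
    obtain ⟨b, rfl⟩ : ∃ b, q = b + 1 := ⟨q - 1, by omega⟩
    rw [extend_of_lt _ (by omega)] at h1 h2 ⊢
    exact (hadj l ⟨b, by omega⟩).1 hl h2 ⟨⟨p, by omega⟩, by simpa [Fin.lt_def] using hpq, h1⟩
  have heven : ∀ p q l, l % 2 = 0 → p < q → q ≤ t → l < extend D.ht p → l ≤ extend D.ht q →
      l ≤ extend D.ht (p + 1) := by
    intro p q l hl hpq hq h1 h2
    rw [extend_of_lt _ (by omega)] at h1 h2 ⊢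
    exact (hadj l ⟨p, by omega⟩).2 hl h1 ⟨⟨q, by omega⟩, by simpa [Fin.lt_def] using hpq, h2⟩
  refine heightCompat_of_local hodd heven fun p q l hpq hq h1 h2 hb => ⟨fun hl k hk hk' hlk => ?_,
    fun hl k hk hk' hlk => ?_⟩
  · have h3 := hodd p q l hl hpq hq h1.le h2
    obtain ⟨a, rfl⟩ : ∃ a, q = a + 1 := ⟨q - 1, by omega⟩
    simp only [Nat.add_sub_cancel] at h3 ⊢
    rw [extend_of_lt _ (by omega)] at h1 h2 h3 hlk
    rw [extend_of_lt _ (by omega), extend_of_lt _ (by omega)]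
    refine h _ _ ⟨l, ⟨p, by omega⟩, ⟨a + 1, by omega⟩, ⟨a, by omega⟩, ⟨k, by omega⟩,
      ⟨by simpa [Fin.lt_def] using hpq, h1, h2, fun m h4 h5 => ?_⟩, hlk,
      (exists_entry (fun l _ => hadj l) ⟨k, by omega⟩).1 hl hlk
        ⟨⟨a + 1, by omega⟩, by simp [Fin.lt_def]; omega, h2.le⟩,
      Or.inl ⟨Nat.odd_iff.2 hl, neighbours_castSucc_succ (b := ⟨a, by omega⟩) h3 h2.le,
        by simpa [Fin.le_def] using hk, by simp [Fin.lt_def]; omega,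
        (exists_entry (fun l _ => hadj l) ⟨a, by omega⟩).2 (by omega) h2
          ⟨⟨p, by omega⟩, by simpa [Fin.lt_def] using hpq, h1⟩⟩⟩
    have := hb m h4 h5
    rw [extend_val] at this
    omega
  · have h3 := heven p q l hl hpq hq h1 h2.le
    rw [extend_of_lt _ (by omega)] at h1 h2 h3 hlk
    rw [extend_of_lt _ (by omega), extend_of_lt _ (by omega)]
    refine h _ _ ⟨l, ⟨p, by omega⟩, ⟨q, by omega⟩, ⟨p + 1, by omega⟩, ⟨k + 1, by omega⟩,
      ⟨by simpa [Fin.lt_def] using hpq, h1, h2, fun m h4 h5 => ?_⟩, hlk,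
      (exists_entry (fun l _ => hadj l) ⟨k, by omega⟩).2 hl hlk
        ⟨⟨p, by omega⟩, by simp [Fin.lt_def]; omega, h1.le⟩,
      Or.inr ⟨Nat.even_iff.2 hl, neighbours_castSucc_succ (b := ⟨p, by omega⟩) h1.le h3,
        by simp [Fin.lt_def]; omega, by simp [Fin.le_def]; omega,
        (exists_entry (fun l _ => hadj l) ⟨p, by omega⟩).1 (by omega) h1
          ⟨⟨q, by omega⟩, by simpa [Fin.lt_def] using hpq, h2⟩⟩⟩
    have := hb m h4 h5
    rw [extend_val] at this
    omega

theorem IsComplete.rel_of_heightCompat {D : Diagram t} (hD : D.IsComplete) {c : Fin t → ℕ}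
    (h : HeightCompat t (extend c) (extend D.ht)) {a b : Fin t} (hab : D.Rel a b) : c a < c b := by
  have hadj := fun j => hD.adjacentAt j
  obtain ⟨l, p, q, n, k, ⟨h1, h2, h3, h4⟩, h5, h6, hside⟩ := hab
  have key := h p q l h1 (by omega) (by simpa using h2) (by simpa using h3) fun m h7 h8 => by
    have := h4 ⟨m, by omega⟩ h7 h8
    rw [extend_of_lt _ (by omega)]
    omega
  have e1 := entry_eq (fun l _ => hadj l) h6
  rcases hside with ⟨h7, h8, h9, h10, h11⟩ | ⟨h7, h8, h9, h10, h11⟩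
  · rw [Nat.odd_iff] at h7
    obtain rfl := (entry_eq (fun l _ => hadj l) h11).1 (by omega)
    obtain rfl := e1.2 h7
    have := h8.1
    have := key.1 h7 b h9 (by rw [Fin.val_succ]; rw [Fin.lt_def] at *; simp at *; omega)
    simpa using this
  · rw [Nat.even_iff] at h7
    obtain rfl := (entry_eq (fun l _ => hadj l) h11).2 (by omega)
    obtain rfl := e1.1 h7
    have := h8.1
    have := key.2 h7 b (by rw [Fin.lt_def] at *; simp at *; omega)
      (by rw [Fin.le_def] at *; simp at *; omega)
    simpa using this

end Diagram

/-! ### Classes and tight depth functions -/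

namespace Diagram

variable {t : ℕ}

/-- A tight depth function is the depth of a complete diagram of every sufficiently large odd
height. -/
theorem exists_of_tightDepth {d : ℕ → ℕ} (hd : TightDepth t d) {r : ℕ} (hr : r % 2 = 1)
    (hle : ∀ k ≤ t, d k ≤ r) :
    ∃ D : Diagram t, D.IsComplete ∧ D.height = r ∧ ∀ k : Fin (t + 1), D.ht k = r - d k := by
  have key : ∀ k : Fin (t + 1), r - d k < r → ∃ q : Fin (t + 1),
      IsParent (fun k : Fin (t + 1) => r - d k) k q ∧ r - d q = r - d k + 1 := by
    intro k hk
    have h1 := hle k (by omega)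
    rcases Nat.mod_two_eq_zero_or_one (d k) with h2 | h2
    · obtain ⟨p, hp, hp1, hb⟩ := hd.left k (by omega) (by omega) h2
      refine ⟨⟨p, by omega⟩, ⟨by simp; omega, Or.inr ⟨by simp; omega, by simpa [Fin.lt_def],
        fun m h3 h4 => ?_⟩⟩, by simp; omega⟩
      have := hb m h3 h4
      simp; omega
    · obtain ⟨q, hqt, hq, hq1, hb⟩ := hd.right k (by omega) h2
      refine ⟨⟨q, by omega⟩, ⟨by simp; omega, Or.inl ⟨by simp; omega, by simpa [Fin.lt_def],
        fun m h3 h4 => ?_⟩⟩, by simp; omega⟩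
      have := hb m h3 h4
      simp; omega
  obtain ⟨e, he, he0⟩ := hd.exists_zero
  obtain ⟨D, hD, hH⟩ := exists_diagram (h := fun k : Fin (t + 1) => r - d k) (r := r)
    (fun k => Nat.sub_le _ _) ⟨⟨e, by omega⟩, by simp [he0]⟩ fun k hk => by
      obtain ⟨q, ⟨h1, h2⟩, -⟩ := key k hk
      exact ⟨q, h1, h2.imp (fun h => ⟨h.1, h.2.1⟩) fun h => ⟨h.1, h.2.1⟩⟩
  refine ⟨D, ?_, hH, fun k => by rw [hD]⟩
  rw [isComplete_iff, hH, hD]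
  exact key

theorem IsComplete.tightDepth {D : Diagram t} (hD : D.IsComplete) (h2 : D.height % 2 = 1)
    {d : ℕ → ℕ} (hd : ∀ k : Fin (t + 1), D.ht k + d k = D.height) : TightDepth t d := by
  rw [isComplete_iff] at hD
  refine ⟨?_, fun k hk h0 h3 => ?_, fun k hk h3 => ?_⟩
  · obtain ⟨e, he⟩ := D.exists_ht_eq
    have := hd e
    exact ⟨e, by omega, by omega⟩
  · have h4 := hd ⟨k, by omega⟩
    simp only at h4
    obtain ⟨q, ⟨h5, h6⟩, h7⟩ := hD ⟨k, by omega⟩ (by omega)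
    have h8 := hd q
    rcases h6 with h6 | ⟨-, h6, hb⟩
    · omega
    · refine ⟨q, h6, by omega, fun m h9 h10 => ?_⟩
      have := hb ⟨m, by omega⟩ h9 h10
      have := hd ⟨m, by omega⟩
      simp only at this
      omega
  · have h4 := hd ⟨k, by omega⟩
    simp only at h4
    obtain ⟨q, ⟨h5, h6⟩, h7⟩ := hD ⟨k, by omega⟩ (by omega)
    have h8 := hd q
    rcases h6 with ⟨-, h6, hb⟩ | h6
    · refine ⟨q, by omega, h6, by omega, fun m h9 h10 => ?_⟩
      have := hb ⟨m, by omega⟩ h9 h10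
      have := hd ⟨m, by omega⟩
      simp only at this
      omega
    · omega

theorem ht_add_depth {D : Diagram t} (h2 : D.height % 2 = 1) (k : Fin (t + 1)) :
    D.ht k + D.depth k = D.height := by
  have := D.le_height k
  rw [depth, if_pos h2]
  omega

theorem depth_eq_of_odd {D : Diagram t} (h2 : D.height % 2 = 1) {d : ℕ → ℕ}
    (hd : ∀ k : Fin (t + 1), D.ht k + d k = D.height) (k : Fin (t + 1)) : D.depth k = d k := by
  have := ht_add_depth h2 k
  have := hd k
  omega

theorem depth_of_even {D : Diagram t} (h2 : D.height % 2 = 0) (k : Fin (t + 1)) :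
    (k < D.strongCol → D.ht k + D.depth k = D.height + 1 ∧ D.depth k ≠ 0) ∧
      (k = D.strongCol → D.ht k = D.height ∧ D.depth k = 0) ∧
      (D.strongCol < k → D.ht k + D.depth k + 1 = D.height) := by
  have h1 := D.le_height k
  have h3 := D.ht_lt_of_strongCol_lt (k := k) h2
  rw [depth, if_neg (by omega)]
  refine ⟨fun h => ?_, fun h => ?_, fun h => ?_⟩
  · rw [if_pos h]; omega
  · rw [if_neg (by omega), if_pos h]
    exact ⟨h ▸ D.ht_strongCol, rfl⟩
  · rw [if_neg (by omega), if_neg (by omega)]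
    have := h3 h
    omega

/-- Level `l + 1` corresponds to depth `δ - 1` for `δ = r - l`, and the parities of `l` and `δ` are
opposite. -/
theorem heightCompat_iff_of_odd {D : Diagram t} (h2 : D.height % 2 = 1) {c d : ℕ → ℕ}
    (hd : ∀ k : Fin (t + 1), D.ht k + d k = D.height) :
    HeightCompat t c (extend D.ht) ↔ CompatDepth t c d := by
  have hd' : ∀ k ≤ t, extend D.ht k + d k = D.height := fun k hk => by
    rw [extend_of_lt _ (by omega)]; exact hd ⟨k, by omega⟩
  constructor
  · intro h p q δ hpq hq hp hq' hb
    by_cases hpq' : q = p + 1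
    · exact ⟨fun _ x _ _ => by omega, fun _ x _ _ => by omega⟩
    have h3 := hd' p (by omega)
    have h4 := hd' q (by omega)
    have h5 := hd' (p + 1) (by omega)
    have h6 := hb (p + 1) (by omega) (by omega)
    have := h p q (D.height - δ) hpq hq (by omega) (by omega) fun m h7 h8 => by
      have := hd' m (by omega)
      have := hb m h7 h8
      omega
    exact ⟨fun h7 => this.1 (by omega), fun h7 => this.2 (by omega)⟩
  · intro h p q l hpq hq hp hq' hb
    have h3 := hd' p (by omega)
    have h4 := hd' q (by omega)
    have := h p q (D.height - l) hpq hq (by omega) (by omega) fun m h7 h8 => by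
      have := hd' m (by omega)
      have := hb m h7 h8
      omega
    exact ⟨fun h7 => this.1 (by omega), fun h7 => this.2 (by omega)⟩

/-- At even height `r` the level `l` that corresponds to `δ` is `r + 1 - δ` on the left and
`r - 1 - δ` on the right of the strongly extremal column, which does not lie strictly between two
neighbours at depth `δ - 1`. -/
theorem compatDepth_of_even {D : Diagram t} (h2 : D.height % 2 = 0) {c : ℕ → ℕ}
    (h : HeightCompat t c (extend D.ht)) : CompatDepth t c (extend D.depth) := by
  have hd : ∀ k ≤ t, (k < D.strongCol.val →
        extend D.ht k + extend D.depth k = D.height + 1 ∧ extend D.depth k ≠ 0) ∧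
      (k = D.strongCol.val → extend D.ht k = D.height ∧ extend D.depth k = 0) ∧
      (D.strongCol.val < k → extend D.ht k + extend D.depth k + 1 = D.height) := by
    intro k hk
    rw [extend_of_lt _ (by omega), extend_of_lt _ (by omega)]
    have := depth_of_even h2 ⟨k, by omega⟩
    rwa [Fin.lt_def, Fin.lt_def, Fin.ext_iff] at this
  intro p q δ hpq hq hp hq' hb
  by_cases hpq' : q = p + 1
  · exact ⟨fun _ x _ _ => by omega, fun _ x _ _ => by omega⟩
  have h3 := hd p (by omega)
  have h4 := hd q (by omega)
  have h5 := hd (p + 1) (by omega)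
  have h6 := hb (p + 1) (by omega) (by omega)
  have h7 := hb D.strongCol.val
  have h8 := hd D.strongCol.val (by omega)
  have := h p q (if q ≤ D.strongCol.val then D.height + 1 - δ else D.height - 1 - δ) hpq hq
    (by split_ifs <;> omega) (by split_ifs <;> omega) fun m h9 h10 => by
      have := hd m (by omega)
      have := hb m h9 h10
      split_ifs <;> omega
  refine ⟨fun h9 => this.1 (by split_ifs <;> omega), fun h9 => this.2 (by split_ifs <;> omega)⟩

end Diagram

namespace DiagramClass

variable {t : ℕ}

open Diagram

theorem tightDepth (x : DiagramClass t) : TightDepth t (extend x.depth) := by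
  obtain ⟨D, hD, h2, rfl⟩ := exists_odd_rep x
  rw [depth_mk hD]
  exact hD.tightDepth h2 fun k => by rw [extend_val, ht_add_depth h2]

/-- The strongly extremal column is the leftmost one of maximal height in a representative of odd
height. -/
theorem isFirstZero_index (x : DiagramClass t) : IsFirstZero (extend x.depth) x.index := by
  obtain ⟨D, hD, h2, rfl⟩ := exists_odd_rep x
  rw [depth_mk hD, index_mk]
  refine ⟨?_, fun m hm => ?_⟩
  · have := ht_add_depth h2 D.strongCol
    have := D.ht_strongCol
    rw [extend_val]; omega
  · have hm' : m < t + 1 := by omega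
    rw [extend_of_lt _ hm']
    have := ht_add_depth h2 ⟨m, hm'⟩
    have := D.ht_lt_of_lt_strongCol (k := ⟨m, hm'⟩) h2 hm
    omega

theorem exists_odd_bound (d : ℕ → ℕ) (n : ℕ) : ∃ r, r % 2 = 1 ∧ ∀ k ≤ n, d k ≤ r := by
  refine ⟨2 * (Finset.range (n + 1)).sup d + 1, by omega, fun k hk => ?_⟩
  have := Finset.le_sup (f := d) (Finset.mem_range.2 (show k < n + 1 by omega))
  omega

theorem exists_depth_eq {d : ℕ → ℕ} (hd : TightDepth t d) :
    ∃ x : DiagramClass t, ∀ k ≤ t, extend x.depth k = d k := by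
  obtain ⟨r, hr, hle⟩ := exists_odd_bound d t
  obtain ⟨D, hD, hH, hD'⟩ := exists_of_tightDepth hd hr hle
  refine ⟨mk D, fun k hk => ?_⟩
  rw [depth_mk hD, extend_of_lt _ (by omega)]
  refine depth_eq_of_odd (d := d) (by omega) (fun k => ?_) _
  have := hle k (by omega)
  rw [hD', hH]; omega

theorem eq_of_depth {x y : DiagramClass t} (h : ∀ k ≤ t, extend x.depth k = extend y.depth k) :
    x = y := by
  refine depth_injective ?_
  funext k
  simpa using h k (by omega)

/-- Every complete representative, of odd or even height, gives the condition on the depth function;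
conversely it suffices to have one representative, which may be taken of odd height. -/
theorem mem_orderClasses_iff {c : Fin t → ℕ} {x : DiagramClass t} :
    x ∈ orderClasses c ↔ CompatDepth t (extend c) (extend x.depth) := by
  constructor
  · rintro ⟨D, rfl, hD, hrel⟩
    have h := hD.heightCompat_of_rel hrel
    rw [depth_mk hD]
    rcases Nat.mod_two_eq_zero_or_one D.height with h2 | h2
    · exact compatDepth_of_even h2 h
    · exact (heightCompat_iff_of_odd h2 fun k => by rw [extend_val, ht_add_depth h2]).1 h
  · intro h
    obtain ⟨D, hD, h2, rfl⟩ := exists_odd_rep x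
    rw [depth_mk hD] at h
    refine ⟨D, rfl, hD, fun a b hab => hD.rel_of_heightCompat ?_ hab⟩
    exact (heightCompat_iff_of_odd h2 fun k => by rw [extend_val, ht_add_depth h2]).2 h

end DiagramClass

/-! ### Links between classes -/

namespace Diagram

variable {t : ℕ}

theorem AdjacentAt.congr {D D' : Diagram t} {l : ℕ} (h : D.AdjacentAt l)
    (hk : ∀ m, (l ≤ D.ht m ↔ l ≤ D'.ht m) ∧ (l + 1 ≤ D.ht m ↔ l + 1 ≤ D'.ht m)) :
    D'.AdjacentAt l := by
  intro b
  simp only [← (hk _).1, ← (hk _).2]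
  exact h b

/-- In a complete diagram equal rows are full: the highest column below them would have to be one
block lower than its parent. -/
theorem IsComplete.le_ht_of_equalRows {D : Diagram t} (hD : D.IsComplete) {j : ℕ}
    (hj : j + 2 ≤ D.height) (h : D.EqualRows j) (k : Fin (t + 1)) : j + 2 ≤ D.ht k := by
  by_contra hlt
  rw [isComplete_iff] at hD
  have hne : (Finset.univ.filter fun k => D.ht k ≤ j).Nonempty :=
    ⟨k, by have := h k; simp; omega⟩
  obtain ⟨m, hm, hmax⟩ := Finset.exists_max_image _ D.ht hne
  simp only [Finset.mem_filter, Finset.mem_univ, true_and] at hm hmax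
  obtain ⟨q, hq, hq2⟩ := hD m (by omega)
  have := h q
  have := hmax q
  omega

theorem IsComplete.isReduced {D : Diagram t} (hD : D.IsComplete) {k : Fin (t + 1)}
    (hk : D.ht k ≤ 1) : D.IsReduced := fun j hj h => by
  have := hD.le_ht_of_equalRows hj h k
  omega

end Diagram

namespace DiagramClass

variable {t : ℕ}

open Diagram

/-- The class of `D` has the depth function `d'`, if the diagram of odd height `r` with the depth
function `d'` arises from `D` by adjoining a domino to every column in `S`. -/
theorem depth_mk_of_cascade {D : Diagram t} {r : ℕ} (hr : r % 2 = 1) {d' : ℕ → ℕ}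
    (hd' : TightDepth t d') (hle : ∀ k ≤ t, d' k ≤ r) (S : Finset (Fin (t + 1)))
    (hS : ∀ k ∈ S, ∃ q, IsParent D.ht k q ∧ (D.ht k + 2 ≤ D.ht q ∨ q ∈ S))
    (h1 : ∀ k ∈ S, D.ht k + 2 + d' k = r) (h2 : ∀ k ∉ S, D.ht k + d' k = r) :
    ∀ k ≤ t, extend (mk D).depth k = d' k := by
  obtain ⟨E, hE, hH, hE'⟩ := exists_of_tightDepth hd' hr hle
  obtain ⟨D', hD', hgen⟩ := D.exists_cascade S hS
  have : D' = E := by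
    refine Diagram.ext ?_
    funext k
    rw [hD', hE']
    have := h1 k
    have := h2 k
    simp only
    split_ifs with hk
    · have := h1 k hk; omega
    · have := h2 k hk; omega
  subst this
  intro k hk
  rw [mk_eq_of_reflTransGen hgen, depth_mk hE, extend_of_lt _ (by omega)]
  refine depth_eq_of_odd (d := d') (by omega) (fun k => ?_) _
  have := hle k (by omega)
  rw [hE', hH]; omega

/-- Adding a block to the column `k` in a representative of odd height: the completion raises the
columns between `k` and `i + 1` by one domino each. -/
theorem depth_addBlock_of_odd {D D' : Diagram t} {d d' : ℕ → ℕ} (hd : TightDepth t d)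
    (h2 : D.height % 2 = 1) (hD : ∀ k : Fin (t + 1), D.ht k + d k = D.height)
    {k : Fin (t + 1)} {i : ℕ} (h : DepthLinkAt t d k i d') (hD' : D.AddBlock k D') :
    ∀ m ≤ t, extend (mk D').depth m = d' m := by
  have e1 := h.eq_one
  have hk := hD k
  have f1 : D'.ht k = D.height := by rw [hD']; simp; omega
  have f2 : ∀ m, m ≠ k → D'.ht m = D.ht m := fun m hm => by rw [hD']; simp [hm]
  have f3 : ∀ (m : ℕ) (hm : m ≤ t), D.ht ⟨m, by omega⟩ + d m = D.height :=
    fun m hm => hD ⟨m, by omega⟩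
  have b1 := h.le
  have b2 := h.lt
  have b3 := h.succ_le
  refine depth_mk_of_cascade h2 (h.tightDepth hd) (fun m hm => ?_)
    (Finset.univ.filter fun m : Fin (t + 1) => k < m ∧ m.val ≤ i) (fun m hm => ?_) (fun m hm => ?_)
    fun m hm => ?_
  · have := f3 m hm
    by_cases hmk : m = k
    · rw [hmk, h.eq_zero]; omega
    by_cases hmi : k < m ∧ m ≤ i
    · have := h.lower m hmi.1 hmi.2; omega
    · have := h.eq m hm (by omega); omega
  · simp only [Finset.mem_filter, Finset.mem_univ, true_and] at hm ⊢
    have g1 := h.lower m (Fin.lt_def.1 hm.1) hm.2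
    have g2 := hD m
    have g3 := f2 m hm.1.ne'
    rcases Nat.mod_two_eq_zero_or_one (d m) with hp | hp
    · obtain ⟨p, hp1, hp2, hb⟩ := hd.left m (by omega) (by omega) hp
      have hkp : k.val ≤ p := by
        by_contra hlt
        have := hb k (by omega) (Fin.lt_def.1 hm.1)
        omega
      have g4 := f3 p (by omega)
      have hle : D.ht ⟨p, by omega⟩ ≤ D'.ht ⟨p, by omega⟩ := by
        by_cases hpk : (⟨p, by omega⟩ : Fin (t + 1)) = k
        · rw [hpk]; omega
        · rw [f2 _ hpk]
      refine ⟨⟨p, by omega⟩,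
        ⟨by omega, Or.inr ⟨by omega, by simpa [Fin.lt_def], fun u hu hu' => ?_⟩⟩, ?_⟩
      · rw [Fin.lt_def] at hu hu'
        have := hb u hu hu'
        have := hD u
        rw [f2 u (by rintro rfl; simp only at hu; omega)]
        omega
      · by_cases hpk : (⟨p, by omega⟩ : Fin (t + 1)) = k
        · left; rw [hpk] at g4 ⊢; rw [← hpk] at e1; simp only at e1; omega
        · right
          rw [Fin.ext_iff] at hpk
          simp only at hpk
          exact ⟨by rw [Fin.lt_def]; simp only; omega, by simp only; omega⟩
    · obtain ⟨q, hqN, hq1, hq2, hb⟩ := hd.right m (by omega) hp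
      have hqi : q ≤ i := by
        have := hb (i + 1)
        have : q = i + 1 → d q = d (i + 1) := by rintro rfl; rfl
        omega
      have g4 := f3 q hqN
      have hkm := Fin.lt_def.1 hm.1
      have hqk : (⟨q, by omega⟩ : Fin (t + 1)) ≠ k := by rw [Ne, Fin.ext_iff]; simp only; omega
      have g5 := f2 _ hqk
      refine ⟨⟨q, by omega⟩, ⟨by omega, Or.inl ⟨by omega, by simpa [Fin.lt_def],
        fun u hu hu' => ?_⟩⟩, Or.inr ⟨by rw [Fin.lt_def]; simp only; omega, hqi⟩⟩
      rw [Fin.lt_def] at hu hu'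
      have := hb u hu hu'
      have := hD u
      rw [f2 u (by rintro rfl; omega)]
      omega
  · simp only [Finset.mem_filter, Finset.mem_univ, true_and] at hm
    have g1 := h.lower m (Fin.lt_def.1 hm.1) hm.2
    have g2 := hD m
    rw [f2 m hm.1.ne']
    omega
  · simp only [Finset.mem_filter, Finset.mem_univ, true_and] at hm
    by_cases hmk : m = k
    · subst hmk; rw [f1, h.eq_zero]; rfl
    · have g2 := hD m
      rw [f2 m hmk, h.eq m (by omega) (by rw [Fin.lt_def] at hm; rw [Fin.ext_iff] at hmk; omega)]
      exact g2

/-- The linkage is realized in the representative of least odd height `r` that is at least the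
maximal depth; it is reduced since it has a column of height at most `1`. -/
theorem linkage_of_depthLink {x y : DiagramClass t} {i : Fin t}
    (h : DepthLink t (extend x.depth) i (extend y.depth)) : x.Linkage i y := by
  obtain ⟨k, h⟩ := h
  have hx := x.tightDepth
  have hx0 := x.isFirstZero_index
  have hi := h.le
  have hiN := h.lt
  set d := extend x.depth with hd
  obtain ⟨r, hr, hle, k₀, hk₀, hrk⟩ :
      ∃ r, r % 2 = 1 ∧ (∀ k ≤ t, d k ≤ r) ∧ ∃ k ≤ t, r ≤ d k + 1 := by
    obtain ⟨k₀, hk₀, hmax⟩ := (Finset.range (t + 1)).exists_max_image d ⟨0, by simp⟩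
    rw [Finset.mem_range] at hk₀
    have hmax : ∀ k ≤ t, d k ≤ d k₀ := fun k hk => hmax k (by rw [Finset.mem_range]; omega)
    refine ⟨if d k₀ % 2 = 1 then d k₀ else d k₀ + 1, by split_ifs <;> omega, fun k hk => ?_,
      k₀, by omega, by split_ifs <;> omega⟩
    have := hmax k hk
    split_ifs <;> omega
  obtain ⟨D, hD, hH, hDd⟩ := exists_of_tightDepth hx hr hle
  have hDd' : ∀ m : Fin (t + 1), D.ht m + d m = D.height := fun m => by
    have := hle m (by omega)
    rw [hDd, hH]; omega
  have hmk : mk D = x := by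
    refine eq_of_depth fun m hm => ?_
    rw [depth_mk hD, extend_of_lt _ (by omega), depth_eq_of_odd (by omega) hDd']
  have e1 := h.eq_one
  have hk := hDd' ⟨k, by omega⟩
  simp only at hk
  obtain ⟨D', hD', hH'⟩ : ∃ D' : Diagram t, D.AddBlock ⟨k, by omega⟩ D' ∧ D'.height = r := by
    refine exists_diagram (fun m => ?_) ?_ fun m hm => ?_
    · by_cases hmk : m = ⟨k, by omega⟩
      · subst hmk; simp; omega
      · have := D.le_height m
        simp [hmk]; omega
    · exact ⟨⟨k, by omega⟩, by simp; omega⟩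
    · by_cases hmk : m = ⟨k, by omega⟩
      · rw [hmk] at hm; simp at hm; omega
      · simp only [Function.update_of_ne hmk] at hm ⊢
        obtain ⟨q, hq1, hq2⟩ := D.exists_isParent (k := m) (by omega)
        refine ⟨q, ?_, by omega⟩
        by_cases hqk : q = ⟨k, by omega⟩
        · rw [hqk] at hq1 ⊢; simp; omega
        · simpa [hqk] using hq1
  have f1 : D'.ht ⟨k, by omega⟩ = r := by rw [hD']; simp; omega
  have f2 : ∀ m, m ≠ ⟨k, by omega⟩ → D'.ht m = D.ht m := fun m hm => by rw [hD']; simp [hm]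
  have hy : mk D' = y :=
    eq_of_depth (depth_addBlock_of_odd (k := ⟨k, by omega⟩) hx (by omega) hDd' h hD')
  have hyk : y.index = ⟨k, by omega⟩ :=
    Fin.ext (y.isFirstZero_index.unique h.isFirstZero)
  refine ⟨D, D', ⟨k, by omega⟩, hD, hD.isReduced (k := ⟨k₀, by omega⟩) ?_, hmk, hD', hy, hyk,
    ?_, ?_⟩
  · rw [hDd]; simp only; omega
  · intro hxk
    have := hx0.1
    rw [hxk] at this
    simp only at this
    omega
  -- the entry of the new block is that of the column `i + 1` at the level below
  · rw [f1]
    have hnz := h.ne_zero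
    have hie : i.val < x.index.val := by
      by_contra hlt
      exact hnz x.index.val (by omega) hx0.1
    have hsucc := h.succ_le
    have g1 := hDd' i.succ
    rw [Fin.val_succ] at g1
    have hik : i.succ ≠ ⟨k, by omega⟩ := by rw [Ne, Fin.ext_iff, Fin.val_succ]; simp only; omega
    obtain ⟨j, rfl⟩ : ∃ j, r = j + 1 := ⟨r - 1, by omega⟩
    -- `D'` need not be complete, but agrees with the complete diagram `D` below its top row
    have hadj : ∀ l < j, D'.AdjacentAt l := fun l hl => by
      refine (hD.adjacentAt l).congr fun m => ?_
      by_cases hm : m = ⟨k, by omega⟩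
      · subst hm; omega
      · rw [f2 m hm]; simp
    have hbetween : ∀ m : Fin (t + 1), k < m.val → m.val ≤ i → D'.ht m < j := fun m hm hm' => by
      have := h.lower m hm hm'
      have := hDd' m
      rw [f2 m (by rw [Ne, Fin.ext_iff]; simp only; omega)]
      omega
    rcases Nat.eq_zero_or_pos j with rfl | hj
    · have : (⟨k, by omega⟩ : Fin (t + 1)) = i.castSucc := by
        rw [Fin.ext_iff, Fin.val_castSucc]
        by_contra hne
        simp only at hne
        have := hbetween i.castSucc (by rw [Fin.val_castSucc]; omega) (by rw [Fin.val_castSucc])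
        omega
      rw [this] at f1 ⊢
      exact .one i (by omega)
    · have hlt : (⟨k, by omega⟩ : Fin (t + 1)) < i.succ := by
        rw [Fin.lt_def, Fin.val_succ]; simp only; omega
      refine .fromRight (k := i.succ) (Nat.even_iff.2 (by omega)) hj (by omega) ⟨x.index, ?_, ?_⟩
        ⟨hlt, by omega, by rw [f2 _ hik]; omega, fun m hm hm' => ?_⟩
        ((exists_entry hadj i).2 (by omega) (by rw [f2 _ hik]; omega)
          ⟨⟨k, by omega⟩, hlt, by omega⟩)
      · rw [gt_iff_lt, Fin.lt_def]; simp only; omega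
      · have := hDd' x.index
        rw [hx0.1] at this
        rw [f2 _ (by rw [Ne, Fin.ext_iff]; simp only; omega)]
        omega
      · rw [Fin.lt_def] at hm hm'
        rw [Fin.val_succ] at hm'
        exact hbetween m hm (by omega)

end DiagramClass

namespace DiagramClass

variable {t : ℕ}

open Diagram

/-- Adding a block to the column `k` in a representative of even height, where the column `i` is
the left neighbour of `k` at the level below.  The link goes in the opposite direction, from the
new class to the old one.  To see this, adjoin a half-domino to the new strongly extremal column
`k`; the completion then raises all the columns to the right of `i` except `k`. -/
theorem depth_addBlock_of_even {D D' : Diagram t} (hD : D.IsComplete)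
    (h2 : D.height % 2 = 0) {k : Fin (t + 1)} {i : ℕ} (hk : D.ht k + 1 = D.height)
    (hek : D.strongCol < k) (hD' : D.AddBlock k D') (hH' : D'.height = D.height)
    (hs' : D'.strongCol = k) (hei : D.strongCol.val ≤ i) (hik : i < k)
    (hi0 : extend D.depth i = 0) (hb : ∀ m, i < m → m < k → extend D.depth m ≠ 0) :
    ∀ m ≤ t, extend (mk D').depth m = linkSource (extend D.depth) D.strongCol i m := by
  have hd : TightDepth t (extend D.depth) := by
    rw [← depth_mk hD]; exact (mk D).tightDepth
  have he : IsFirstZero (extend D.depth) D.strongCol := by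
    rw [← depth_mk hD]; exact (mk D).isFirstZero_index
  have hDd := depth_of_even h2
  have hk0 : extend D.depth k = 0 := by
    have := (hDd k).2.2 hek
    rw [extend_val]; omega
  have hz := hd.linkSource he hei hi0 hik (by omega) hk0 hb
  have hze := hDd D.strongCol
  have hgt : ∀ m : Fin (t + 1), D.strongCol < m → D.ht m + extend D.depth m + 1 = D.height :=
    fun m hm => by rw [extend_val]; exact (hDd m).2.2 hm
  have hlt : ∀ m : Fin (t + 1), m < D.strongCol → D.ht m + extend D.depth m = D.height + 1 :=
    fun m hm => by rw [extend_val]; exact ((hDd m).1 hm).1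
  have heq := D.ht_strongCol
  clear hDd hze
  generalize extend D.depth = d at *
  generalize D.strongCol = e at *
  obtain ⟨D₁, hD₁, hH₁⟩ := D'.exists_halfDomino
  rw [hH'] at hH₁
  have f1 : D₁.ht k = D.height + 1 := by rw [hD₁, hs', hH']; simp
  have f2 : ∀ m, m ≠ k → D₁.ht m = D.ht m := fun m hm => by
    rw [hD₁, hs', Function.update_of_ne hm, hD', Function.update_of_ne hm]
  rw [← mk_halfDomino (halfDominoAdj_of_ht_eq hD₁)]
  have z1 : ∀ m, m < e.val ∨ i < m → linkSource d e i m = d m := fun m hm => by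
    rw [linkSource, if_neg (by omega), if_neg (by omega)]
  have z2 : linkSource d e i e = 1 := by simp [linkSource]
  have z3 : ∀ m, e.val < m → m ≤ i → linkSource d e i m = d m + 2 := fun m hm hm' => by
    rw [linkSource, if_neg (by omega), if_pos ⟨hm, hm'⟩]
  generalize linkSource d e i = z at *
  have zS : ∀ m : Fin (t + 1), i < m.val → m ≠ k → D₁.ht m + 2 + z m = D.height + 1 :=
    fun m h h' => by
      have := hgt m (by rw [Fin.lt_def]; omega)
      rw [f2 m h', z1 m (Or.inr h)]; omega
  have zS' : ∀ m : Fin (t + 1), ¬ (i < m.val ∧ m ≠ k) → D₁.ht m + z m = D.height + 1 :=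
    fun m hm => by
      by_cases hmk : m = k
      · subst hmk; rw [f1, z1 m (Or.inr hik), hk0]
      rw [f2 m hmk]
      have hmi : m.val ≤ i := by
        by_contra h
        exact hm ⟨by omega, hmk⟩
      rcases lt_trichotomy m e with h | h | h
      · rw [z1 m (Or.inl h)]; exact hlt m h
      · rw [h, z2]; omega
      · have := hgt m h
        rw [z3 m h hmi]; omega
  refine depth_mk_of_cascade (r := D.height + 1) (by omega) hz (fun m hm => ?_)
    (Finset.univ.filter fun m : Fin (t + 1) => i < m.val ∧ m ≠ k) (fun m hm => ?_) (fun m hm => ?_)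
    fun m hm => ?_
  · have h3 := zS ⟨m, by omega⟩
    have h4 := zS' ⟨m, by omega⟩
    by_cases h : i < (⟨m, by omega⟩ : Fin (t + 1)).val ∧ (⟨m, by omega⟩ : Fin (t + 1)) ≠ k
    · have := h3 h.1 h.2; simp only at this; omega
    · have := h4 h; simp only at this; omega
  · simp only [Finset.mem_filter, Finset.mem_univ, true_and] at hm ⊢
    obtain ⟨hmi, hmk⟩ := hm
    have g1 := hgt m (by rw [Fin.lt_def]; omega)
    have g2 := f2 m hmk
    have g3 : ∀ u : Fin (t + 1), i < u.val → u ≠ k → D₁.ht u + d u + 1 = D.height :=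
      fun u h h' => by
      rw [f2 u h']; exact hgt u (by rw [Fin.lt_def]; omega)
    rcases Nat.mod_two_eq_zero_or_one (d m) with hp | hp
    · by_cases hm0 : d m = 0
      · have hkm : k < m := by
          by_contra h
          exact hb m hmi (by rw [Ne, Fin.ext_iff] at hmk; rw [Fin.lt_def] at h; omega) hm0
        refine ⟨k, ⟨by omega, Or.inr ⟨by omega, hkm, fun u hu hu' => ?_⟩⟩, Or.inl (by omega)⟩
        have := g3 u (by rw [Fin.lt_def] at hu; omega) hu.ne'
        omega
      obtain ⟨p, hp1, hp2, hb'⟩ := hd.left m (by omega) hm0 hp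
      have hip : i < p := by
        have := hb' i
        have : p = i → d p = d i := by rintro rfl; rfl
        omega
      have hpk : (⟨p, by omega⟩ : Fin (t + 1)) ≠ k := by
        intro h
        rw [← h] at hk0
        exact absurd hk0 (by dsimp only; omega)
      have g4 := g3 ⟨p, by omega⟩ hip hpk
      simp only at g4
      refine ⟨⟨p, by omega⟩,
        ⟨by omega, Or.inr ⟨by omega, by simpa [Fin.lt_def], fun u hu hu' => ?_⟩⟩,
        Or.inr ⟨hip, hpk⟩⟩
      rw [Fin.lt_def] at hu hu'
      have h5 := hb' u hu hu'
      have := g3 u (by simp only at hu; omega) (by rintro rfl; omega)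
      omega
    · obtain ⟨q, hqN, hq1, hq2, hb'⟩ := hd.right m (by omega) hp
      have hbu : ∀ u : Fin (t + 1), m < u → u.val < q → D₁.ht u ≤ D₁.ht m := fun u hu hu' => by
        rw [Fin.lt_def] at hu
        have h5 := hb' u hu hu'
        have := g3 u (by omega) (by rintro rfl; omega)
        omega
      by_cases hqk : (⟨q, by omega⟩ : Fin (t + 1)) = k
      · refine ⟨k, ⟨by omega, Or.inl ⟨by omega, ?_, fun u hu hu' => hbu u hu ?_⟩⟩, Or.inl ?_⟩
        · rw [← hqk, Fin.lt_def]; exact hq1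
        · rw [← hqk] at hu'; exact hu'
        · rw [f1]; omega
      · have g4 := g3 ⟨q, by omega⟩ (by simp only; omega) hqk
        simp only at g4
        exact ⟨⟨q, by omega⟩, ⟨by omega, Or.inl ⟨by omega, by simpa [Fin.lt_def],
          fun u hu hu' => hbu u hu hu'⟩⟩, Or.inr ⟨by simp only; omega, hqk⟩⟩
  · simp only [Finset.mem_filter, Finset.mem_univ, true_and] at hm
    exact zS m hm.1 hm.2
  · simp only [Finset.mem_filter, Finset.mem_univ, true_and] at hm
    exact zS' m hm

/-- A linkage in a representative of odd (even) height gives a link in the same (opposite)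
direction. -/
theorem depthLink_of_linkage {x y : DiagramClass t} {i : Fin t} (h : x.Linkage i y) :
    DepthLink t (extend x.depth) i (extend y.depth) ∨
      DepthLink t (extend y.depth) i (extend x.depth) := by
  obtain ⟨D, D', k, hD, -, rfl, hD', rfl, hyk, hxk, hent⟩ := h
  rw [index_mk] at hyk hxk
  have hx := (mk D).tightDepth
  have hx0 := (mk D).isFirstZero_index
  rw [depth_mk hD] at hx hx0 ⊢
  rw [index_mk] at hx0
  have f1 : D'.ht k = D.ht k + 1 := by rw [hD']; simp
  have f2 : ∀ m, m ≠ k → D'.ht m = D.ht m := fun m hm => by rw [hD']; simp [hm]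
  have f3 := D'.ht_strongCol
  rw [hyk, f1] at f3
  have f4 := f2 _ hxk
  have f5 := D'.le_height D.strongCol
  have f6 := D.ht_strongCol
  have f7 := D.le_height k
  have f8 := D.ht_lt_of_lt_strongCol (k := k)
  have f9 := D.ht_lt_of_strongCol_lt (k := k)
  -- The block raises the column `k` to the maximal height of `D`: otherwise `k` would have this
  -- height before, and would be the parent in `D'` of the strongly extremal column of `D`, in spite
  -- of being on the side where all columns of `D` are lower than that one.
  have hkr : D.ht k + 1 = D.height := by
    by_contra hne
    obtain ⟨q, hq1, hq2⟩ := D'.exists_isParent (k := D.strongCol) (by omega)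
    have hqk : q = k := by
      by_contra hqk
      have := f2 q hqk
      have := D.le_height q
      omega
    subst hqk
    omega
  have hH' : D'.height = D.height := by omega
  rw [f1, hkr] at hent
  obtain ⟨j, hj⟩ : ∃ j, D.height = j + 1 := ⟨D.ht k, hkr.symm⟩
  have hadj : ∀ l < j, D'.AdjacentAt l := fun l hl => by
    refine (hD.adjacentAt l).congr fun m => ?_
    by_cases hm : m = k
    · subst hm; omega
    · rw [f2 m hm]; simp
  rw [hj] at hent
  have hnb := neighbours_of_entry hadj hent
  rcases Nat.mod_two_eq_zero_or_one D.height with h2 | h2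
  · right
    obtain ⟨n1, n2, n3, n4⟩ := hnb.2 (by omega)
    have hek : D.strongCol < k := by
      have := D'.ht_lt_of_strongCol_lt (k := D.strongCol) (by omega)
      rw [hyk] at this
      by_contra h
      have := this (by omega)
      omega
    have hei : D.strongCol ≤ i.castSucc := by
      by_contra h
      have := n4 D.strongCol (by omega) hek
      omega
    have hDd := depth_of_even h2
    have hi0 : extend D.depth i = 0 := by
      rw [← Fin.val_castSucc, extend_val]
      rcases hei.eq_or_lt with h | h
      · exact ((hDd _).2.1 h.symm).2
      · have := (hDd _).2.2 h
        rw [f2 _ n1.ne] at n2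
        omega
    rw [Fin.le_def, Fin.val_castSucc] at hei
    rw [Fin.lt_def, Fin.val_castSucc] at n1
    have key := depth_addBlock_of_even hD h2 hkr hek hD' hH' hyk hei n1 hi0 fun m hm hm' => by
      have h3 := n4 ⟨m, by omega⟩ (by rw [Fin.lt_def, Fin.val_castSucc]; exact hm)
        (by rw [Fin.lt_def]; exact hm')
      have h4 := (hDd ⟨m, by omega⟩).2.2 (by rw [Fin.lt_def]; simp only; omega)
      rw [f2 _ (by rw [Ne, Fin.ext_iff]; simp only; omega)] at h3
      rw [extend_of_lt _ (by omega)]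
      omega
    exact ⟨_, (depthLinkAt_linkSource hx hx0 hei i.2 hi0).congr (fun m hm => (key m hm).symm)
      fun _ _ => rfl⟩
  · left
    obtain ⟨n1, n2, n3, n4⟩ := hnb.1 (by omega)
    have hke : k < D.strongCol := by
      have := D'.ht_lt_of_lt_strongCol (k := D.strongCol) (by omega)
      rw [hyk] at this
      by_contra h
      have := this (by omega)
      omega
    have hDd : ∀ m : Fin (t + 1), D.ht m + extend D.depth m = D.height := fun m => by
      rw [extend_val, ht_add_depth h2]
    have hDd' : ∀ (m : ℕ) (hm : m ≤ t), D.ht ⟨m, by omega⟩ + extend D.depth m = D.height :=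
      fun m hm => hDd ⟨m, by omega⟩
    have hdk := hDd k
    have hb : ∀ m, k.val < m → m ≤ i.val → 2 ≤ extend D.depth m := fun m hm hm' => by
      have h3 := n4 ⟨m, by omega⟩ hm (by rw [Fin.lt_def, Fin.val_succ]; simp only; omega)
      have h4 := hDd' m (by omega)
      rw [f2 _ (by rw [Ne, Fin.ext_iff]; simp only; omega)] at h3
      omega
    have hsucc : extend D.depth (i + 1) ≤ 1 := by
      have h4 := hDd i.succ
      rw [f2 _ n1.ne'] at n3
      rw [Fin.val_succ] at h4
      omega
    rw [Fin.lt_def, Fin.val_succ] at n1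
    have hlink : DepthLinkAt t (extend D.depth) k i (fun m => if m = k then 0
        else if k < m ∧ m ≤ i.val then extend D.depth m - 2 else extend D.depth m) := by
      refine ⟨by omega, i.2, by omega, fun m hm => ?_, hsucc, by simp, fun m hm hm' => ?_,
        fun m hm hm' => ?_⟩
      · rcases lt_trichotomy m k.val with h | h | h
        · exact hx0.2 m (by rw [Fin.lt_def] at hke; omega)
        · subst h; omega
        · have := hb m h hm; omega
      · have := hb m hm hm'
        rw [if_neg (by omega), if_pos ⟨hm, hm'⟩]
        omega
      · rw [if_neg (by omega), if_neg (by omega)]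
    have key := depth_addBlock_of_odd hx h2 hDd hlink hD'
    exact ⟨_, hlink.congr (fun _ _ => rfl) fun m hm => (key m hm).symm⟩

theorem linkGraph_edge_iff {x y : DiagramClass t} {i : Fin t} :
    (linkGraph t).edge x i y ↔ DepthLink t (extend x.depth) i (extend y.depth) ∨
      DepthLink t (extend y.depth) i (extend x.depth) := by
  constructor
  · rintro (h | h)
    · exact depthLink_of_linkage h
    · exact (depthLink_of_linkage h).symm
  · rintro (h | h)
    · exact Or.inl (linkage_of_depthLink h)
    · exact Or.inr (linkage_of_depthLink h)

end DiagramClass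

/-! ### Links between expansions -/

section

variable {N s i : ℕ} {d d' : ℕ → ℕ}

theorem depthLink_expandPlus_iff (hs : s ≤ N) :
    DepthLink (N + 1) (expandPlus s d) i (expandPlus s d') ↔
      ∃ j, i = skip s j ∧ DepthLink N d j d' := by
  constructor
  · intro h
    refine h.of_expansion hs (isExpansion_expandPlus s d) (isExpansion_expandPlus s d') ?_
    rintro rfl
    have h1 :=
      (h.expansion_self hs (isExpansion_expandPlus i d) (isExpansion_expandPlus i d')).2.2.1
    have h2 := expandPlus_pair i d'
    omega
  · rintro ⟨j, rfl, h⟩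
    exact h.expandPlus hs

theorem depthLink_expandMinus_iff (hs : s ≤ N) :
    DepthLink (N + 1) (expandMinus s d) i (expandMinus s d') ↔
      ∃ j, i = skip s j ∧ DepthLink N d j d' := by
  constructor
  · intro h
    refine h.of_expansion hs (isExpansion_expandMinus s d) (isExpansion_expandMinus s d') ?_
    rintro rfl
    have h1 := h.expansion_self hs (isExpansion_expandMinus i d) (isExpansion_expandMinus i d')
    have h2 := expandMinus_pair i d
    have h3 := h1.1.1
    omega
  · rintro ⟨j, rfl, h⟩
    exact h.expandMinus hs

/-- A link with a label different from `s` preserves the type of an expansion at `s`: the types are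
told apart by the values at `s` and `s + 1`, which are both lowered by `2` or both kept unless the
block is added to one of these columns. -/
theorem eq_of_depthLink_expandPlus_expandMinus (hs : s ≤ N)
    (h : DepthLink (N + 1) (expandPlus s d) i (expandMinus s d')) : i = s := by
  by_contra his
  obtain ⟨k, h⟩ := h
  have p1 := expandPlus_pair s d
  have p2 := expandMinus_pair s d'
  have b1 := h.eq_one
  have b2 := h.eq_zero
  have b3 := h.lower s
  have b4 := h.lower (s + 1)
  have b5 := h.eq s
  have b6 := h.eq (s + 1)
  have b7 := h.le
  have b8 := h.lt
  have b9 := h.ne_zero s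
  have b10 := h.succ_le
  by_cases hk : k = s
  · subst hk; omega
  by_cases hk' : k = s + 1
  · subst hk'; omega
  omega

theorem eq_of_depthLink_expandMinus_expandPlus (hs : s ≤ N)
    (h : DepthLink (N + 1) (expandMinus s d) i (expandPlus s d')) : i = s := by
  by_contra his
  obtain ⟨k, h⟩ := h
  have p1 := expandMinus_pair s d
  have p2 := expandPlus_pair s d'
  have b1 := h.eq_one
  have b2 := h.eq_zero
  have b3 := h.lower s
  have b4 := h.lower (s + 1)
  have b5 := h.eq s
  have b6 := h.eq (s + 1)
  have b7 := h.le
  have b8 := h.lt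
  by_cases hk : k = s
  · subst hk; omega
  by_cases hk' : k = s + 1
  · subst hk'; omega
  omega

theorem not_depthLink_expandMinus_expandPlus (hs : s ≤ N) :
    ¬ DepthLink (N + 1) (expandMinus s d) i (expandPlus s d') := by
  intro h
  obtain rfl := eq_of_depthLink_expandMinus_expandPlus hs h
  have h1 := h.expansion_self hs (isExpansion_expandMinus i d) (isExpansion_expandPlus i d')
  have h2 := expandPlus_pair i d'
  omega

theorem expandPlus_congr (hs : s ≤ N) (h : ∀ m ≤ N, d m = d' m) :
    ∀ m ≤ N + 1, expandPlus s d m = expandPlus s d' m := by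
  intro m hm
  have := h s hs
  rcases index_cases s m with hl | rfl | rfl | ⟨j, hl, rfl⟩
  · rw [expandPlus_lt hl, expandPlus_lt hl, h m (by omega)]
  · rw [expandPlus_self, expandPlus_self, this]
  · rw [expandPlus_succ, expandPlus_succ, this]
  · rw [expandPlus_gt hl, expandPlus_gt hl, h j (by omega)]

theorem expandMinus_congr (hs : s ≤ N) (h : ∀ m ≤ N, d m = d' m) :
    ∀ m ≤ N + 1, expandMinus s d m = expandMinus s d' m := by
  intro m hm
  have := h s hs
  rcases index_cases s m with hl | rfl | rfl | ⟨j, hl, rfl⟩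
  · rw [expandMinus_lt hl, expandMinus_lt hl, h m (by omega)]
  · rw [expandMinus_self, expandMinus_self, this]
  · rw [expandMinus_succ, expandMinus_succ, this]
  · rw [expandMinus_gt hl, expandMinus_gt hl, h j (by omega)]

theorem eq_of_expandPlus_eq (hs : s ≤ N)
    (h : ∀ m ≤ N + 1, expandPlus s d m = expandPlus s d' m) : ∀ m ≤ N, d m = d' m := by
  intro m hm
  rcases lt_trichotomy m s with hl | rfl | hl
  · simpa only [expandPlus_lt hl] using h m (by omega)
  · simpa only [expandPlus_succ] using h (m + 1) (by omega)
  · simpa only [expandPlus_gt hl] using h (m + 1) (by omega)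

theorem eq_of_expandMinus_eq (hs : s ≤ N)
    (h : ∀ m ≤ N + 1, expandMinus s d m = expandMinus s d' m) : ∀ m ≤ N, d m = d' m := by
  intro m hm
  rcases lt_trichotomy m s with hl | rfl | hl
  · simpa only [expandMinus_lt hl] using h m (by omega)
  · simpa only [expandMinus_self] using h m (by omega)
  · simpa only [expandMinus_gt hl] using h (m + 1) (by omega)

theorem not_expandPlus_eq_expandMinus (hs : s ≤ N) :
    ¬ ∀ m ≤ N + 1, expandPlus s d m = expandMinus s d' m := by
  intro h
  have h1 := expandPlus_pair s d
  have h2 := expandMinus_pair s d'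
  have h3 := h s (by omega)
  have h4 := h (s + 1) (by omega)
  omega

theorem depthLink_expandPlus_expandMinus_iff (hs : s ≤ N) :
    DepthLink (N + 1) (expandPlus s d) i (expandMinus s d') ↔
      i = s ∧ IsFirstZero d s ∧ ∀ m ≤ N, d' m = d m := by
  constructor
  · intro h
    obtain rfl := eq_of_depthLink_expandPlus_expandMinus hs h
    have h1 := h.expansion_self hs (isExpansion_expandPlus i d) (isExpansion_expandMinus i d')
    exact ⟨rfl, h1.1, h1.2.2.2⟩
  · rintro ⟨rfl, h, h'⟩
    obtain ⟨k, hk⟩ := depthLink_cross hs h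
    exact ⟨k, hk.congr (fun _ _ => rfl) (expandMinus_congr hs fun m hm => (h' m hm).symm)⟩

end

/-! ### The depth functions of the vertices of `𝒢(c)` -/

theorem val_succAbove {n : ℕ} (s : Fin (n + 1)) (j : Fin n) :
    (s.succAbove j : ℕ) = skip s j := by
  simp only [Fin.succAbove, skip, Fin.lt_def, Fin.val_castSucc]
  split_ifs <;> rfl

theorem extend_skip {n : ℕ} (c : Fin (n + 1) → ℕ) (s : Fin (n + 1)) {i : ℕ} (hi : i < n) :
    extend (fun j => c (s.succAbove j)) i = extend c (skip s i) := by
  rw [extend_of_lt _ hi, ← extend_val c, val_succAbove]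

theorem extend_lt_topIndex {n : ℕ} {c : Fin (n + 1) → ℕ} (hc : Function.Injective c) :
    ∀ i ≤ n, i ≠ (topIndex c : ℕ) → extend c i < extend c (topIndex c) := by
  intro i hi his
  rw [extend_of_lt _ (by omega), extend_val]
  exact LabelledGraph.topIndex_spec hc _ fun h => his (by rw [← h])

/-- The depth function attached to a vertex of `𝒢(c)`: each binary fusion at `s` expands the depth
function at `s`, in the copies `𝒢⁺` and `𝒢⁻` by `expandPlus` and `expandMinus`. -/
noncomputable def fusionDepth : {t : ℕ} → (c : Fin t → ℕ) → FusionVertex t → ℕ → ℕ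
  | 0, _, _ => fun _ => 0
  | _ + 1, c, .inl v =>
    expandPlus (topIndex c) (fusionDepth (fun j => c ((topIndex c).succAbove j)) v)
  | _ + 1, c, .inr v =>
    expandMinus (topIndex c) (fusionDepth (fun j => c ((topIndex c).succAbove j)) v)

theorem tightDepth_fusionDepth : ∀ {t : ℕ} (c : Fin t → ℕ) (v : FusionVertex t),
    TightDepth t (fusionDepth c v)
  | 0, _, _ => ⟨⟨0, le_rfl, rfl⟩, fun _ _ h => absurd rfl h,
      fun _ _ h => absurd h (by simp [fusionDepth])⟩
  | _ + 1, _, .inl v =>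
    (isExpansion_expandPlus _ _).tight (Fin.is_le _) (tightDepth_fusionDepth _ v)
  | _ + 1, _, .inr v =>
    (isExpansion_expandMinus _ _).tight (Fin.is_le _) (tightDepth_fusionDepth _ v)

theorem compatDepth_fusionDepth : ∀ {t : ℕ} {c : Fin t → ℕ}, Function.Injective c →
    ∀ v : FusionVertex t, CompatDepth t (extend c) (fusionDepth c v)
  | 0, _, _, _ => fun p q δ h h' => by omega
  | _ + 1, c, hc, .inl v => (isExpansion_expandPlus _ _).compat (Fin.is_le _)
      (fun i hi => extend_skip c _ hi) (extend_lt_topIndex hc)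
      (compatDepth_fusionDepth (hc.comp Fin.succAbove_right_injective) v)
  | _ + 1, c, hc, .inr v => (isExpansion_expandMinus _ _).compat (Fin.is_le _)
      (fun i hi => extend_skip c _ hi) (extend_lt_topIndex hc)
      (compatDepth_fusionDepth (hc.comp Fin.succAbove_right_injective) v)

theorem fusionDepth_injective : ∀ {t : ℕ} (c : Fin t → ℕ) {v v' : FusionVertex t},
    (∀ m ≤ t, fusionDepth c v m = fusionDepth c v' m) → v = v'
  | 0, _, _, _, _ => rfl
  | _ + 1, _, .inl _, .inl _, h =>
    congrArg Sum.inl (fusionDepth_injective _ (eq_of_expandPlus_eq (Fin.is_le _) h))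
  | _ + 1, _, .inl _, .inr _, h => absurd h (not_expandPlus_eq_expandMinus (Fin.is_le _))
  | _ + 1, _, .inr _, .inl _, h =>
    absurd (fun m hm => (h m hm).symm) (not_expandPlus_eq_expandMinus (Fin.is_le _))
  | _ + 1, _, .inr _, .inr _, h =>
    congrArg Sum.inr (fusionDepth_injective _ (eq_of_expandMinus_eq (Fin.is_le _) h))

/-- Every compatible tight depth function belongs to a vertex of `𝒢(c)`. -/
theorem exists_fusionDepth_eq : ∀ {t : ℕ} {c : Fin t → ℕ}, Function.Injective c → ∀ {d : ℕ → ℕ},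
    TightDepth t d → CompatDepth t (extend c) d →
    ∃ v : FusionVertex t, ∀ m ≤ t, fusionDepth c v m = d m
  | 0, c, _, d, hd, _ => by
    obtain ⟨k, hk, h0⟩ := hd.exists_zero
    refine ⟨Unit.unit, fun m hm => ?_⟩
    rw [show m = k by omega, h0]
    rfl
  | t + 1, c, hc, D, hD, hcD => by
    have hs : (topIndex c : ℕ) ≤ t := Fin.is_le _
    obtain ⟨d, h | h⟩ := exists_expansion hs (extend_lt_topIndex hc) hD hcD
    · obtain rfl : D = expandPlus (topIndex c) d := funext h
      have hE := isExpansion_expandPlus (topIndex c : ℕ) d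
      obtain ⟨v, hv⟩ := exists_fusionDepth_eq (hc.comp Fin.succAbove_right_injective)
        (hE.tight_of hs hD) (hE.compat_of hs (fun i hi => extend_skip c _ hi) hcD)
      exact ⟨.inl v, expandPlus_congr hs hv⟩
    · obtain rfl : D = expandMinus (topIndex c) d := funext h
      have hE := isExpansion_expandMinus (topIndex c : ℕ) d
      obtain ⟨v, hv⟩ := exists_fusionDepth_eq (hc.comp Fin.succAbove_right_injective)
        (hE.tight_of hs hD) (hE.compat_of hs (fun i hi => extend_skip c _ hi) hcD)
      exact ⟨.inr v, expandMinus_congr hs hv⟩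

theorem isFirstZero_vlabel : ∀ {t : ℕ} (c : Fin t → ℕ) (v : FusionVertex t),
    IsFirstZero (fusionDepth c v) ((fusionGraph c).vlabel v)
  | 0, _, _ => ⟨rfl, fun _ hm => absurd hm (Nat.not_lt_zero _)⟩
  | _ + 1, c, .inl v => by
    have h :=
      (isFirstZero_vlabel (fun j => c ((topIndex c).succAbove j)) v).expandPlus (topIndex c)
    have e := val_succAbove (topIndex c).castSucc
      ((fusionGraph fun j => c ((topIndex c).succAbove j)).vlabel v)
    rw [Fin.val_castSucc] at e
    rw [← e] at h
    exact h
  | _ + 1, c, .inr v => by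
    have h :=
      (isFirstZero_vlabel (fun j => c ((topIndex c).succAbove j)) v).expandMinus (topIndex c)
    have e := val_succAbove (topIndex c).succ
      ((fusionGraph fun j => c ((topIndex c).succAbove j)).vlabel v)
    rw [Fin.val_succ] at e
    rw [← e] at h
    exact h

theorem vlabel_eq_iff_isFirstZero {t : ℕ} (c : Fin t → ℕ) (v : FusionVertex t) (s : Fin (t + 1)) :
    (fusionGraph c).vlabel v = s ↔ IsFirstZero (fusionDepth c v) s :=
  ⟨fun h => h ▸ isFirstZero_vlabel c v, fun h => Fin.ext ((isFirstZero_vlabel c v).unique h)⟩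

theorem exists_eq_skip_iff {t : ℕ} {s i : Fin (t + 1)} {P : ℕ → Prop} (hP : ∀ j, P j → j < t) :
    (∃ j, (i : ℕ) = skip s j ∧ P j) ↔ ∃ j : Fin t, P j ∧ i = s.succAbove j := by
  constructor
  · rintro ⟨j, hj, h⟩
    exact ⟨⟨j, hP j h⟩, h, Fin.ext (by rw [val_succAbove, hj])⟩
  · rintro ⟨j, h, rfl⟩
    exact ⟨j, val_succAbove s j, h⟩

theorem DepthLink.label_lt {N i : ℕ} {d d' : ℕ → ℕ} (h : DepthLink N d i d') : i < N :=
  h.elim fun _ h => h.lt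

theorem fusionGraph_edge_iff : ∀ {t : ℕ} (c : Fin t → ℕ) (v : FusionVertex t) (i : Fin t)
    (v' : FusionVertex t), (fusionGraph c).edge v i v' ↔
      DepthLink t (fusionDepth c v) i (fusionDepth c v') ∨
        DepthLink t (fusionDepth c v') i (fusionDepth c v)
  | 0, _, _, i, _ => i.elim0
  | t + 1, c, .inl v, i, .inl v' => by
    refine (LabelledGraph.binaryFusion_edge_inl_inl v v' i).trans ?_
    refine Iff.trans ?_ (or_congr (depthLink_expandPlus_iff (Fin.is_le _))
      (depthLink_expandPlus_iff (Fin.is_le _))).symm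
    rw [exists_eq_skip_iff fun _ => DepthLink.label_lt,
      exists_eq_skip_iff fun _ => DepthLink.label_lt, ← exists_or]
    exact exists_congr fun j => by rw [fusionGraph_edge_iff, or_and_right]
  | t + 1, c, .inr v, i, .inr v' => by
    refine (LabelledGraph.binaryFusion_edge_inr_inr v v' i).trans ?_
    refine Iff.trans ?_ (or_congr (depthLink_expandMinus_iff (Fin.is_le _))
      (depthLink_expandMinus_iff (Fin.is_le _))).symm
    rw [exists_eq_skip_iff fun _ => DepthLink.label_lt,
      exists_eq_skip_iff fun _ => DepthLink.label_lt, ← exists_or]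
    exact exists_congr fun j => by rw [fusionGraph_edge_iff, or_and_right]
  | t + 1, c, .inl v, i, .inr v' => by
    refine (LabelledGraph.binaryFusion_edge_inl_inr v v' i).trans ?_
    refine Iff.trans ?_ (or_congr (depthLink_expandPlus_expandMinus_iff (Fin.is_le _))
      (iff_false_intro (not_depthLink_expandMinus_expandPlus (Fin.is_le _)))).symm
    rw [or_false, vlabel_eq_iff_isFirstZero, Fin.ext_iff]
    exact ⟨fun ⟨h1, h2, h3⟩ => ⟨h2, h3, fun m _ => by rw [h1]⟩,
      fun ⟨h1, h2, h3⟩ => ⟨fusionDepth_injective _ h3, h1, h2⟩⟩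
  | t + 1, c, .inr v', i, .inl v => by
    refine (LabelledGraph.binaryFusion_edge_inr_inl v v' i).trans ?_
    refine Iff.trans ?_ (or_congr
      (iff_false_intro (not_depthLink_expandMinus_expandPlus (Fin.is_le _)))
      (depthLink_expandPlus_expandMinus_iff (Fin.is_le _))).symm
    rw [false_or, vlabel_eq_iff_isFirstZero, Fin.ext_iff]
    exact ⟨fun ⟨h1, h2, h3⟩ => ⟨h2, h3, fun m _ => by rw [h1]⟩,
      fun ⟨h1, h2, h3⟩ => ⟨fusionDepth_injective _ h3, h1, h2⟩⟩

/-! ### The isomorphism between `𝒢(c)` and `𝒢_{H(c)}` -/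

theorem DepthLink.congr {N i : ℕ} {d d' e e' : ℕ → ℕ} (he : ∀ m ≤ N, d m = e m)
    (he' : ∀ m ≤ N, d' m = e' m) : DepthLink N d i d' ↔ DepthLink N e i e' :=
  exists_congr fun _ => ⟨fun h => h.congr he he',
    fun h => h.congr (fun m hm => (he m hm).symm) fun m hm => (he' m hm).symm⟩

/-- The isomorphism maps a vertex of `𝒢(c)` to the class with the same depth function. -/
theorem exists_isLabelledIso_fusionGraph {t : ℕ} {c : Fin t → ℕ} (hc : Function.Injective c) :
    ∃ θ : FusionVertex t → orderClasses c, (fusionGraph c).IsLabelledIso (orderLinkGraph c) θ := by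
  choose f hf using fun v : FusionVertex t =>
    DiagramClass.exists_depth_eq (tightDepth_fusionDepth c v)
  have hmem : ∀ v, f v ∈ orderClasses c := fun v => DiagramClass.mem_orderClasses_iff.2
    ((compatDepth_fusionDepth hc v).congr fun m hm => (hf v m hm).symm)
  refine ⟨fun v => ⟨f v, hmem v⟩, ⟨fun v v' h => ?_, fun x => ?_⟩, fun v => ?_, fun v i v' => ?_⟩
  · have h : f v = f v' := congrArg Subtype.val h
    exact fusionDepth_injective c fun m hm => by rw [← hf v m hm, ← hf v' m hm, h]
  · obtain ⟨v, hv⟩ := exists_fusionDepth_eq hc x.1.tightDepth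
      (DiagramClass.mem_orderClasses_iff.1 x.2)
    exact ⟨v, Subtype.ext (DiagramClass.eq_of_depth fun m hm => by rw [hf v m hm, hv m hm])⟩
  · have h := (f v).isFirstZero_index
    refine ((vlabel_eq_iff_isFirstZero c v _).2 ⟨?_, fun m hm => ?_⟩).symm
    · rw [← hf v _ (Fin.is_le _)]
      exact h.1
    · rw [← hf v m (hm.le.trans (Fin.is_le _))]
      exact h.2 m hm
  · refine DiagramClass.linkGraph_edge_iff.trans ?_
    rw [fusionGraph_edge_iff, DepthLink.congr (hf v) (hf v'), DepthLink.congr (hf v') (hf v)]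

theorem theorem8p5 (t : ℕ) (c : Fin t → ℕ) (hc : Function.Injective c) :
    (∃ θ : FusionVertex t → orderClasses c,
      (fusionGraph c).IsLabelledEmbedding (orderLinkGraph c) θ ∧
      (∀ θ' : FusionVertex t → orderClasses c,
        (fusionGraph c).IsLabelledEmbedding (orderLinkGraph c) θ' → θ' = θ) ∧
      (fusionGraph c).IsLabelledIso (orderLinkGraph c) θ) ∧
    (fusionGraph c).IsSGraph c ∧
    (orderLinkGraph c).IsSGraph c ∧
    Nat.card (orderClasses c) = 2 ^ t := by
  obtain ⟨θ, hθ⟩ := exists_isLabelledIso_fusionGraph hc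
  have hG := LabelledGraph.fusionGraph_isSGraph hc
  have hG' := hθ.isSGraph hG
  have hemb : (fusionGraph c).IsLabelledEmbedding (orderLinkGraph c) θ :=
    ⟨hθ.bijective.1, hθ.map_vlabel, fun v i v' => (hθ.map_edge_iff v i v').2⟩
  exact ⟨⟨θ, hemb, fun θ' h => hemb.unique hG.p4 hG.p5 hG'.p2 hG'.p4 h, hθ⟩, hG, hG',
    (Nat.card_congr (Equiv.ofBijective θ hθ.bijective)).symm.trans (card_fusionVertex t)⟩
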